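/- Consider the equations $$y''=a^3(x,y)\,y'^3+a^2(x,y)\,y'^2+a^1(x,y)\,y'+a^0(x,y)$$ with smooth coefficients, and identify such an equation with the section $(x,y)\mapsto(x,y,a^0,a^1,a^2,a^3)$ of the product bundle $\pi:\mathbb R^2\times\mathbb R^4\to\mathbb R^2$, with base coordinates $x^1=x$, $x^2=y$ and fibre coordinates $u^1,\dots,u^4$ (so $u^{i+1}=a^i$). Let $J^k\pi$ be the manifold of $k$-jets of sections of $\pi$, with standard coordinates $x^j,\ u^i_\sigma$ ($|\sigma|\le k$, $u^i_{j_1\ldots j_r}=\partial^r u^i/\partial x^{j_1}\cdots\partial x^{j_r}$). A point transformation is a diffeomorphism $f$ of an open subset of $\mathbb R^2$ onto an open subset of $\mathbb R^2$; it transforms equations of the above form into equations of the same form by the change of variables $(\tilde x,\tilde y)=f(x,y)$, hence transforms sections, $S\mapsto f_*S$, and acts on jets by $f^{(k)}(j^k_pS)=j^k_{f(p)}(f_*S)$. Let $\Gamma$ be the pseudogroup of all point transformations, acting on each $J^k\pi$ in this way. Define functions on $J^2\pi$ by $$F^1=3u^1_{22}-2u^2_{12}+u^3_{11}+3u^4u^1_1-3u^3u^1_2+2u^2u^2_2-u^2u^3_1-3u^1u^3_2+6u^1u^4_1,$$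 $$F^2=u^2_{22}-2u^3_{12}+3u^4_{11}-3u^1u^4_2+3u^2u^4_1-2u^3u^3_1+u^3u^2_2+3u^4u^2_1-6u^4u^1_2,$$ and a function on $J^3\pi$ by $$F^3=F^2(F^1D_1F^2-F^2D_1F^1)-F^1(F^1D_2F^2-F^2D_2F^1)+(F^1)^3u^4-(F^1)^2F^2u^3+F^1(F^2)^2u^2-(F^2)^3u^1,$$ where $D_j=\partial/\partial x^j+\sum_{\sigma,i}u^i_{\sigma j}\,\partial/\partial u^i_\sigma$ is the total derivative with respect to $x^j$. Then: 1. $J^0\pi$ and $J^1\pi$ are each a single orbit of $\Gamma$. 2. $J^2\pi$ is the union of two orbits of $\Gamma$: a generic (open and dense) orbit given by $(F^1,F^2)\neq(0,0)$, and a degenerate orbit, which is the submanifold of codimension $2$ of $J^2\pi$ given by the equations $F^1=0$, $F^2=0$ (whose differentials $dF^1,dF^2$ are linearly independent at each of its points). 3. $J^3\pi$ is a union of orbits of $\Gamma$, one of which is the generic (open and dense) orbit given by $F^3\neq0$. -/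

import Mathlib

open scoped ContDiff

noncomputable section

namespace PointODE

/-- The base of the bundle, with coordinates `x¹ = p 0` and `x² = p 1`
(in the equation `x = x¹`, `y = x²`). -/
abbrev Plane : Type := Fin 2 → ℝ

/-- The fibre of `π : ℝ² × ℝ⁴ → ℝ²`. The entry with index `i` (`i = 0, 1, 2, 3`) is the coefficient
`aⁱ` of `y'' = a³ y'³ + a² y'² + a¹ y' + a⁰`, that is, the fibre coordinate `uⁱ⁺¹`. -/
abbrev Fibre : Type := Fin 4 → ℝ

/-- The partial derivative `∂g/∂xʲ` (with `j = 0, 1` standing for `x¹, x²`). -/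
def pderiv (j : Fin 2) (g : Plane → ℝ) : Plane → ℝ :=
  fun p => fderiv ℝ g p (Pi.single j 1)

/-- Symmetric multi-indices of length at most `k`: `(a, b)` stands for `1…12…2` with `a` ones and
`b` twos. -/
abbrev MultiIdx (k : ℕ) : Type := {σ : ℕ × ℕ // σ.1 + σ.2 ≤ k}

instance (k : ℕ) : Fintype (MultiIdx k) :=
  Fintype.ofInjective
    (fun σ : MultiIdx k => ((⟨σ.1.1, by have := σ.2; omega⟩,
      ⟨σ.1.2, by have := σ.2; omega⟩) : Fin (k + 1) × Fin (k + 1)))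
    (by
      rintro ⟨⟨a, b⟩, h⟩ ⟨⟨c, d⟩, h'⟩ e
      simp only [Prod.mk.injEq, Fin.mk.injEq] at e
      obtain ⟨rfl, rfl⟩ := e
      rfl)

/-- The jet space `Jᵏπ` in its standard (global) coordinates `(x¹, x², uⁱ_σ)`, `|σ| ≤ k`, with its
topology and smooth structure of a finite-dimensional vector space. -/
abbrev JetSpace (k : ℕ) : Type := Plane × (MultiIdx k → Fibre)

/-- The coordinate `uⁱ⁺¹_σ` of a jet, with `σ` consisting of `a` ones and `b` twos. -/
def JetSpace.u {k : ℕ} (θ : JetSpace k) (i : Fin 4) (a b : ℕ)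
    (h : a + b ≤ k := by decide) : ℝ :=
  θ.2 ⟨(a, b), h⟩ i

/-- The `k`-jet `j_p^k S` of the section `q ↦ (q, S q)` of `π`. -/
def jet (k : ℕ) (S : Plane → Fibre) (p : Plane) : JetSpace k :=
  (p, fun σ i => ((pderiv 0)^[σ.1.1] ((pderiv 1)^[σ.1.2] (fun q => S q i))) p)

/-- A point transformation of `ℝ²`: a smooth diffeomorphism of an open subset of `ℝ²` onto an open
subset of `ℝ²`. -/
def IsPointTransformation (f : OpenPartialHomeomorph Plane Plane) : Prop :=
  ContDiffOn ℝ ∞ f f.source ∧ ContDiffOn ℝ ∞ f.symm f.target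

/-- The functions `Φⁱ`: the coefficients `ã⁰, …, ã³` of the transformed equation at a point `q`, in
terms of the coefficients `a⁰, …, a³` of the original equation at `g q` and of the first
derivatives `d m j = ∂_j gᵐ (q)` and second derivatives `h m j l = ∂_j ∂_l gᵐ (q)` of the inverse
`g = (X, Y)` of the point transformation, i.e. of the substitution `x = X(x̃, ỹ)`, `y = Y(x̃, ỹ)`. -/
def transformedCoeffs (a : Fibre) (d : Fin 2 → Fin 2 → ℝ) (h : Fin 2 → Fin 2 → Fin 2 → ℝ) :
    Fibre :=
  let X1 := d 0 0
  let X2 := d 0 1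
  let Y1 := d 1 0
  let Y2 := d 1 1
  let X11 := h 0 0 0
  let X12 := h 0 0 1
  let X22 := h 0 1 1
  let Y11 := h 1 0 0
  let Y12 := h 1 0 1
  let Y22 := h 1 1 1
  let J := X1 * Y2 - X2 * Y1
  ![(a 0 * X1 ^ 3 + a 1 * X1 ^ 2 * Y1 + a 2 * X1 * Y1 ^ 2 + a 3 * Y1 ^ 3
        - (Y11 * X1 - X11 * Y1)) / J,
    (3 * a 0 * X1 ^ 2 * X2 + a 1 * (2 * X1 * X2 * Y1 + X1 ^ 2 * Y2)
        + a 2 * (X2 * Y1 ^ 2 + 2 * X1 * Y1 * Y2) + 3 * a 3 * Y1 ^ 2 * Y2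
        - (2 * Y12 * X1 + Y11 * X2 - 2 * X12 * Y1 - X11 * Y2)) / J,
    (3 * a 0 * X1 * X2 ^ 2 + a 1 * (X2 ^ 2 * Y1 + 2 * X1 * X2 * Y2)
        + a 2 * (X1 * Y2 ^ 2 + 2 * X2 * Y1 * Y2) + 3 * a 3 * Y1 * Y2 ^ 2
        - (Y22 * X1 + 2 * Y12 * X2 - X22 * Y1 - 2 * X12 * Y2)) / J,
    (a 0 * X2 ^ 3 + a 1 * X2 ^ 2 * Y2 + a 2 * X2 * Y2 ^ 2 + a 3 * Y2 ^ 3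
        - (Y22 * X2 - X22 * Y2)) / J]

/-- The formula for `transformedCoeffs` is the change of variables in the equation. For a curve with
`ỹ' = p`, `ỹ'' = r`, the total derivatives of `X`, `Y` along it are `A = X₁ + X₂ p`,
`B = Y₁ + Y₂ p`, those of `A`, `B` are `A'`, `B'`, and the image curve has `y' = B / A`,
`y'' = (B' A - B A') / A³`. The image satisfies the original equation iff the curve satisfies the
transformed one. -/
theorem transformedCoeffs_spec (a : Fibre) (d : Fin 2 → Fin 2 → ℝ)
    (h : Fin 2 → Fin 2 → Fin 2 → ℝ) (hJ : d 0 0 * d 1 1 - d 0 1 * d 1 0 ≠ 0)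
    (p r A B A' B' : ℝ)
    (hA : A = d 0 0 + d 0 1 * p) (hB : B = d 1 0 + d 1 1 * p)
    (hA' : A' = h 0 0 0 + 2 * h 0 0 1 * p + h 0 1 1 * p ^ 2 + d 0 1 * r)
    (hB' : B' = h 1 0 0 + 2 * h 1 0 1 * p + h 1 1 1 * p ^ 2 + d 1 1 * r)
    (hA0 : A ≠ 0) :
    (B' * A - B * A') / A ^ 3
        = a 3 * (B / A) ^ 3 + a 2 * (B / A) ^ 2 + a 1 * (B / A) + a 0 ↔
      r = transformedCoeffs a d h 3 * p ^ 3 + transformedCoeffs a d h 2 * p ^ 2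
        + transformedCoeffs a d h 1 * p + transformedCoeffs a d h 0 := by
  have e1 : (B' * A - B * A') / A ^ 3
        = a 3 * (B / A) ^ 3 + a 2 * (B / A) ^ 2 + a 1 * (B / A) + a 0 ↔
      B' * A - B * A' = a 3 * B ^ 3 + a 2 * B ^ 2 * A + a 1 * B * A ^ 2 + a 0 * A ^ 3 := by
    rw [div_eq_iff (pow_ne_zero 3 hA0)]
    have : (a 3 * (B / A) ^ 3 + a 2 * (B / A) ^ 2 + a 1 * (B / A) + a 0) * A ^ 3
        = a 3 * B ^ 3 + a 2 * B ^ 2 * A + a 1 * B * A ^ 2 + a 0 * A ^ 3 := by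
      field_simp
    rw [this]
  have e2 : (transformedCoeffs a d h 3 * p ^ 3 + transformedCoeffs a d h 2 * p ^ 2
        + transformedCoeffs a d h 1 * p + transformedCoeffs a d h 0)
        * (d 0 0 * d 1 1 - d 0 1 * d 1 0)
      = a 3 * B ^ 3 + a 2 * B ^ 2 * A + a 1 * B * A ^ 2 + a 0 * A ^ 3
        - (B' * A - B * A') + r * (d 0 0 * d 1 1 - d 0 1 * d 1 0) := by
    have key : ∀ n₀ n₁ n₂ n₃ J : ℝ, J ≠ 0 →
        (n₃ / J * p ^ 3 + n₂ / J * p ^ 2 + n₁ / J * p + n₀ / J) * J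
          = n₃ * p ^ 3 + n₂ * p ^ 2 + n₁ * p + n₀ := by
      intro n₀ n₁ n₂ n₃ J hJ
      field_simp
    simp only [transformedCoeffs, Matrix.cons_val]
    rw [key _ _ _ _ _ hJ]
    subst hA hB hA' hB'
    ring
  rw [e1, ← mul_left_inj' hJ (a := r), e2]
  constructor <;> intro hh <;> linarith

/-- The section `f⁽⁰⁾ ∘ S ∘ f⁻¹` (defined on the image of the domain of `S` under `f`): its value at
`q` is `Φ(S(f⁻¹ q), j_q² f⁻¹)`. -/
def transformSection (f : OpenPartialHomeomorph Plane Plane) (S : Plane → Fibre) :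
    Plane → Fibre :=
  fun q => transformedCoeffs (S (f.symm q))
    (fun m j => pderiv j (fun z => f.symm z m) q)
    (fun m j l => pderiv j (pderiv l (fun z => f.symm z m)) q)

/-- `f⁽ᵏ⁾(θ) = θ'`: the point `p` under `θ` lies in the domain of `f`, and for a smooth section `S`
near `p` with `j_p^k S = θ`, one has `θ' = j_{f(p)}^k (f⁽⁰⁾ ∘ S ∘ f⁻¹)`. -/
def LiftMaps (k : ℕ) (f : OpenPartialHomeomorph Plane Plane) (θ θ' : JetSpace k) : Prop :=
  θ.1 ∈ f.source ∧ ∃ (U : Set Plane) (S : Plane → Fibre), IsOpen U ∧ θ.1 ∈ U ∧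
    ContDiffOn ℝ ∞ S U ∧ jet k S θ.1 = θ ∧ θ' = jet k (transformSection f S) (f θ.1)

/-- `Orb(θ)`: the orbit through `θ` of the pseudogroup of all point transformations acting on
`Jᵏπ` by the lifted transformations. -/
def orbit (k : ℕ) (θ : JetSpace k) : Set (JetSpace k) :=
  {θ' | ∃ f : OpenPartialHomeomorph Plane Plane, IsPointTransformation f ∧ LiftMaps k f θ θ'}

/-- `O ⊆ Jᵏπ` is an orbit: it is non-empty and is the orbit of each of its points. -/
def IsOrbit (k : ℕ) (O : Set (JetSpace k)) : Prop :=
  O.Nonempty ∧ ∀ θ ∈ O, orbit k θ = O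

/-- An orbit is generic if it is open (has codimension `0`) and dense. -/
def IsGenericOrbit (k : ℕ) (O : Set (JetSpace k)) : Prop :=
  IsOrbit k O ∧ IsOpen O ∧ Dense O

/-- `M` is a smooth (embedded) submanifold of codimension `c`: near each of its points it is the
zero set of a smooth submersion to `ℝᶜ`. -/
def IsSubmanifoldOfCodim {E : Type*} [NormedAddCommGroup E] [NormedSpace ℝ E] (c : ℕ)
    (M : Set E) : Prop :=
  ∀ x ∈ M, ∃ (U : Set E) (g : E → Fin c → ℝ), IsOpen U ∧ x ∈ U ∧ ContDiffOn ℝ ∞ g U ∧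
    (∀ y ∈ U, Function.Surjective (fderiv ℝ g y)) ∧ M ∩ U = {y ∈ U | g y = 0}

/-- The function `F¹` on `J²π`; `θ.u i a b` is `uⁱ⁺¹` differentiated `a` times in `x¹` and `b` times
in `x²`. -/
def F1 (θ : JetSpace 2) : ℝ :=
  3 * θ.u 0 0 2 - 2 * θ.u 1 1 1 + θ.u 2 2 0
    + 3 * θ.u 3 0 0 * θ.u 0 1 0 - 3 * θ.u 2 0 0 * θ.u 0 0 1 + 2 * θ.u 1 0 0 * θ.u 1 0 1
    - θ.u 1 0 0 * θ.u 2 1 0 - 3 * θ.u 0 0 0 * θ.u 2 0 1 + 6 * θ.u 0 0 0 * θ.u 3 1 0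

/-- The function `F²` on `J²π`. -/
def F2 (θ : JetSpace 2) : ℝ :=
  θ.u 1 0 2 - 2 * θ.u 2 1 1 + 3 * θ.u 3 2 0
    - 3 * θ.u 0 0 0 * θ.u 3 0 1 + 3 * θ.u 1 0 0 * θ.u 3 1 0 - 2 * θ.u 2 0 0 * θ.u 2 1 0
    + θ.u 2 0 0 * θ.u 1 0 1 + 3 * θ.u 3 0 0 * θ.u 1 1 0 - 6 * θ.u 3 0 0 * θ.u 0 0 1

/-- The projection `π_{k+1,k} : Jᵏ⁺¹π → Jᵏπ`. -/
def proj {k : ℕ} (θ : JetSpace (k + 1)) : JetSpace k :=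
  (θ.1, fun σ => θ.2 ⟨σ.1, Nat.le_succ_of_le σ.2⟩)

/-- The multi-index `σj`. -/
def MultiIdx.snoc {k : ℕ} (σ : MultiIdx k) (j : Fin 2) : MultiIdx (k + 1) :=
  ⟨(σ.1.1 + (if j = 0 then 1 else 0), σ.1.2 + (if j = 0 then 0 else 1)), by
    have := σ.2
    split <;> simp only <;> omega⟩

/-- The total derivative `D_j G = ∂G/∂xʲ + ∑ uⁱ_{σj} ∂G/∂uⁱ_σ`, a function on `Jᵏ⁺¹π`, of a function
`G` on `Jᵏπ`: the derivative of `G` along the vector with components `(e_j, uⁱ_{σj})`. -/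
def totalDeriv {k : ℕ} (j : Fin 2) (G : JetSpace k → ℝ) (θ : JetSpace (k + 1)) : ℝ :=
  fderiv ℝ G (proj θ) ((Pi.single j 1, fun σ => θ.2 (σ.snoc j)) : JetSpace k)

/-- The function `F³` on `J³π`. -/
def F3 (θ : JetSpace 3) : ℝ :=
  let f1 := F1 (proj θ)
  let f2 := F2 (proj θ)
  f2 * (f1 * totalDeriv 0 F2 θ - f2 * totalDeriv 0 F1 θ)
    - f1 * (f1 * totalDeriv 1 F2 θ - f2 * totalDeriv 1 F1 θ)
    + f1 ^ 3 * θ.u 3 0 0 - f1 ^ 2 * f2 * θ.u 2 0 0 + f1 * f2 ^ 2 * θ.u 1 0 0 - f2 ^ 3 * θ.u 0 0 0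

end PointODE

end

open Filter Topology

noncomputable section

namespace PointODE

/-! ### Calculus of partial derivatives of germs of smooth functions -/

/-! The proof has two halves: a transformation law, which makes the sets in question invariant, and
normal forms, which make the action on them transitive.

Invariance. If `g` is the inverse of a point transformation and J its Jacobian determinant, then
(F¹, F²) transforms as a covector times J: the new pair is J · (Dg)ᵀ (F¹, F²) (`covariant`).
Checking this for a general `g` by expansion would be unwieldy. But both the law and the action are
functorial, and locally every `g` is a composite of coordinate swaps and maps (x, y) ↦ (x, Y(x, y)),
for which the law is a short computation. Differentiating the law gives that of D_l Fʲ, and together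
with the transformation of the coefficients it gives F³ ↦ J⁵ F³ (`F3_jet_pull`). Geometrically,
where F² ≠ 0 the kernel of the covector (F¹, F²) has slope p = -F¹/F², and F³ is (F²)³ times the
defect of the integral curves of this direction field from solving the equation; hence its vanishing
is invariant.

Transitivity. A map x + O(|x|ᵏ⁺²) does not change the derivatives of the coefficients of order below
k, and it shifts those of order k by `coeffShift`, a linear function of its 2(k+3) derivatives of
order k + 2. There are 4(k+1) coordinates of order k. For k = 0 (4 against 6) and k = 1 (8 against
8) all of them can be removed, so J⁰π and J¹π are orbits. For k = 2 (12 against 10) two survive, and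
they are the values of F¹, F²; for k = 3 (16 against 12) four survive, and they are fixed by the
values D_l Fʲ. Thus a 2-jet is determined up to equivalence by (F¹, F²), and linear maps bring a
non-zero pair to (1, 0).

On J³π with F³ ≠ 0, take (F¹, F²) = (1, 0) and vanishing coefficients at the point. Then F³ = -D₂F²,
and the remaining freedom, namely linear maps preserving (1, 0) and the two-parameter family of
quadratic terms that keeps the coefficients zero, brings the four numbers D_l Fʲ to fixed values
(`exists_isGenericNormalThree`). -/

theorem pderiv_congr {f g : Plane → ℝ} {p : Plane} (j : Fin 2) (h : f =ᶠ[𝓝 p] g) :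
    pderiv j f =ᶠ[𝓝 p] pderiv j g := by
  filter_upwards [h.fderiv (𝕜 := ℝ)] with z hz
  simp only [pderiv, hz]

theorem contDiffAt_pderiv {f : Plane → ℝ} {p : Plane} (j : Fin 2) (h : ContDiffAt ℝ ∞ f p) :
    ContDiffAt ℝ ∞ (pderiv j f) p :=
  (h.fderiv_right (m := ∞) (by simp)).clm_apply contDiffAt_const

theorem eventually_contDiffAt {E F : Type*} [NormedAddCommGroup E] [NormedSpace ℝ E]
    [NormedAddCommGroup F] [NormedSpace ℝ F] {f : E → F} {p : E} (n : ℕ)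
    (h : ContDiffAt ℝ ∞ f p) : ∀ᶠ z in 𝓝 p, ContDiffAt ℝ n f z :=
  (h.of_le (by exact_mod_cast le_top)).eventually (by simp)

theorem eventually_differentiableAt {E F : Type*} [NormedAddCommGroup E] [NormedSpace ℝ E]
    [NormedAddCommGroup F] [NormedSpace ℝ F] {f : E → F} {p : E} (h : ContDiffAt ℝ ∞ f p) :
    ∀ᶠ z in 𝓝 p, DifferentiableAt ℝ f z := by
  filter_upwards [eventually_contDiffAt 1 h] with z hz
  exact hz.differentiableAt (by simp)

theorem pderiv_add {f g : Plane → ℝ} {p : Plane} (j : Fin 2) (hf : DifferentiableAt ℝ f p)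
    (hg : DifferentiableAt ℝ g p) :
    pderiv j (fun z => f z + g z) p = pderiv j f p + pderiv j g p := by
  simp only [pderiv]
  rw [fderiv_fun_add hf hg]
  rfl

theorem pderiv_sub {f g : Plane → ℝ} {p : Plane} (j : Fin 2) (hf : DifferentiableAt ℝ f p)
    (hg : DifferentiableAt ℝ g p) :
    pderiv j (fun z => f z - g z) p = pderiv j f p - pderiv j g p := by
  simp only [pderiv]
  rw [fderiv_fun_sub hf hg]
  rfl

theorem pderiv_mul {f g : Plane → ℝ} {p : Plane} (j : Fin 2) (hf : DifferentiableAt ℝ f p)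
    (hg : DifferentiableAt ℝ g p) :
    pderiv j (fun z => f z * g z) p = pderiv j f p * g p + f p * pderiv j g p := by
  simp only [pderiv]
  rw [fderiv_fun_mul hf hg]
  simp
  ring

theorem pderiv_inv {f : Plane → ℝ} {p : Plane} (j : Fin 2) (hf : DifferentiableAt ℝ f p)
    (h0 : f p ≠ 0) :
    pderiv j (fun z => (f z)⁻¹) p = -(f p)⁻¹ ^ 2 * pderiv j f p := by
  simp only [pderiv]
  have := ((hasDerivAt_inv h0).comp_hasFDerivAt p hf.hasFDerivAt).fderiv
  simp only [Function.comp_def] at this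
  rw [this]
  simp

@[simp]
theorem pderiv_const (j : Fin 2) (c : ℝ) : pderiv j (fun _ => c) = fun _ => 0 := by
  funext p
  simp [pderiv]

theorem pderiv_coord (j m : Fin 2) (p : Plane) :
    pderiv j (fun z => z m) p = if m = j then 1 else 0 := by
  simp only [pderiv]
  rw [(hasFDerivAt_apply (𝕜 := ℝ) m p).fderiv]
  simp [Pi.single_apply]

theorem pderiv_comp {f : Plane → ℝ} {v : Plane → Plane} {p : Plane} (j : Fin 2)
    (hf : DifferentiableAt ℝ f (v p)) (hv : DifferentiableAt ℝ v p) :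
    pderiv j (fun z => f (v z)) p
      = pderiv 0 f (v p) * pderiv j (fun z => v z 0) p
        + pderiv 1 f (v p) * pderiv j (fun z => v z 1) p := by
  have hc : ∀ m, pderiv j (fun z => v z m) p = fderiv ℝ v p (Pi.single j 1) m := by
    intro m
    simp only [pderiv]
    rw [(hasFDerivAt_pi'.1 hv.hasFDerivAt m).fderiv]
    rfl
  rw [hc, hc]
  simp only [pderiv]
  have := (hf.hasFDerivAt.comp p hv.hasFDerivAt).fderiv
  simp only [Function.comp_def] at this
  rw [this, ContinuousLinearMap.comp_apply]
  generalize fderiv ℝ v p (Pi.single j 1) = w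
  have hw : w = w 0 • (Pi.single 0 1 : Plane) + w 1 • (Pi.single 1 1 : Plane) := by
    ext i
    fin_cases i <;> simp
  conv_lhs => rw [hw]
  simp
  ring

theorem pderiv_comm {f : Plane → ℝ} {p : Plane} (j l : Fin 2) (hf : ContDiffAt ℝ 2 f p) :
    pderiv j (pderiv l f) p = pderiv l (pderiv j f) p := by
  have hs : IsSymmSndFDerivAt ℝ f p := hf.isSymmSndFDerivAt (by simp)
  have hd : DifferentiableAt ℝ (fderiv ℝ f) p :=
    (hf.fderiv_right (m := 1) (by norm_num)).differentiableAt (by simp)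
  have key : ∀ j l : Fin 2, pderiv j (pderiv l f) p
      = fderiv ℝ (fderiv ℝ f) p (Pi.single j 1) (Pi.single l 1) := by
    intro j l
    change fderiv ℝ (fun y => fderiv ℝ f y (Pi.single l 1)) p (Pi.single j 1) = _
    rw [fderiv_clm_apply hd (differentiableAt_const _)]
    simp
  rw [key, key, hs.eq]

theorem pderiv_comm_eventually {f : Plane → ℝ} {p : Plane} (j l : Fin 2)
    (hf : ContDiffAt ℝ ∞ f p) : pderiv j (pderiv l f) =ᶠ[𝓝 p] pderiv l (pderiv j f) := by
  filter_upwards [eventually_contDiffAt 2 hf] with z hz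
  exact pderiv_comm j l hz

/-- The germ at `p` of the smooth function `f` has the smooth partial derivative `f'`. -/
structure HasPD (j : Fin 2) (f f' : Plane → ℝ) (p : Plane) : Prop where
  smooth : ContDiffAt ℝ ∞ f p
  smooth' : ContDiffAt ℝ ∞ f' p
  eq : pderiv j f =ᶠ[𝓝 p] f'

namespace HasPD

variable {j l : Fin 2} {f f' g g' : Plane → ℝ} {p : Plane}

theorem of_contDiffAt (h : ContDiffAt ℝ ∞ f p) : HasPD j f (pderiv j f) p :=
  ⟨h, contDiffAt_pderiv j h, .rfl⟩

theorem congr (h : HasPD j f f' p) (e : f' =ᶠ[𝓝 p] g') : HasPD j f g' p :=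
  ⟨h.smooth, h.smooth'.congr_of_eventuallyEq e.symm, h.eq.trans e⟩

theorem const (c : ℝ) : HasPD j (fun _ => c) (fun _ => 0) p :=
  ⟨contDiffAt_const, contDiffAt_const, by rw [pderiv_const]⟩

theorem add (hf : HasPD j f f' p) (hg : HasPD j g g' p) :
    HasPD j (fun z => f z + g z) (fun z => f' z + g' z) p := by
  refine ⟨hf.smooth.add hg.smooth, hf.smooth'.add hg.smooth', ?_⟩
  filter_upwards [hf.eq, hg.eq, eventually_differentiableAt hf.smooth,
    eventually_differentiableAt hg.smooth] with z h1 h2 h3 h4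
  rw [pderiv_add j h3 h4, h1, h2]

theorem sub (hf : HasPD j f f' p) (hg : HasPD j g g' p) :
    HasPD j (fun z => f z - g z) (fun z => f' z - g' z) p := by
  refine ⟨hf.smooth.sub hg.smooth, hf.smooth'.sub hg.smooth', ?_⟩
  filter_upwards [hf.eq, hg.eq, eventually_differentiableAt hf.smooth,
    eventually_differentiableAt hg.smooth] with z h1 h2 h3 h4
  rw [pderiv_sub j h3 h4, h1, h2]

theorem mul (hf : HasPD j f f' p) (hg : HasPD j g g' p) :
    HasPD j (fun z => f z * g z) (fun z => f' z * g z + f z * g' z) p := by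
  refine ⟨hf.smooth.mul hg.smooth,
    (hf.smooth'.mul hg.smooth).add (hf.smooth.mul hg.smooth'), ?_⟩
  filter_upwards [hf.eq, hg.eq, eventually_differentiableAt hf.smooth,
    eventually_differentiableAt hg.smooth] with z h1 h2 h3 h4
  rw [pderiv_mul j h3 h4, h1, h2]

theorem const_mul (c : ℝ) (hf : HasPD j f f' p) :
    HasPD j (fun z => c * f z) (fun z => c * f' z) p := by
  refine ((HasPD.const c).mul hf).congr (.of_eq ?_)
  funext z
  ring

theorem neg (hf : HasPD j f f' p) : HasPD j (fun z => -f z) (fun z => -f' z) p := by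
  simpa using hf.const_mul (-1)

theorem sq (hf : HasPD j f f' p) :
    HasPD j (fun z => f z ^ 2) (fun z => 2 * f z * f' z) p := by
  have := (hf.mul hf).congr (g' := fun z => 2 * f z * f' z) (.of_eq (by funext z; ring))
  simpa only [← pow_two] using this

theorem cube (hf : HasPD j f f' p) :
    HasPD j (fun z => f z ^ 3) (fun z => 3 * f z ^ 2 * f' z) p := by
  have := (hf.sq.mul hf).congr (g' := fun z => 3 * f z ^ 2 * f' z) (.of_eq (by funext z; ring))
  simpa only [← pow_succ] using this

theorem inv (hf : HasPD j f f' p) (h0 : f p ≠ 0) :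
    HasPD j (fun z => (f z)⁻¹) (fun z => -(f z)⁻¹ ^ 2 * f' z) p := by
  refine ⟨hf.smooth.inv h0, ((hf.smooth.inv h0).pow 2).neg.mul hf.smooth', ?_⟩
  filter_upwards [hf.eq, eventually_differentiableAt hf.smooth,
    hf.smooth.continuousAt.eventually_ne h0] with z h1 h2 h3
  rw [pderiv_inv j h2 h3, h1]

theorem comp {v : Plane → Plane} {v0 v1 : Plane → ℝ} (hf : ContDiffAt ℝ ∞ f (v p))
    (hv : ContDiffAt ℝ ∞ v p) (h0 : HasPD j (fun z => v z 0) v0 p)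
    (h1 : HasPD j (fun z => v z 1) v1 p) :
    HasPD j (fun z => f (v z))
      (fun z => pderiv 0 f (v z) * v0 z + pderiv 1 f (v z) * v1 z) p := by
  refine ⟨hf.comp p hv, (((contDiffAt_pderiv 0 hf).comp p hv).mul h0.smooth').add
    (((contDiffAt_pderiv 1 hf).comp p hv).mul h1.smooth'), ?_⟩
  filter_upwards [h0.eq, h1.eq, hv.continuousAt.eventually (eventually_differentiableAt hf),
    eventually_differentiableAt hv] with z e0 e1 h2 h3
  rw [pderiv_comp j h2 h3, e0, e1]

theorem value (h : HasPD j f f' p) : pderiv j f p = f' p := h.eq.eq_of_nhds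

/-- Derivatives are recorded as identities of germs, so they can be differentiated again. -/
theorem value₂ (h : HasPD j f f' p) (h' : HasPD l f' g' p) :
    pderiv l (pderiv j f) p = g' p :=
  ((pderiv_congr l h.eq).trans h'.eq).eq_of_nhds

end HasPD

theorem contDiffAt_coord (m : Fin 2) (p : Plane) : ContDiffAt ℝ ∞ (fun z : Plane => z m) p :=
  (contDiff_apply ℝ ℝ m).contDiffAt

/-! ### Iterated partial derivatives -/

/-- The partial derivative `∂₁ᵃ∂₂ᵇ f (p)`. -/
def partials (a b : ℕ) (f : Plane → ℝ) (p : Plane) : ℝ :=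
  ((pderiv 0)^[a] ((pderiv 1)^[b] f)) p

theorem jet_snd_apply (k : ℕ) (S : Plane → Fibre) (p : Plane) (σ : MultiIdx k) (i : Fin 4) :
    (jet k S p).2 σ i = partials σ.1.1 σ.1.2 (fun q => S q i) p := rfl

theorem iterate_pderiv_congr {f g : Plane → ℝ} {p : Plane} (j : Fin 2) (n : ℕ)
    (h : f =ᶠ[𝓝 p] g) : (pderiv j)^[n] f =ᶠ[𝓝 p] (pderiv j)^[n] g := by
  induction n with
  | zero => exact h
  | succ n ih =>
    rw [Function.iterate_succ_apply', Function.iterate_succ_apply']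
    exact pderiv_congr j ih

theorem contDiffAt_iterate_pderiv {f : Plane → ℝ} {p : Plane} (j : Fin 2) (n : ℕ)
    (h : ContDiffAt ℝ ∞ f p) : ContDiffAt ℝ ∞ ((pderiv j)^[n] f) p := by
  induction n with
  | zero => exact h
  | succ n ih =>
    rw [Function.iterate_succ_apply']
    exact contDiffAt_pderiv j ih

theorem contDiffAt_partials {f : Plane → ℝ} {p : Plane} (a b : ℕ) (h : ContDiffAt ℝ ∞ f p) :
    ContDiffAt ℝ ∞ (partials a b f) p :=
  contDiffAt_iterate_pderiv 0 a (contDiffAt_iterate_pderiv 1 b h)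

theorem iterate_pderiv_comm {f : Plane → ℝ} {p : Plane} (j l : Fin 2) (n : ℕ)
    (h : ContDiffAt ℝ ∞ f p) :
    (pderiv j)^[n] (pderiv l f) =ᶠ[𝓝 p] pderiv l ((pderiv j)^[n] f) := by
  induction n with
  | zero => exact .rfl
  | succ n ih =>
    rw [Function.iterate_succ_apply', Function.iterate_succ_apply']
    exact (pderiv_congr j ih).trans
      (pderiv_comm_eventually j l (contDiffAt_iterate_pderiv j n h))

theorem partials_congr {f g : Plane → ℝ} {p : Plane} (a b : ℕ) (h : f =ᶠ[𝓝 p] g) :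
    partials a b f =ᶠ[𝓝 p] partials a b g :=
  iterate_pderiv_congr 0 a (iterate_pderiv_congr 1 b h)

/-- In `partials` the derivatives ∂₂ are applied first. An innermost ∂₁ must therefore be commuted
past them, which uses smoothness; an innermost ∂₂ is absorbed by definition. -/
theorem partials_pderiv_zero {f : Plane → ℝ} {p : Plane} (a b : ℕ) (h : ContDiffAt ℝ ∞ f p) :
    partials a b (pderiv 0 f) p = partials (a + 1) b f p := by
  simp only [partials]
  rw [(iterate_pderiv_congr 0 a (iterate_pderiv_comm 1 0 b h)).eq_of_nhds,
    Function.iterate_succ_apply]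

theorem partials_pderiv_one (f : Plane → ℝ) (p : Plane) (a b : ℕ) :
    partials a b (pderiv 1 f) p = partials a (b + 1) f p := by
  simp only [partials, Function.iterate_succ_apply]

theorem pderiv_zero_partials (f : Plane → ℝ) (a b : ℕ) :
    pderiv 0 (partials a b f) = partials (a + 1) b f := by
  funext p
  simp only [partials]
  rw [Function.iterate_succ_apply']
  rfl

theorem pderiv_one_partials {f : Plane → ℝ} {p : Plane} (a b : ℕ) (h : ContDiffAt ℝ ∞ f p) :
    pderiv 1 (partials a b f) p = partials a (b + 1) f p := by
  have := (iterate_pderiv_comm 0 1 a (contDiffAt_iterate_pderiv 1 b h)).eq_of_nhds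
  simp only [partials]
  rw [Function.iterate_succ_apply']
  exact this.symm

theorem iterate_pderiv_add {f g : Plane → ℝ} {p : Plane} (j : Fin 2) (n : ℕ)
    (hf : ContDiffAt ℝ ∞ f p) (hg : ContDiffAt ℝ ∞ g p) :
    (pderiv j)^[n] (fun z => f z + g z)
      =ᶠ[𝓝 p] fun z => (pderiv j)^[n] f z + (pderiv j)^[n] g z := by
  induction n with
  | zero => exact .rfl
  | succ n ih =>
    simp only [Function.iterate_succ_apply']
    exact (pderiv_congr j ih).trans
      ((HasPD.of_contDiffAt (contDiffAt_iterate_pderiv j n hf)).add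
        (HasPD.of_contDiffAt (contDiffAt_iterate_pderiv j n hg))).eq

theorem iterate_pderiv_const_mul {f : Plane → ℝ} {p : Plane} (j : Fin 2) (n : ℕ) (c : ℝ)
    (hf : ContDiffAt ℝ ∞ f p) :
    (pderiv j)^[n] (fun z => c * f z) =ᶠ[𝓝 p] fun z => c * (pderiv j)^[n] f z := by
  induction n with
  | zero => exact .rfl
  | succ n ih =>
    simp only [Function.iterate_succ_apply']
    exact (pderiv_congr j ih).trans
      ((HasPD.of_contDiffAt (contDiffAt_iterate_pderiv j n hf)).const_mul c).eq

theorem partials_add {f g : Plane → ℝ} {p : Plane} (a b : ℕ)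
    (hf : ContDiffAt ℝ ∞ f p) (hg : ContDiffAt ℝ ∞ g p) :
    partials a b (fun z => f z + g z) p = partials a b f p + partials a b g p := by
  have h1 := iterate_pderiv_congr 0 a (iterate_pderiv_add 1 b hf hg)
  exact (h1.trans (iterate_pderiv_add 0 a (contDiffAt_iterate_pderiv 1 b hf)
    (contDiffAt_iterate_pderiv 1 b hg))).eq_of_nhds

theorem partials_const_mul {f : Plane → ℝ} {p : Plane} (a b : ℕ) (c : ℝ)
    (hf : ContDiffAt ℝ ∞ f p) :
    partials a b (fun z => c * f z) p = c * partials a b f p := by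
  have h1 := iterate_pderiv_congr 0 a (iterate_pderiv_const_mul 1 b c hf)
  exact (h1.trans (iterate_pderiv_const_mul 0 a c
    (contDiffAt_iterate_pderiv 1 b hf))).eq_of_nhds

theorem partials_sub {f g : Plane → ℝ} {p : Plane} (a b : ℕ)
    (hf : ContDiffAt ℝ ∞ f p) (hg : ContDiffAt ℝ ∞ g p) :
    partials a b (fun z => f z - g z) p = partials a b f p - partials a b g p := by
  have h1 := partials_add a b hf (contDiffAt_const (c := (-1 : ℝ)).mul hg)
  rw [partials_const_mul a b (-1) hg] at h1
  rw [sub_eq_add_neg, ← neg_one_mul, ← h1]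
  congr 1
  funext z
  ring

theorem iterate_pderiv_comp_add (f : Plane → ℝ) (c : Plane) (j : Fin 2) (n : ℕ) :
    (pderiv j)^[n] (fun z => f (z + c)) = fun z => (pderiv j)^[n] f (z + c) := by
  induction n generalizing f with
  | zero => rfl
  | succ n ih =>
    simp only [Function.iterate_succ_apply]
    rw [← ih]
    congr 1
    funext z
    simp only [pderiv]
    rw [fderiv_comp_add_right]

theorem partials_comp_add (f : Plane → ℝ) (c : Plane) (a b : ℕ) (p : Plane) :
    partials a b (fun z => f (z + c)) p = partials a b f (p + c) := by
  simp only [partials, iterate_pderiv_comp_add]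

/-! ### Order of contact -/

/-- The smooth germs `f` and `g` at `p` have the same partial derivatives of order less than `n`. -/
structure Contact (n : ℕ) (p : Plane) (f g : Plane → ℝ) : Prop where
  left : ContDiffAt ℝ ∞ f p
  right : ContDiffAt ℝ ∞ g p
  vanishes : ∀ a b, a + b < n → partials a b f p = partials a b g p

namespace Contact

variable {n : ℕ} {p : Plane} {f g h f' g' : Plane → ℝ}

theorem refl (hf : ContDiffAt ℝ ∞ f p) : Contact n p f f := ⟨hf, hf, fun _ _ _ => rfl⟩

theorem of_eventuallyEq (hf : ContDiffAt ℝ ∞ f p) (e : f =ᶠ[𝓝 p] g) : Contact n p f g :=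
  ⟨hf, hf.congr_of_eventuallyEq e.symm, fun a b _ => (partials_congr a b e).eq_of_nhds⟩

theorem symm (h : Contact n p f g) : Contact n p g f :=
  ⟨h.right, h.left, fun a b hab => (h.vanishes a b hab).symm⟩

theorem trans (h₁ : Contact n p f g) (h₂ : Contact n p g h) : Contact n p f h :=
  ⟨h₁.left, h₂.right, fun a b hab => (h₁.vanishes a b hab).trans (h₂.vanishes a b hab)⟩

theorem mono {m : ℕ} (h : Contact n p f g) (hm : m ≤ n) : Contact m p f g :=
  ⟨h.left, h.right, fun a b hab => h.vanishes a b (hab.trans_le hm)⟩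

theorem value (h : Contact (n + 1) p f g) : f p = g p := h.vanishes 0 0 (by omega)

theorem pderiv (h : Contact (n + 1) p f g) (j : Fin 2) :
    Contact n p (pderiv j f) (pderiv j g) := by
  refine ⟨contDiffAt_pderiv j h.left, contDiffAt_pderiv j h.right, fun a b hab => ?_⟩
  match j with
  | 0 =>
    rw [partials_pderiv_zero _ _ h.left, partials_pderiv_zero _ _ h.right]
    exact h.vanishes _ _ (by omega)
  | 1 =>
    rw [partials_pderiv_one, partials_pderiv_one]
    exact h.vanishes _ _ (by omega)

/-- The induction principle behind the product and chain rules for contact: contact passes to first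
derivatives at the cost of one order, and conversely. -/
theorem succ (hf : ContDiffAt ℝ ∞ f p) (hg : ContDiffAt ℝ ∞ g p) (h0 : f p = g p)
    (h : ∀ j, Contact n p (PointODE.pderiv j f) (PointODE.pderiv j g)) : Contact (n + 1) p f g := by
  refine ⟨hf, hg, fun a b hab => ?_⟩
  rcases a with _ | a
  · rcases b with _ | b
    · exact h0
    · have := (h 1).vanishes 0 b (by omega)
      rwa [partials_pderiv_one, partials_pderiv_one] at this
  · have := (h 0).vanishes a b (by omega)
    rwa [partials_pderiv_zero _ _ hf, partials_pderiv_zero _ _ hg] at this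

theorem add (h : Contact n p f g) (h' : Contact n p f' g') :
    Contact n p (fun z => f z + f' z) (fun z => g z + g' z) :=
  ⟨h.left.add h'.left, h.right.add h'.right, fun a b hab => by
    rw [partials_add a b h.left h'.left, partials_add a b h.right h'.right,
      h.vanishes a b hab, h'.vanishes a b hab]⟩

theorem sub (h : Contact n p f g) (h' : Contact n p f' g') :
    Contact n p (fun z => f z - f' z) (fun z => g z - g' z) :=
  ⟨h.left.sub h'.left, h.right.sub h'.right, fun a b hab => by
    rw [partials_sub a b h.left h'.left, partials_sub a b h.right h'.right,
      h.vanishes a b hab, h'.vanishes a b hab]⟩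

/-- Induction on the order: by the Leibniz rule the first derivatives are sums of products of pairs
in contact to one order less. -/
theorem mul (h : Contact n p f g) (h' : Contact n p f' g') :
    Contact n p (fun z => f z * f' z) (fun z => g z * g' z) := by
  induction n generalizing f g f' g' with
  | zero => exact ⟨h.left.mul h'.left, h.right.mul h'.right, fun _ _ h => by omega⟩
  | succ n ih =>
    refine succ (h.left.mul h'.left) (h.right.mul h'.right) ?_ fun j => ?_
    · simp only [h.value, h'.value]
    · have e₁ := (HasPD.of_contDiffAt (j := j) h.left).mul (HasPD.of_contDiffAt h'.left)
      have e₂ := (HasPD.of_contDiffAt (j := j) h.right).mul (HasPD.of_contDiffAt h'.right)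
      have hm := h.mono (Nat.le_succ n)
      have hm' := h'.mono (Nat.le_succ n)
      exact ((of_eventuallyEq e₁.smooth' e₁.eq.symm).symm.trans
        ((ih (h.pderiv j) hm').add (ih hm (h'.pderiv j)))).trans
          (of_eventuallyEq e₂.smooth' e₂.eq.symm)

theorem const (c : ℝ) : Contact n p (fun _ => c) (fun _ => c) := refl contDiffAt_const

theorem pow (h : Contact n p f g) (m : ℕ) :
    Contact n p (fun z => f z ^ m) (fun z => g z ^ m) := by
  induction m with
  | zero => simpa using const 1
  | succ m ih => simpa only [pow_succ] using ih.mul h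

theorem inv (h : Contact n p f g) (hf : f p ≠ 0) (hg : g p ≠ 0) :
    Contact n p (fun z => (f z)⁻¹) (fun z => (g z)⁻¹) := by
  have hif := h.left.inv hf
  have hig := h.right.inv hg
  -- Multiplying the contact of g and f by 1/f and 1/g turns it into the contact of 1/f and 1/g, so
  -- no derivative of an inverse is needed.
  have key := ((refl (n := n) hif).mul h.symm).mul (refl hig)
  have ef : (fun z => (f z)⁻¹ * g z * (g z)⁻¹) =ᶠ[𝓝 p] fun z => (f z)⁻¹ := by
    filter_upwards [h.right.continuousAt.eventually_ne hg] with z hz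
    field_simp
  have eg : (fun z => (f z)⁻¹ * f z * (g z)⁻¹) =ᶠ[𝓝 p] fun z => (g z)⁻¹ := by
    filter_upwards [h.left.continuousAt.eventually_ne hf] with z hz
    field_simp
  exact ((of_eventuallyEq key.left ef).symm.trans key).trans (of_eventuallyEq key.right eg)

theorem div (h : Contact n p f g) (h' : Contact n p f' g') (hf : f' p ≠ 0) (hg : g' p ≠ 0) :
    Contact n p (fun z => f z / f' z) (fun z => g z / g' z) := by
  simpa only [div_eq_mul_inv] using h.mul (h'.inv hf hg)

theorem comp {f g : Plane → ℝ} {u v : Plane → Plane} (hfg : Contact n (u p) f g) (huv : u p = v p)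
    (hu : ContDiffAt ℝ ∞ u p) (hv : ContDiffAt ℝ ∞ v p)
    (h : ∀ m, Contact n p (fun z => u z m) (fun z => v z m)) :
    Contact n p (fun z => f (u z)) (fun z => g (v z)) := by
  have hf := hfg.left
  have hg : ContDiffAt ℝ ∞ g (v p) := huv ▸ hfg.right
  induction n generalizing f g with
  | zero => exact ⟨hf.comp p hu, hg.comp p hv, fun _ _ h => by omega⟩
  | succ n ih =>
    have hm : ∀ m, Contact n p (fun z => u z m) (fun z => v z m) :=
      fun m => (h m).mono (Nat.le_succ n)
    refine succ (hf.comp p hu) (hg.comp p hv) ?_ fun j => ?_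
    · exact hfg.value.trans (congrArg g huv)
    · have e₁ := HasPD.comp (j := j) hf hu (.of_contDiffAt (h 0).left) (.of_contDiffAt (h 1).left)
      have e₂ := HasPD.comp (j := j) hg hv (.of_contDiffAt (h 0).right) (.of_contDiffAt (h 1).right)
      have hp : ∀ m, Contact n p (fun z => PointODE.pderiv m f (u z))
          (fun z => PointODE.pderiv m g (v z)) := fun m =>
        ih (hfg.pderiv m) hm (hfg.pderiv m).left (contDiffAt_pderiv m hg)
      exact ((of_eventuallyEq e₁.smooth' e₁.eq.symm).symm.trans
        (((hp 0).mul ((h 0).pderiv j)).add ((hp 1).mul ((h 1).pderiv j)))).trans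
          (of_eventuallyEq e₂.smooth' e₂.eq.symm)

end Contact

/-- The shift to `k + 1` arises because `Contact n` concerns the orders strictly below `n`. -/
theorem jet_eq_iff {k : ℕ} {S T : Plane → Fibre} {p : Plane} (hS : ContDiffAt ℝ ∞ S p)
    (hT : ContDiffAt ℝ ∞ T p) :
    jet k S p = jet k T p ↔ ∀ i, Contact (k + 1) p (fun z => S z i) (fun z => T z i) := by
  constructor
  · intro h i
    refine ⟨contDiffAt_pi.1 hS i, contDiffAt_pi.1 hT i, fun a b hab => ?_⟩
    exact congrFun (congrFun (congrArg Prod.snd h) ⟨(a, b), Nat.lt_succ_iff.1 hab⟩) i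
  · intro h
    refine Prod.ext rfl (funext fun σ => funext fun i => ?_)
    exact (h i).vanishes _ _ (Nat.lt_succ_iff.2 σ.2)

theorem jet_congr {k : ℕ} {S T : Plane → Fibre} {p : Plane} (h : S =ᶠ[𝓝 p] T) :
    jet k S p = jet k T p := by
  refine Prod.ext rfl (funext fun σ => funext fun i => ?_)
  refine (partials_congr σ.1.1 σ.1.2 (f := fun z => S z i) (g := fun z => T z i) ?_).eq_of_nhds
  filter_upwards [h] with z hz
  rw [hz]

/-! ### The action of maps of the plane on sections -/

/-- The section `S` transformed by the inverse of the local diffeomorphism `g`. -/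
def pull (g : Plane → Plane) (S : Plane → Fibre) : Plane → Fibre :=
  fun q => transformedCoeffs (S (g q)) (fun m j => pderiv j (fun z => g z m) q)
    (fun m j l => pderiv j (pderiv l (fun z => g z m)) q)

theorem transformSection_eq_pull (f : OpenPartialHomeomorph Plane Plane) (S : Plane → Fibre) :
    transformSection f S = pull f.symm S := rfl

/-- The determinant of a `2 × 2` array. -/
def det2 (d : Fin 2 → Fin 2 → ℝ) : ℝ := d 0 0 * d 1 1 - d 0 1 * d 1 0

/-- The Jacobian determinant of a map of the plane. -/
def jac (g : Plane → Plane) (q : Plane) : ℝ := det2 fun m j => pderiv j (fun z => g z m) q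

theorem transformedCoeffs_contact {n : ℕ} {q : Plane} {a a' : Plane → Fibre}
    {d d' : Fin 2 → Fin 2 → Plane → ℝ} {h h' : Fin 2 → Fin 2 → Fin 2 → Plane → ℝ}
    (ha : ∀ i, Contact n q (fun z => a z i) (fun z => a' z i))
    (hd : ∀ m j, Contact n q (d m j) (d' m j))
    (hh : ∀ m j l, Contact n q (h m j l) (h' m j l))
    (h0 : det2 (fun m j => d m j q) ≠ 0) (h0' : det2 (fun m j => d' m j q) ≠ 0) (i : Fin 4) :
    Contact n q
      (fun z => transformedCoeffs (a z) (fun m j => d m j z) (fun m j l => h m j l z) i)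
      (fun z => transformedCoeffs (a' z) (fun m j => d' m j z) (fun m j l => h' m j l z) i) := by
  have hJ : Contact n q (fun z => d 0 0 z * d 1 1 z - d 0 1 z * d 1 0 z)
      (fun z => d' 0 0 z * d' 1 1 z - d' 0 1 z * d' 1 0 z) :=
    ((hd 0 0).mul (hd 1 1)).sub ((hd 0 1).mul (hd 1 0))
  fin_cases i <;> simp only [transformedCoeffs, Matrix.cons_val, Fin.zero_eta, Fin.mk_one,
    Fin.reduceFinMk] <;> refine Contact.div ?_ hJ h0 h0' <;>
  · repeat' first
      | exact ha _
      | exact hd _ _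
      | exact hh _ _ _
      | exact Contact.const _
      | refine Contact.pow ?_ _
      | refine Contact.sub ?_ ?_
      | refine Contact.add ?_ ?_
      | refine Contact.mul ?_ ?_

/-- Two more orders are needed for the maps than for the sections, since second derivatives of the
map enter the transformed coefficients. -/
theorem pull_contact {n : ℕ} {q : Plane} {g g' : Plane → Plane} {S S' : Plane → Fibre}
    (hg : ContDiffAt ℝ ∞ g q) (hg' : ContDiffAt ℝ ∞ g' q)
    (h : ∀ m, Contact (n + 2) q (fun z => g z m) (fun z => g' z m))
    (hS : ∀ i, Contact n (g q) (fun z => S z i) (fun z => S' z i)) (h0 : jac g q ≠ 0) (i : Fin 4) :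
    Contact n q (fun z => pull g S z i) (fun z => pull g' S' z i) := by
  have e : jac g q = jac g' q := by
    simp only [jac, ((h _).pderiv _).value]
  refine transformedCoeffs_contact
    (a := fun z => S (g z)) (a' := fun z => S' (g' z))
    (d := fun m j => pderiv j fun z => g z m) (d' := fun m j => pderiv j fun z => g' z m)
    (h := fun m j l => pderiv j (pderiv l fun z => g z m))
    (h' := fun m j l => pderiv j (pderiv l fun z => g' z m)) (fun i => ?_)
    (fun m j => ((h m).pderiv j).mono (Nat.le_succ n)) (fun m j l => ((h m).pderiv l).pderiv j)
    h0 (fun h1 => h0 (e.trans h1)) i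
  exact (hS i).comp (f := fun z => S z i) (g := fun z => S' z i)
    (funext fun m => (h m).value) hg hg' fun m => (h m).mono (by omega)

theorem contDiffAt_pull {q : Plane} {g : Plane → Plane} {S : Plane → Fibre}
    (hg : ContDiffAt ℝ ∞ g q) (hS : ContDiffAt ℝ ∞ S (g q)) (h0 : jac g q ≠ 0) :
    ContDiffAt ℝ ∞ (pull g S) q :=
  contDiffAt_pi.2 fun i => (pull_contact (n := 0) (S' := S) hg hg
    (fun m => .refl (contDiffAt_pi.1 hg m)) (fun i => .refl (contDiffAt_pi.1 hS i)) h0 i).left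

/-- This makes the lifted action on jets independent of the section chosen to represent a jet. -/
theorem jet_pull_congr {k : ℕ} {q : Plane} {g : Plane → Plane} {S S' : Plane → Fibre}
    (hg : ContDiffAt ℝ ∞ g q) (hS : ContDiffAt ℝ ∞ S (g q)) (hS' : ContDiffAt ℝ ∞ S' (g q))
    (h : jet k S (g q) = jet k S' (g q)) (h0 : jac g q ≠ 0) :
    jet k (pull g S) q = jet k (pull g S') q :=
  (jet_eq_iff (contDiffAt_pull hg hS h0) (contDiffAt_pull hg hS' h0)).2
    (pull_contact hg hg (fun m => .refl (contDiffAt_pi.1 hg m)) ((jet_eq_iff hS hS').1 h) h0)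

theorem pull_congr {q : Plane} {g g' : Plane → Plane} {S S' : Plane → Fibre}
    (hg : g =ᶠ[𝓝 q] g') (hc : ContinuousAt g q) (hS : S =ᶠ[𝓝 (g q)] S') :
    pull g S =ᶠ[𝓝 q] pull g' S' := by
  have h0 : ∀ m, (fun z => g z m) =ᶠ[𝓝 q] fun z => g' z m := fun m => by
    filter_upwards [hg] with z hz
    rw [hz]
  have h1 : ∀ᶠ z in 𝓝 q, ∀ m j, pderiv j (fun z => g z m) z = pderiv j (fun z => g' z m) z :=
    eventually_all.2 fun m => eventually_all.2 fun j => pderiv_congr j (h0 m)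
  have h2 : ∀ᶠ z in 𝓝 q, ∀ m j l, pderiv j (pderiv l (fun z => g z m)) z
      = pderiv j (pderiv l (fun z => g' z m)) z :=
    eventually_all.2 fun m => eventually_all.2 fun j => eventually_all.2 fun l =>
      pderiv_congr j (pderiv_congr l (h0 m))
  filter_upwards [h1, h2, hg, hc.eventually hS] with z e1 e2 e3 e4
  simp only [pull, e1, e2, e4]
  rw [e3]

theorem jac_congr {q : Plane} {g g' : Plane → Plane} (hg : g =ᶠ[𝓝 q] g') :
    jac g q = jac g' q := by
  have h0 : ∀ m, (fun z => g z m) =ᶠ[𝓝 q] fun z => g' z m := fun m => by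
    filter_upwards [hg] with z hz
    rw [hz]
  simp only [jac, (pderiv_congr _ (h0 _)).eq_of_nhds]

theorem jac_id (q : Plane) : jac (fun z => z) q = 1 := by
  simp [jac, det2, pderiv_coord]

theorem pull_id (S : Plane → Fibre) : pull (fun z => z) S = S := by
  have h : ∀ m j : Fin 2, pderiv j (fun z => z m) = fun _ => if m = j then 1 else 0 :=
    fun m j => funext fun p => pderiv_coord j m p
  funext q i
  simp only [pull, h, pderiv_const]
  fin_cases i <;> simp [transformedCoeffs]

theorem jac_comp {q : Plane} {g h : Plane → Plane} (hg : DifferentiableAt ℝ g (h q))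
    (hh : DifferentiableAt ℝ h q) : jac (fun z => g (h z)) q = jac g (h q) * jac h q := by
  simp only [jac, det2, pderiv_comp (f := fun z => g z _) _ (differentiableAt_pi.1 hg _) hh]
  ring

/-- Functoriality of the change of variables; on the right stand the first and second derivatives of
the composite, as given by the chain rule. Up to the Jacobian factor and the inhomogeneous terms,
the coefficients are those of a binary cubic form. Hence the multipliers in the proof are the
coefficients of cubic monomials after the substitution `d'`. -/
theorem transformedCoeffs_transformedCoeffs (a : Fibre) (d d' : Fin 2 → Fin 2 → ℝ)
    (h h' : Fin 2 → Fin 2 → Fin 2 → ℝ) (h0 : det2 d ≠ 0) (h0' : det2 d' ≠ 0)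
    (hs : ∀ m, h m 1 0 = h m 0 1) :
    transformedCoeffs (transformedCoeffs a d h) d' h'
      = transformedCoeffs a (fun m j => d m 0 * d' 0 j + d m 1 * d' 1 j)
        (fun m j l => (h m 0 0 * d' 0 j + h m 1 0 * d' 1 j) * d' 0 l + d m 0 * h' 0 j l
          + ((h m 0 1 * d' 0 j + h m 1 1 * d' 1 j) * d' 1 l + d m 1 * h' 1 j l)) := by
  have hJ : (d 0 0 * d' 0 0 + d 0 1 * d' 1 0) * (d 1 0 * d' 0 1 + d 1 1 * d' 1 1)
      - (d 0 0 * d' 0 1 + d 0 1 * d' 1 1) * (d 1 0 * d' 0 0 + d 1 1 * d' 1 0)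
      = (d 0 0 * d 1 1 - d 0 1 * d 1 0) * (d' 0 0 * d' 1 1 - d' 0 1 * d' 1 0) := by
    ring
  simp only [det2] at h0 h0'
  -- The inner coefficients stay opaque and are known only through equations cleared of the
  -- denominator det d, so nested fractions never appear.
  obtain ⟨t, ht⟩ : ∃ t, t = transformedCoeffs a d h := ⟨_, rfl⟩
  rw [← ht]
  have e0 := congrFun ht 0
  have e1 := congrFun ht 1
  have e2 := congrFun ht 2
  have e3 := congrFun ht 3
  simp only [transformedCoeffs, Matrix.cons_val] at e0 e1 e2 e3
  rw [eq_div_iff h0] at e0 e1 e2 e3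
  clear ht
  funext i
  fin_cases i <;> simp only [transformedCoeffs, Matrix.cons_val, Fin.zero_eta, Fin.mk_one,
    Fin.reduceFinMk, hs] <;> rw [hJ, div_eq_div_iff h0' (mul_ne_zero h0 h0'), ← mul_assoc] <;>
    congr 1
  · linear_combination d' 0 0 ^ 3 * e0 + d' 0 0 ^ 2 * d' 1 0 * e1 + d' 0 0 * d' 1 0 ^ 2 * e2
      + d' 1 0 ^ 3 * e3
  · linear_combination 3 * d' 0 0 ^ 2 * d' 0 1 * e0
      + (2 * d' 0 0 * d' 0 1 * d' 1 0 + d' 0 0 ^ 2 * d' 1 1) * e1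
      + (d' 0 1 * d' 1 0 ^ 2 + 2 * d' 0 0 * d' 1 0 * d' 1 1) * e2
      + 3 * d' 1 0 ^ 2 * d' 1 1 * e3
  · linear_combination 3 * d' 0 0 * d' 0 1 ^ 2 * e0
      + (d' 0 1 ^ 2 * d' 1 0 + 2 * d' 0 0 * d' 0 1 * d' 1 1) * e1
      + (d' 0 0 * d' 1 1 ^ 2 + 2 * d' 0 1 * d' 1 0 * d' 1 1) * e2
      + 3 * d' 1 0 * d' 1 1 ^ 2 * e3
  · linear_combination d' 0 1 ^ 3 * e0 + d' 0 1 ^ 2 * d' 1 1 * e1 + d' 0 1 * d' 1 1 ^ 2 * e2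
      + d' 1 1 ^ 3 * e3

theorem contDiffAt_jac {q : Plane} {g : Plane → Plane} (hg : ContDiffAt ℝ ∞ g q) :
    ContDiffAt ℝ ∞ (jac g) q := by
  have h : ∀ m j, ContDiffAt ℝ ∞ (pderiv j fun z => g z m) q := fun m j =>
    contDiffAt_pderiv j (contDiffAt_pi.1 hg m)
  exact ((h 0 0).mul (h 1 1)).sub ((h 0 1).mul (h 1 0))

theorem pull_pull {q : Plane} {g h : Plane → Plane} (S : Plane → Fibre)
    (hg : ContDiffAt ℝ ∞ g (h q)) (hh : ContDiffAt ℝ ∞ h q) (h0 : jac g (h q) ≠ 0)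
    (h0' : jac h q ≠ 0) :
    pull h (pull g S) =ᶠ[𝓝 q] pull (fun z => g (h z)) S := by
  have hgm : ∀ m, ContDiffAt ℝ ∞ (fun z => g z m) (h q) := contDiffAt_pi.1 hg
  have hhm : ∀ m, ContDiffAt ℝ ∞ (fun z => h z m) q := contDiffAt_pi.1 hh
  have hd : ∀ m j, HasPD j (fun z => g (h z) m)
      (fun z => pderiv 0 (fun z => g z m) (h z) * pderiv j (fun z => h z 0) z
        + pderiv 1 (fun z => g z m) (h z) * pderiv j (fun z => h z 1) z) q := fun m j =>
    .comp (f := fun z => g z m) (hgm m) hh (.of_contDiffAt (hhm 0)) (.of_contDiffAt (hhm 1))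
  have hdd : ∀ m r j, HasPD j (fun z => pderiv r (fun z => g z m) (h z)) _ q := fun m r j =>
    .comp (contDiffAt_pderiv r (hgm m)) hh (.of_contDiffAt (hhm 0)) (.of_contDiffAt (hhm 1))
  have hh' : ∀ m j l, HasPD j (pderiv l fun z => h z m) _ q := fun m j l =>
    .of_contDiffAt (contDiffAt_pderiv l (hhm m))
  have h1 : ∀ᶠ z in 𝓝 q, ∀ m j, pderiv j (fun z => g (h z) m) z = _ :=
    eventually_all.2 fun m => eventually_all.2 fun j => (hd m j).eq
  have h2 : ∀ᶠ z in 𝓝 q, ∀ m j l, pderiv j (pderiv l (fun z => g (h z) m)) z = _ :=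
    eventually_all.2 fun m => eventually_all.2 fun j => eventually_all.2 fun l =>
      (pderiv_congr j (hd m l).eq).trans
        (((hdd m 0 j).mul (hh' 0 j l)).add ((hdd m 1 j).mul (hh' 1 j l))).eq
  have h3 : ∀ᶠ z in 𝓝 q, ∀ m, pderiv 1 (pderiv 0 fun z => g z m) (h z)
      = pderiv 0 (pderiv 1 fun z => g z m) (h z) :=
    eventually_all.2 fun m => hh.continuousAt.eventually (pderiv_comm_eventually 1 0 (hgm m))
  have h4 : ∀ᶠ z in 𝓝 q, jac g (h z) ≠ 0 := by
    refine ContinuousAt.eventually_ne (g := fun z => jac g (h z)) ?_ h0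
    exact ContinuousAt.comp (g := jac g) (contDiffAt_jac hg).continuousAt hh.continuousAt
  have h5 : ∀ᶠ z in 𝓝 q, jac h z ≠ 0 := (contDiffAt_jac hh).continuousAt.eventually_ne h0'
  filter_upwards [h1, h2, h3, h4, h5] with z e1 e2 e3 e4 e5
  simp only [pull, e1, e2]
  exact transformedCoeffs_transformedCoeffs (S (g (h z))) _ _ _ _ e4 e5 e3

/-! ### Sections and maps with prescribed jets -/

/-- The divided monomial `(x¹ - p¹)ᵃ (x² - p²)ᵇ / (a! b!)`. -/
def monomialAt (p : Plane) (a b : ℕ) (z : Plane) : ℝ :=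
  (z 0 - p 0) ^ a / a.factorial * ((z 1 - p 1) ^ b / b.factorial)

theorem contDiff_monomialAt (p : Plane) (a b : ℕ) : ContDiff ℝ ∞ (monomialAt p a b) := by
  unfold monomialAt
  fun_prop

theorem pderiv_apply_coord {φ : ℝ → ℝ} {φ' : ℝ} (j m : Fin 2) {p : Plane}
    (h : HasDerivAt φ φ' (p m)) : pderiv j (fun z => φ (z m)) p = if m = j then φ' else 0 := by
  have := (h.comp_hasFDerivAt p (hasFDerivAt_apply (𝕜 := ℝ) m p)).fderiv
  simp only [Function.comp_def] at this
  simp only [pderiv]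
  rw [this]
  simp [Pi.single_apply]

theorem hasDerivAt_divided_pow (c x : ℝ) (a : ℕ) :
    HasDerivAt (fun x => (x - c) ^ (a + 1) / (a + 1).factorial) ((x - c) ^ a / a.factorial) x := by
  have := (((hasDerivAt_id x).sub_const c).pow (a + 1)).div_const ((a + 1).factorial : ℝ)
  refine this.congr_deriv ?_
  rw [Nat.factorial_succ]
  have : (a.factorial : ℝ) ≠ 0 := by positivity
  push_cast
  simp
  field_simp

theorem pderiv_zero_monomialAt_succ (p : Plane) (a b : ℕ) :
    pderiv 0 (monomialAt p (a + 1) b) = monomialAt p a b := by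
  funext z
  unfold monomialAt
  rw [pderiv_mul 0 (by fun_prop) (by fun_prop),
    pderiv_apply_coord 0 0 (hasDerivAt_divided_pow (p 0) (z 0) a),
    pderiv_apply_coord (φ := fun x => (x - p 1) ^ b / b.factorial) 0 1
      (DifferentiableAt.hasDerivAt (by fun_prop))]
  simp

theorem pderiv_one_monomialAt_succ (p : Plane) (a b : ℕ) :
    pderiv 1 (monomialAt p a (b + 1)) = monomialAt p a b := by
  funext z
  unfold monomialAt
  rw [pderiv_mul 1 (by fun_prop) (by fun_prop),
    pderiv_apply_coord 1 1 (hasDerivAt_divided_pow (p 1) (z 1) b),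
    pderiv_apply_coord (φ := fun x => (x - p 0) ^ a / a.factorial) 1 0
      (DifferentiableAt.hasDerivAt (by fun_prop))]
  simp

theorem pderiv_zero_monomialAt_zero (p : Plane) (b : ℕ) :
    pderiv 0 (monomialAt p 0 b) = fun _ => 0 := by
  funext z
  unfold monomialAt
  rw [pderiv_mul 0 (by fun_prop) (by fun_prop),
    pderiv_apply_coord (φ := fun x => (x - p 1) ^ b / b.factorial) 0 1
      (DifferentiableAt.hasDerivAt (by fun_prop))]
  simp

theorem pderiv_one_monomialAt_zero (p : Plane) (a : ℕ) :
    pderiv 1 (monomialAt p a 0) = fun _ => 0 := by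
  funext z
  unfold monomialAt
  rw [pderiv_mul 1 (by fun_prop) (by fun_prop),
    pderiv_apply_coord (φ := fun x => (x - p 0) ^ a / a.factorial) 1 0
      (DifferentiableAt.hasDerivAt (by fun_prop))]
  simp

theorem partials_zero (a b : ℕ) (p : Plane) : partials a b (fun _ => 0) p = 0 := by
  have := partials_const_mul (f := fun _ => 0) (p := p) a b 0 contDiffAt_const
  simpa using this

theorem partials_monomialAt (p : Plane) (a b a' b' : ℕ) :
    partials a' b' (monomialAt p a b) p = if a' = a ∧ b' = b then 1 else 0 := by
  induction b' generalizing b with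
  | zero =>
    induction a' generalizing a with
    | zero =>
      change monomialAt p a b p = _
      rcases a with _ | a <;> rcases b with _ | b <;> simp [monomialAt]
    | succ a' ih =>
      rw [← partials_pderiv_zero _ _ (contDiff_monomialAt p a b).contDiffAt]
      rcases a with _ | a
      · rw [pderiv_zero_monomialAt_zero, partials_zero]
        simp
      · rw [pderiv_zero_monomialAt_succ, ih]
        simp
  | succ b' ih =>
    rw [← partials_pderiv_one]
    rcases b with _ | b
    · rw [pderiv_one_monomialAt_zero, partials_zero]
      simp
    · rw [pderiv_one_monomialAt_succ, ih]
      simp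

theorem partials_sum {ι : Type*} (s : Finset ι) (f : ι → Plane → ℝ) (a b : ℕ) {p : Plane}
    (hf : ∀ i, ContDiffAt ℝ ∞ (f i) p) :
    partials a b (fun z => ∑ i ∈ s, f i z) p = ∑ i ∈ s, partials a b (f i) p := by
  classical
  induction s using Finset.induction_on with
  | empty => simpa using partials_zero a b p
  | insert i s hi ih =>
    simp only [Finset.sum_insert hi]
    rw [partials_add a b (hf i) (ContDiffAt.sum fun i _ => hf i), ih]

/-- The polynomial with the derivatives `c a b` for `a, b ≤ n` at `p`. -/
def taylorPoly (n : ℕ) (c : ℕ → ℕ → ℝ) (p : Plane) (z : Plane) : ℝ :=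
  ∑ s ∈ Finset.range (n + 1) ×ˢ Finset.range (n + 1), c s.1 s.2 * monomialAt p s.1 s.2 z

theorem contDiff_taylorPoly (n : ℕ) (c : ℕ → ℕ → ℝ) (p : Plane) :
    ContDiff ℝ ∞ (taylorPoly n c p) :=
  ContDiff.sum fun s _ => contDiff_const.mul (contDiff_monomialAt p s.1 s.2)

theorem partials_taylorPoly (n : ℕ) (c : ℕ → ℕ → ℝ) (p : Plane) {a b : ℕ} (h : a + b ≤ n) :
    partials a b (taylorPoly n c p) p = c a b := by
  refine (partials_sum _ (fun (s : ℕ × ℕ) z => c s.1 s.2 * monomialAt p s.1 s.2 z) a b fun s =>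
    (contDiff_const.mul (contDiff_monomialAt p s.1 s.2)).contDiffAt).trans ?_
  have : ∀ s : ℕ × ℕ, partials a b (fun z => c s.1 s.2 * monomialAt p s.1 s.2 z) p
      = if s = (a, b) then c a b else 0 := by
    rintro ⟨a', b'⟩
    rw [partials_const_mul _ _ _ (contDiff_monomialAt p a' b').contDiffAt, partials_monomialAt]
    by_cases e : a = a' ∧ b = b'
    · obtain ⟨rfl, rfl⟩ := e
      simp
    · rw [if_neg e, if_neg (fun e' => e ⟨(congrArg Prod.fst e').symm, (congrArg Prod.snd e').symm⟩),
        mul_zero]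
  simp only [this]
  rw [Finset.sum_ite_eq', if_pos]
  simp only [Finset.mem_product, Finset.mem_range]
  omega

theorem exists_jet_eq {k : ℕ} (θ : JetSpace k) :
    ∃ S : Plane → Fibre, ContDiff ℝ ∞ S ∧ jet k S θ.1 = θ := by
  refine ⟨fun z i => taylorPoly k (fun a b => if h : a + b ≤ k then θ.2 ⟨(a, b), h⟩ i else 0) θ.1 z,
    contDiff_pi.2 fun i => contDiff_taylorPoly _ _ _, Prod.ext rfl ?_⟩
  funext σ i
  rw [jet_snd_apply, partials_taylorPoly _ _ _ σ.2, dif_pos σ.2]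

/-! ### The orbits are the classes of an equivalence relation -/

theorem jac_ne_zero_of_leftInverse {f g : Plane → Plane} {q : Plane}
    (hf : DifferentiableAt ℝ f (g q)) (hg : DifferentiableAt ℝ g q)
    (h : ∀ᶠ z in 𝓝 q, f (g z) = z) : jac g q ≠ 0 := by
  have e := jac_comp hf hg
  rw [jac_congr h, jac_id] at e
  intro h0
  rw [h0, mul_zero] at e
  exact one_ne_zero e

namespace IsPointTransformation

variable {f f' : OpenPartialHomeomorph Plane Plane}

theorem contDiffAt (hf : IsPointTransformation f) {p : Plane} (hp : p ∈ f.source) :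
    ContDiffAt ℝ ∞ f p := hf.1.contDiffAt (f.open_source.mem_nhds hp)

theorem contDiffAt_symm (hf : IsPointTransformation f) {q : Plane} (hq : q ∈ f.target) :
    ContDiffAt ℝ ∞ f.symm q := hf.2.contDiffAt (f.open_target.mem_nhds hq)

theorem symm (hf : IsPointTransformation f) : IsPointTransformation f.symm := ⟨hf.2, hf.1⟩

theorem trans (hf : IsPointTransformation f) (hf' : IsPointTransformation f') :
    IsPointTransformation (f.trans f') := by
  constructor
  · intro p hp
    rw [OpenPartialHomeomorph.trans_source] at hp
    exact ((hf'.contDiffAt hp.2).comp p (hf.contDiffAt hp.1)).contDiffWithinAt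
  · intro q hq
    rw [OpenPartialHomeomorph.trans_target] at hq
    exact ((hf.contDiffAt_symm hq.2).comp q (hf'.contDiffAt_symm hq.1)).contDiffWithinAt

theorem jac_symm_ne_zero (hf : IsPointTransformation f) {q : Plane} (hq : q ∈ f.target) :
    jac f.symm q ≠ 0 :=
  jac_ne_zero_of_leftInverse
    ((hf.contDiffAt (f.map_target hq)).differentiableAt (by simp))
    ((hf.contDiffAt_symm hq).differentiableAt (by simp))
    (f.eventually_right_inverse hq)

end IsPointTransformation

/-- The local diffeomorphism `g`, defined near `θ'.1`, transforms back `θ'` to `θ`. -/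
def PullsBack (k : ℕ) (g : Plane → Plane) (θ θ' : JetSpace k) : Prop :=
  ContDiffAt ℝ ∞ g θ'.1 ∧ jac g θ'.1 ≠ 0 ∧ θ.1 = g θ'.1 ∧
    ∃ S : Plane → Fibre, (∀ᶠ z in 𝓝 θ.1, ContDiffAt ℝ ∞ S z) ∧ jet k S θ.1 = θ ∧
      jet k (pull g S) θ'.1 = θ'

theorem LiftMaps.pullsBack {k : ℕ} {f : OpenPartialHomeomorph Plane Plane} {θ θ' : JetSpace k}
    (hf : IsPointTransformation f) (h : LiftMaps k f θ θ') : PullsBack k f.symm θ θ' := by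
  obtain ⟨hp, U, S, hU, hpU, hS, e, rfl⟩ := h
  refine ⟨hf.contDiffAt_symm (f.map_source hp), hf.jac_symm_ne_zero (f.map_source hp),
    (f.left_inv hp).symm, S, ?_, e, rfl⟩
  filter_upwards [hU.mem_nhds hpU] with z hz
  exact hS.contDiffAt (hU.mem_nhds hz)

/-- The section in `LiftMaps` is only existentially given; any other smooth representative of the
jet may replace it. -/
theorem LiftMaps.jet_eq {k : ℕ} {f : OpenPartialHomeomorph Plane Plane} {θ θ' : JetSpace k}
    (hf : IsPointTransformation f) (h : LiftMaps k f θ θ') {S : Plane → Fibre}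
    (hS : ContDiffAt ℝ ∞ S θ.1) (e : jet k S θ.1 = θ) :
    θ' = jet k (transformSection f S) (f θ.1) := by
  obtain ⟨hp, U, S', hU, hpU, hS', e', rfl⟩ := h
  have h1 : f.symm (f θ.1) = θ.1 := f.left_inv hp
  refine jet_pull_congr (hf.contDiffAt_symm (f.map_source hp)) ?_ ?_ ?_
    (hf.jac_symm_ne_zero (f.map_source hp))
  · rw [h1]
    exact hS'.contDiffAt (hU.mem_nhds hpU)
  · rwa [h1]
  · rw [h1, e, e']

theorem mem_orbit_self {k : ℕ} (θ : JetSpace k) : θ ∈ orbit k θ := by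
  obtain ⟨S, hS, e⟩ := exists_jet_eq θ
  refine ⟨.refl Plane, ⟨contDiffOn_id, contDiffOn_id⟩, trivial, Set.univ, S, isOpen_univ, trivial,
    hS.contDiffOn, e, ?_⟩
  rw [transformSection_eq_pull]
  exact e.symm.trans (congrArg (fun T => jet k T θ.1) (pull_id S).symm)

theorem pull_symm_pull {f : OpenPartialHomeomorph Plane Plane} (hf : IsPointTransformation f)
    {S : Plane → Fibre} {p : Plane} (hp : p ∈ f.source) :
    transformSection f.symm (transformSection f S) =ᶠ[𝓝 p] S := by
  have hq := f.map_source hp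
  have h1 := pull_pull (q := p) (h := f) (g := f.symm) S (hf.contDiffAt_symm hq)
    (hf.contDiffAt hp) (hf.jac_symm_ne_zero hq) (hf.symm.jac_symm_ne_zero hp)
  refine h1.trans ?_
  have hl : (fun z => f.symm (f z)) =ᶠ[𝓝 p] fun z => z := f.eventually_left_inverse hp
  have h2 := pull_congr hl (continuousAt_id.congr hl.symm) (.refl _ S)
  rwa [pull_id] at h2

theorem mem_orbit_symm {k : ℕ} {θ θ' : JetSpace k} (h : θ' ∈ orbit k θ) : θ ∈ orbit k θ' := by
  obtain ⟨f, hf, hp, U, S, hU, hpU, hS, e, rfl⟩ := h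
  have hq := f.map_source hp
  have h1 : f.symm (f θ.1) = θ.1 := f.left_inv hp
  refine ⟨f.symm, hf.symm, hq, f.target ∩ f.symm ⁻¹' U, transformSection f S,
    f.isOpen_inter_preimage_symm hU, ⟨hq, ?_⟩, ?_, rfl, ?_⟩
  · change f.symm (f θ.1) ∈ U
    rwa [h1]
  · intro z hz
    exact (contDiffAt_pull (hf.contDiffAt_symm hz.1) (hS.contDiffAt (hU.mem_nhds hz.2))
      (hf.jac_symm_ne_zero hz.1)).contDiffWithinAt
  · change θ = jet k _ (f.symm (f θ.1))
    rw [h1, jet_congr (pull_symm_pull hf hp), e]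

theorem mem_orbit_trans {k : ℕ} {θ θ' θ'' : JetSpace k} (h : θ' ∈ orbit k θ)
    (h' : θ'' ∈ orbit k θ') : θ'' ∈ orbit k θ := by
  obtain ⟨f, hf, hp, U, S, hU, hpU, hS, e, rfl⟩ := h
  obtain ⟨f', hf', hq⟩ := h'
  have hp' := f.map_source hp
  have h1 : f.symm (f θ.1) = θ.1 := f.left_inv hp
  have hs : ContDiffAt ℝ ∞ (transformSection f S) (f θ.1) := by
    refine contDiffAt_pull (hf.contDiffAt_symm hp') ?_ (hf.jac_symm_ne_zero hp')
    rw [h1]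
    exact hS.contDiffAt (hU.mem_nhds hpU)
  -- The second map is witnessed by an unrelated section; it is exchanged for the transform of `S`,
  -- so that the two actions compose.
  have e2 := hq.jet_eq hf' hs rfl
  have hq' : f θ.1 ∈ f'.source := hq.1
  have h2 : f'.symm (f' (f θ.1)) = f θ.1 := f'.left_inv hq'
  refine ⟨f.trans f', hf.trans hf', ?_, U, S, hU, hpU, hS, e, ?_⟩
  · rw [OpenPartialHomeomorph.trans_source]
    exact ⟨hp, hq'⟩
  · rw [e2]
    refine jet_congr (pull_pull (q := f' (f θ.1)) (h := f'.symm) (g := f.symm) S ?_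
      (hf'.contDiffAt_symm (f'.map_source hq')) ?_ (hf'.jac_symm_ne_zero (f'.map_source hq')))
    · rw [h2]
      exact hf.contDiffAt_symm hp'
    · rw [h2]
      exact hf.jac_symm_ne_zero hp'

theorem isOrbit_orbit {k : ℕ} (θ : JetSpace k) : IsOrbit k (orbit k θ) := by
  refine ⟨⟨θ, mem_orbit_self θ⟩, fun θ' h => Set.ext fun θ'' => ⟨mem_orbit_trans h, ?_⟩⟩
  exact mem_orbit_trans (mem_orbit_symm h)

theorem sUnion_isOrbit (k : ℕ) : ⋃₀ {O : Set (JetSpace k) | IsOrbit k O} = Set.univ :=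
  Set.eq_univ_of_forall fun θ => ⟨orbit k θ, isOrbit_orbit θ, mem_orbit_self θ⟩

/-- Since orbits are equivalence classes, it is enough to bring each point of an invariant set to
one normal form. -/
theorem isOrbit_of_invariant_of_transitive {k : ℕ} {O : Set (JetSpace k)} {θ₀ : JetSpace k}
    (h₀ : θ₀ ∈ O) (hinv : ∀ θ ∈ O, orbit k θ ⊆ O) (htrans : ∀ θ ∈ O, θ₀ ∈ orbit k θ) :
    IsOrbit k O :=
  ⟨⟨θ₀, h₀⟩, fun θ hθ => (hinv θ hθ).antisymm fun θ' hθ' =>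
    mem_orbit_trans (htrans θ hθ) (mem_orbit_symm (htrans θ' hθ'))⟩

/-! ### Point transformations from maps with non-zero Jacobian -/

theorem fderiv_apply_eq {g : Plane → Plane} {q : Plane} (hg : DifferentiableAt ℝ g q) (v : Plane)
    (m : Fin 2) : fderiv ℝ g q v m
      = v 0 * pderiv 0 (fun z => g z m) q + v 1 * pderiv 1 (fun z => g z m) q := by
  have h : ∀ w, fderiv ℝ (fun z => g z m) q w = fderiv ℝ g q w m := by
    intro w
    rw [(hasFDerivAt_pi'.1 hg.hasFDerivAt m).fderiv]
    rfl
  have hv : v = v 0 • (Pi.single 0 1 : Plane) + v 1 • (Pi.single 1 1 : Plane) := by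
    ext i
    fin_cases i <;> simp
  conv_lhs => rw [hv]
  simp [pderiv, h]

theorem exists_hasFDerivAt_equiv {g : Plane → Plane} {q : Plane} (hg : DifferentiableAt ℝ g q)
    (h0 : jac g q ≠ 0) :
    ∃ e : Plane ≃L[ℝ] Plane, HasFDerivAt g (e : Plane →L[ℝ] Plane) q := by
  have hinj : Function.Injective (fderiv ℝ g q : Plane →ₗ[ℝ] Plane) := by
    rw [← LinearMap.ker_eq_bot, LinearMap.ker_eq_bot']
    intro v hv
    have h1 := fun m => (fderiv_apply_eq hg v m).symm.trans (congrFun hv m)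
    have e0 := h1 0
    have e1 := h1 1
    simp only [jac, det2, Pi.zero_apply] at h0 e0 e1
    -- Cramer's rule: the Jacobian times each component of `v` is a combination of the two equations
    -- Dg · v = 0.
    have z0 : v 0 = 0 := by
      refine (mul_eq_zero.1 ?_).resolve_right h0
      linear_combination pderiv 1 (fun z => g z 1) q * e0 - pderiv 1 (fun z => g z 0) q * e1
    have z1 : v 1 = 0 := by
      refine (mul_eq_zero.1 ?_).resolve_right h0
      linear_combination pderiv 0 (fun z => g z 0) q * e1 - pderiv 0 (fun z => g z 1) q * e0
    ext i
    fin_cases i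
    exacts [z0, z1]
  refine ⟨(LinearEquiv.ofInjectiveEndo _ hinj).toContinuousLinearEquiv, ?_⟩
  convert hg.hasFDerivAt using 1
  ext v : 1
  rfl

/-- The inverse function theorem for maps of the plane. -/
theorem exists_openPartialHomeomorph {g : Plane → Plane} {q : Plane} {V : Set Plane}
    (hV : IsOpen V) (hg : ContDiffOn ℝ ∞ g V) (hq : q ∈ V) (h0 : ∀ z ∈ V, jac g z ≠ 0) :
    ∃ f : OpenPartialHomeomorph Plane Plane, IsPointTransformation f ∧ q ∈ f.target ∧
      ⇑f.symm = g := by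
  have hgV : ∀ z ∈ V, ContDiffAt ℝ ∞ g z := fun z hz => hg.contDiffAt (hV.mem_nhds hz)
  have hd : ∀ z ∈ V, DifferentiableAt ℝ g z := fun z hz => (hgV z hz).differentiableAt (by simp)
  obtain ⟨e, he⟩ := exists_hasFDerivAt_equiv (hd q hq) (h0 q hq)
  -- After restriction to `V` the Jacobian is non-zero on the whole domain, so the inverse is smooth
  -- at every point of its domain and not only at the image of `q`.
  set G := ((hgV q hq).toOpenPartialHomeomorph g he (by simp)).restrOpen V hV with hG
  have hGg : ⇑G = g := rfl
  have hsrc : G.source ⊆ V := fun z hz => hz.2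
  refine ⟨G.symm, ⟨fun y hy => ?_, fun z hz => ?_⟩,
    ⟨(hgV q hq).mem_toOpenPartialHomeomorph_source he (by simp), hq⟩, hGg⟩
  · have hs := hsrc (G.map_target hy)
    obtain ⟨e', he'⟩ := exists_hasFDerivAt_equiv (hd _ hs) (h0 _ hs)
    exact (G.contDiffAt_symm hy he' (hgV _ hs)).contDiffWithinAt
  · exact (hgV z (hsrc hz)).contDiffWithinAt

/-- Local diffeomorphisms given as smooth maps with non-zero Jacobian act within the orbits. -/
theorem jet_pull_mem_orbit {k : ℕ} {g : Plane → Plane} {S : Plane → Fibre} {q : Plane}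
    (hg : ContDiff ℝ ∞ g) (hS : ContDiff ℝ ∞ S) (h0 : jac g q ≠ 0) :
    jet k (pull g S) q ∈ orbit k (jet k S (g q)) := by
  have hc : Continuous (jac g) := continuous_iff_continuousAt.2 fun z =>
    (contDiffAt_jac hg.contDiffAt).continuousAt
  obtain ⟨f, hf, hq, rfl⟩ := exists_openPartialHomeomorph (V := {z | jac g z ≠ 0})
    (isOpen_ne_fun hc continuous_const) hg.contDiffOn h0 fun z hz => hz
  refine ⟨f, hf, f.map_target hq, Set.univ, S, isOpen_univ, trivial, hS.contDiffOn, rfl, ?_⟩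
  change _ = jet k _ (f (f.symm q))
  rw [f.right_inv hq]
  rfl

/-! ### The functions `F¹`, `F²`, `F³` on the jet spaces -/

section Coordinates

variable {k : ℕ} (i : Fin 4) (a b : ℕ) (h : a + b ≤ k)

@[simp]
theorem JetSpace.u_add (θ v : JetSpace k) : (θ + v).u i a b h = θ.u i a b h + v.u i a b h := rfl

@[simp]
theorem JetSpace.u_smul (t : ℝ) (v : JetSpace k) : (t • v).u i a b h = t * v.u i a b h := rfl

@[fun_prop]
theorem JetSpace.contDiff_u {n : WithTop ℕ∞} :
    ContDiff ℝ n fun θ : JetSpace k => θ.u i a b h := by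
  unfold JetSpace.u
  fun_prop

@[simp]
theorem proj_u (θ : JetSpace (k + 1)) : (proj θ).u i a b h = θ.u i a b (Nat.le_succ_of_le h) := rfl

theorem jet_u (S : Plane → Fibre) (p : Plane) :
    (jet k S p).u i a b h = partials a b (fun z => S z i) p := rfl

/-- The direction of the coordinate `uⁱ⁺¹_σ`, with `σ` consisting of `a` ones and `b` twos. -/
def unitJet (k : ℕ) (i : Fin 4) (a b : ℕ) : JetSpace k :=
  (0, fun σ => if σ.1 = (a, b) then Pi.single i 1 else 0)

@[simp]
theorem unitJet_u (i' : Fin 4) (a' b' : ℕ) :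
    (unitJet k i' a' b').u i a b h = if (a, b) = (a', b') ∧ i = i' then 1 else 0 := by
  simp only [unitJet, JetSpace.u]
  by_cases e : (a, b) = (a', b') <;> simp [e, Pi.single_apply]

end Coordinates

theorem contDiff_F1 : ContDiff ℝ ∞ F1 := by
  unfold F1
  fun_prop

theorem contDiff_F2 : ContDiff ℝ ∞ F2 := by
  unfold F2
  fun_prop

/-- F¹ and F² are polynomials of degree two in the jet coordinates, so a directional derivative can
be read off as the linear coefficient along a line. -/
theorem fderiv_apply_of_quadratic {E : Type*} [NormedAddCommGroup E] [NormedSpace ℝ E]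
    {G : E → ℝ} {x v : E} {L Q : ℝ} (hG : DifferentiableAt ℝ G x)
    (h : ∀ t : ℝ, G (x + t • v) = G x + t * L + t ^ 2 * Q) : fderiv ℝ G x v = L := by
  have h1 := hG.hasFDerivAt.hasLineDerivAt v
  have h2 : HasDerivAt (fun t : ℝ => G x + t * L + t ^ 2 * Q) L 0 := by
    have := (((hasDerivAt_id (0 : ℝ)).mul_const L).const_add (G x)).add
      (((hasDerivAt_id (0 : ℝ)).pow 2).mul_const Q)
    refine this.congr_deriv ?_
    simp
  unfold HasLineDerivAt at h1
  simp only [h] at h1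
  exact h1.unique h2

theorem fderiv_F1 (θ v : JetSpace 2) : fderiv ℝ F1 θ v =
    3 * v.u 0 0 2 - 2 * v.u 1 1 1 + v.u 2 2 0
      + 3 * (v.u 3 0 0 * θ.u 0 1 0 + θ.u 3 0 0 * v.u 0 1 0)
      - 3 * (v.u 2 0 0 * θ.u 0 0 1 + θ.u 2 0 0 * v.u 0 0 1)
      + 2 * (v.u 1 0 0 * θ.u 1 0 1 + θ.u 1 0 0 * v.u 1 0 1)
      - (v.u 1 0 0 * θ.u 2 1 0 + θ.u 1 0 0 * v.u 2 1 0)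
      - 3 * (v.u 0 0 0 * θ.u 2 0 1 + θ.u 0 0 0 * v.u 2 0 1)
      + 6 * (v.u 0 0 0 * θ.u 3 1 0 + θ.u 0 0 0 * v.u 3 1 0) := by
  refine fderiv_apply_of_quadratic
    -- The purely quadratic part of F¹, evaluated at `v`.
    (Q := F1 v - (3 * v.u 0 0 2 - 2 * v.u 1 1 1 + v.u 2 2 0))
    (contDiff_F1.contDiffAt.differentiableAt (by simp)) fun t => ?_
  simp only [F1, JetSpace.u_add, JetSpace.u_smul]
  ring

theorem fderiv_F2 (θ v : JetSpace 2) : fderiv ℝ F2 θ v =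
    v.u 1 0 2 - 2 * v.u 2 1 1 + 3 * v.u 3 2 0
      - 3 * (v.u 0 0 0 * θ.u 3 0 1 + θ.u 0 0 0 * v.u 3 0 1)
      + 3 * (v.u 1 0 0 * θ.u 3 1 0 + θ.u 1 0 0 * v.u 3 1 0)
      - 2 * (v.u 2 0 0 * θ.u 2 1 0 + θ.u 2 0 0 * v.u 2 1 0)
      + (v.u 2 0 0 * θ.u 1 0 1 + θ.u 2 0 0 * v.u 1 0 1)
      + 3 * (v.u 3 0 0 * θ.u 1 1 0 + θ.u 3 0 0 * v.u 1 1 0)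
      - 6 * (v.u 3 0 0 * θ.u 0 0 1 + θ.u 3 0 0 * v.u 0 0 1) := by
  refine fderiv_apply_of_quadratic
    (Q := F2 v - (v.u 1 0 2 - 2 * v.u 2 1 1 + 3 * v.u 3 2 0))
    (contDiff_F2.contDiffAt.differentiableAt (by simp)) fun t => ?_
  simp only [F2, JetSpace.u_add, JetSpace.u_smul]
  ring

/-- The vector along which `D_j` differentiates. -/
def totalVector {k : ℕ} (j : Fin 2) (θ : JetSpace (k + 1)) : JetSpace k :=
  (Pi.single j 1, fun σ => θ.2 (σ.snoc j))

theorem totalDeriv_eq {k : ℕ} (j : Fin 2) (G : JetSpace k → ℝ) (θ : JetSpace (k + 1)) :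
    totalDeriv j G θ = fderiv ℝ G (proj θ) (totalVector j θ) := rfl

theorem totalVector_zero_u {k : ℕ} (θ : JetSpace (k + 1)) (i : Fin 4) (a b : ℕ)
    (h : a + b ≤ k) : (totalVector 0 θ).u i a b h = θ.u i (a + 1) b (by omega) := rfl

theorem totalVector_one_u {k : ℕ} (θ : JetSpace (k + 1)) (i : Fin 4) (a b : ℕ)
    (h : a + b ≤ k) : (totalVector 1 θ).u i a b h = θ.u i a (b + 1) (by omega) := rfl

theorem continuous_totalDeriv {k : ℕ} (j : Fin 2) {G : JetSpace k → ℝ} (hG : ContDiff ℝ ∞ G) :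
    Continuous (totalDeriv j G) := by
  have h1 : Continuous fun θ : JetSpace (k + 1) => (proj θ : JetSpace k) := by
    unfold proj
    fun_prop
  have h2 : Continuous fun θ : JetSpace (k + 1) => (totalVector j θ : JetSpace k) := by
    unfold totalVector
    fun_prop
  exact ((hG.continuous_fderiv (by simp)).comp h1).clm_apply h2

theorem continuous_F3 : Continuous F3 := by
  have h1 : Continuous fun θ : JetSpace 3 => (proj θ : JetSpace 2) := by
    unfold proj
    fun_prop
  have h2 := contDiff_F1.continuous.comp h1
  have h3 := contDiff_F2.continuous.comp h1
  have h4 := fun j => continuous_totalDeriv j contDiff_F1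
  have h5 := fun j => continuous_totalDeriv j contDiff_F2
  have h6 : ∀ i, Continuous fun θ : JetSpace 3 => θ.u i 0 0 := fun i =>
    (JetSpace.contDiff_u (n := ∞) i 0 0 _).continuous
  exact (((((h3.mul ((h2.mul (h5 0)).sub (h3.mul (h4 0)))).sub
    (h2.mul ((h2.mul (h5 1)).sub (h3.mul (h4 1))))).add ((h2.pow 3).mul (h6 3))).sub
    (((h2.pow 2).mul h3).mul (h6 2))).add ((h2.mul (h3.pow 2)).mul (h6 1))).sub
    ((h3.pow 3).mul (h6 0))

theorem F1_add_smul_unitJet (θ : JetSpace 2) (t : ℝ) :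
    F1 (θ + t • unitJet 2 2 2 0) = F1 θ + t := by
  simp [F1]
  ring

theorem F1_proj_add_smul_unitJet (θ : JetSpace 3) (t : ℝ) :
    F1 (proj (θ + t • unitJet 3 2 2 0)) = F1 (proj θ) + t := by
  simp [F1]
  ring

/-- The coordinate u²₂₂₂ enters F³ only through D₂F², whose coefficient in F³ is -(F¹)². -/
theorem F3_add_smul_unitJet (θ : JetSpace 3) (t : ℝ) :
    F3 (θ + t • unitJet 3 1 0 3) = F3 θ - t * F1 (proj θ) ^ 2 := by
  have h1 : F1 (proj (θ + t • unitJet 3 1 0 3)) = F1 (proj θ) := by simp [F1]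
  have h2 : F2 (proj (θ + t • unitJet 3 1 0 3)) = F2 (proj θ) := by simp [F2]
  simp only [F3, h1, h2, totalDeriv_eq, fderiv_F1, fderiv_F2, totalVector_zero_u,
    totalVector_one_u, JetSpace.u_add, JetSpace.u_smul, unitJet_u, proj_u]
  simp
  ring

/-- The exceptional parameter `s` leaves room for the single zero of a non-constant affine function
along the line. -/
theorem mem_closure_of_line {E : Type*} [NormedAddCommGroup E] [NormedSpace ℝ E] {A : Set E}
    {x v : E} (s : ℝ) (h : ∀ t : ℝ, t ≠ 0 → t ≠ s → x + t • v ∈ A) : x ∈ closure A := by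
  have h1 : Tendsto (fun t : ℝ => x + t • v) (𝓝[≠] 0) (𝓝 x) := by
    have : Continuous fun t : ℝ => x + t • v := by fun_prop
    simpa using (this.tendsto 0).mono_left nhdsWithin_le_nhds
  refine mem_closure_of_tendsto h1 ?_
  rcases eq_or_ne s 0 with rfl | hs
  · filter_upwards [self_mem_nhdsWithin] with t ht using h t ht ht
  · filter_upwards [self_mem_nhdsWithin,
      mem_nhdsWithin_of_mem_nhds (isOpen_ne.mem_nhds hs.symm)] with t ht ht' using h t ht ht'

theorem isOpen_F_ne_zero : IsOpen {θ : JetSpace 2 | (F1 θ, F2 θ) ≠ (0, 0)} :=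
  isOpen_ne_fun (contDiff_F1.continuous.prodMk contDiff_F2.continuous) continuous_const

theorem dense_F_ne_zero : Dense {θ : JetSpace 2 | (F1 θ, F2 θ) ≠ (0, 0)} := by
  refine fun θ => mem_closure_of_line (v := unitJet 2 2 2 0) (-F1 θ) fun t _ ht h => ht ?_
  have := congrArg Prod.fst h
  rw [F1_add_smul_unitJet] at this
  exact eq_neg_of_add_eq_zero_right this

theorem isOpen_F3_ne_zero : IsOpen {θ : JetSpace 3 | F3 θ ≠ 0} :=
  isOpen_ne_fun continuous_F3 continuous_const

/-- Two perturbations: moving u³₁₁ makes F¹ non-zero, and once F¹ ≠ 0, moving u²₂₂₂ makes F³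
non-zero. -/
theorem dense_F3_ne_zero : Dense {θ : JetSpace 3 | F3 θ ≠ 0} := by
  have h1 : {θ : JetSpace 3 | F1 (proj θ) ≠ 0} ⊆ closure {θ : JetSpace 3 | F3 θ ≠ 0} := by
    intro θ hθ
    have h0 : F1 (proj θ) ^ 2 ≠ 0 := pow_ne_zero 2 hθ
    refine mem_closure_of_line (v := unitJet 3 1 0 3) (F3 θ / F1 (proj θ) ^ 2)
      fun t _ ht h => ht ?_
    rw [F3_add_smul_unitJet] at h
    rw [eq_div_iff h0]
    linarith
  have h2 : Dense {θ : JetSpace 3 | F1 (proj θ) ≠ 0} := by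
    refine fun θ => mem_closure_of_line (v := unitJet 3 2 2 0) (-F1 (proj θ))
      fun t _ ht h => ht ?_
    rw [F1_proj_add_smul_unitJet] at h
    exact eq_neg_of_add_eq_zero_right h
  exact fun θ => closure_minimal h1 isClosed_closure (h2 θ)

/-- The coordinate u³₁₁ occurs only in F¹ and u²₂₂ only in F², each linearly with coefficient 1. The
two directions are thus dual to dF¹, dF² at every jet, which yields both the submersion and the
independence. -/
theorem fderiv_F_unitJet (θ : JetSpace 2) (s t : ℝ) :
    fderiv ℝ F1 θ (s • unitJet 2 2 2 0 + t • unitJet 2 1 0 2) = s ∧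
      fderiv ℝ F2 θ (s • unitJet 2 2 2 0 + t • unitJet 2 1 0 2) = t := by
  constructor
  · simp only [fderiv_F1, JetSpace.u_add, JetSpace.u_smul, unitJet_u]
    simp
  · simp only [fderiv_F2, JetSpace.u_add, JetSpace.u_smul, unitJet_u]
    simp

theorem isSubmanifoldOfCodim_degenerate :
    IsSubmanifoldOfCodim 2 {θ : JetSpace 2 | F1 θ = 0 ∧ F2 θ = 0} := by
  intro θ _
  have hc : ContDiff ℝ ∞ fun θ => ![F1 θ, F2 θ] :=
    contDiff_pi.2 fun m => by
      fin_cases m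
      exacts [contDiff_F1, contDiff_F2]
  refine ⟨Set.univ, fun θ => ![F1 θ, F2 θ], isOpen_univ, trivial, hc.contDiffOn, ?_, ?_⟩
  · intro y _ w
    have hd : ∀ v m, fderiv ℝ (fun θ => ![F1 θ, F2 θ]) y v m
        = fderiv ℝ (fun θ => ![F1 θ, F2 θ] m) y v := by
      intro v m
      rw [(hasFDerivAt_pi'.1 (hc.contDiffAt.differentiableAt (x := y) (by simp)).hasFDerivAt
        m).fderiv]
      rfl
    refine ⟨w 0 • unitJet 2 2 2 0 + w 1 • unitJet 2 1 0 2, ?_⟩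
    ext m
    rw [hd]
    fin_cases m
    · exact (fderiv_F_unitJet y _ _).1
    · exact (fderiv_F_unitJet y _ _).2
  · ext y
    simp

theorem linearIndependent_fderiv_F (θ : JetSpace 2) :
    LinearIndependent ℝ ![fderiv ℝ F1 θ, fderiv ℝ F2 θ] := by
  rw [LinearIndependent.pair_iff]
  intro s t h
  -- On this vector the relation s dF¹ + t dF² = 0 becomes s² + t² = 0.
  have h1 := DFunLike.congr_fun h (s • unitJet 2 2 2 0 + t • unitJet 2 1 0 2)
  simp only [add_apply, smul_apply,
    (fderiv_F_unitJet θ s t).1, (fderiv_F_unitJet θ s t).2, smul_eq_mul,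
    zero_apply] at h1
  exact mul_self_add_mul_self_eq_zero.1 h1

/-! ### Evaluation along sections -/

/-- The chain rule along the map q ↦ `jet k S q`, whose derivative in the direction e_j is exactly
the vector along which D_j differentiates. -/
theorem totalDeriv_jet {k : ℕ} {G : JetSpace k → ℝ} (hG : ContDiff ℝ ∞ G) (j : Fin 2)
    {S : Plane → Fibre} {p : Plane} (hS : ContDiffAt ℝ ∞ S p) :
    totalDeriv j G (jet (k + 1) S p) = pderiv j (fun z => G (jet k S z)) p := by
  have hSi : ∀ i, ContDiffAt ℝ ∞ (fun z => S z i) p := contDiffAt_pi.1 hS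
  have hd : ∀ (σ : MultiIdx k) i, DifferentiableAt ℝ (partials σ.1.1 σ.1.2 fun z => S z i) p :=
    fun σ i => (contDiffAt_partials _ _ (hSi i)).differentiableAt (by simp)
  have hj : HasFDerivAt (jet k S) ((ContinuousLinearMap.id ℝ Plane).prod
      (ContinuousLinearMap.pi fun σ : MultiIdx k => ContinuousLinearMap.pi fun i =>
        fderiv ℝ (partials σ.1.1 σ.1.2 fun z => S z i) p)) p :=
    (hasFDerivAt_id p).prodMk (hasFDerivAt_pi.2 fun σ => hasFDerivAt_pi.2 fun i =>
      (hd σ i).hasFDerivAt)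
  have := ((hG.contDiffAt.differentiableAt (x := jet k S p) (by simp)).hasFDerivAt.comp p
    hj).fderiv
  simp only [Function.comp_def] at this
  simp only [pderiv]
  rw [this, totalDeriv_eq, ContinuousLinearMap.comp_apply]
  refine congrArg (fderiv ℝ G (jet k S p)) (Prod.ext rfl (funext fun σ => funext fun i => ?_))
  change partials _ _ _ p = pderiv j (partials σ.1.1 σ.1.2 fun z => S z i) p
  match j with
  | 0 => rw [pderiv_zero_partials]; rfl
  | 1 => rw [pderiv_one_partials _ _ (hSi i)]; rfl

/-! ### The transformation law of `(F¹, F²)` -/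

theorem HasPD.partials_zero {f : Plane → ℝ} {p : Plane} (a b : ℕ) (hf : ContDiffAt ℝ ∞ f p) :
    HasPD 0 (partials a b f) (partials (a + 1) b f) p :=
  ⟨contDiffAt_partials a b hf, contDiffAt_partials _ b hf,
    .of_eq (pderiv_zero_partials f a b)⟩

theorem HasPD.partials_one {f : Plane → ℝ} {p : Plane} (a b : ℕ) (hf : ContDiffAt ℝ ∞ f p) :
    HasPD 1 (partials a b f) (partials a (b + 1) f) p := by
  refine ⟨contDiffAt_partials a b hf, contDiffAt_partials a _ hf, ?_⟩
  have h := (iterate_pderiv_comm 0 1 a (contDiffAt_iterate_pderiv 1 b hf)).symm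
  rw [← Function.iterate_succ_apply' (PointODE.pderiv 1)] at h
  exact h

/-- The map `(x, y) ↦ (x, Y(x, y))`. -/
def fibreMap (Y : Plane → ℝ) (z : Plane) : Plane := ![z 0, Y z]

theorem contDiffAt_fibreMap {Y : Plane → ℝ} {q : Plane} (hY : ContDiffAt ℝ ∞ Y q) :
    ContDiffAt ℝ ∞ (fibreMap Y) q :=
  contDiffAt_pi.2 fun m => by
    fin_cases m
    exacts [contDiffAt_coord 0 q, hY]

section FibreMap

variable {Y : Plane → ℝ} {S : Plane → Fibre} {q : Plane}

theorem pderiv_fibreMap_zero (Y : Plane → ℝ) (j : Fin 2) :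
    pderiv j (fun z => fibreMap Y z 0) = fun _ => if j = 0 then 1 else 0 := by
  funext z
  refine (pderiv_coord j 0 z).trans ?_
  simp only [eq_comm]

theorem pderiv_fibreMap_one (Y : Plane → ℝ) (j : Fin 2) :
    pderiv j (fun z => fibreMap Y z 1) = pderiv j Y := rfl

theorem jac_fibreMap (Y : Plane → ℝ) (q : Plane) : jac (fibreMap Y) q = pderiv 1 Y q := by
  simp [jac, det2, pderiv_fibreMap_zero, pderiv_fibreMap_one]

theorem HasPD.comp_fibreMap_zero {f : Plane → ℝ} (a b : ℕ) (hY : ContDiffAt ℝ ∞ Y q)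
    (hf : ContDiffAt ℝ ∞ f (fibreMap Y q)) :
    HasPD 0 (fun z => partials a b f (fibreMap Y z))
      (fun z => partials (a + 1) b f (fibreMap Y z)
        + partials a (b + 1) f (fibreMap Y z) * partials 1 0 Y z) q := by
  have hg := contDiffAt_fibreMap hY
  refine (HasPD.comp (contDiffAt_partials a b hf) hg (.of_contDiffAt (contDiffAt_coord 0 q))
    (.of_contDiffAt hY)).congr ?_
  filter_upwards [hg.continuousAt.eventually (HasPD.partials_one a b hf).eq] with z hz
  rw [hz, pderiv_zero_partials, pderiv_fibreMap_zero, pderiv_fibreMap_one]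
  simp [partials]

theorem HasPD.comp_fibreMap_one {f : Plane → ℝ} (a b : ℕ) (hY : ContDiffAt ℝ ∞ Y q)
    (hf : ContDiffAt ℝ ∞ f (fibreMap Y q)) :
    HasPD 1 (fun z => partials a b f (fibreMap Y z))
      (fun z => partials a (b + 1) f (fibreMap Y z) * partials 0 1 Y z) q := by
  have hg := contDiffAt_fibreMap hY
  refine (HasPD.comp (contDiffAt_partials a b hf) hg (.of_contDiffAt (contDiffAt_coord 0 q))
    (.of_contDiffAt hY)).congr ?_
  filter_upwards [hg.continuousAt.eventually (HasPD.partials_one a b hf).eq] with z hz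
  rw [hz, pderiv_fibreMap_zero, pderiv_fibreMap_one]
  simp [partials]

/-- For such maps the Jacobian is just ∂₂Y. The formula uses only sums, products, powers and one
inverse, so that the rules of `HasPD` differentiate it directly. -/
theorem pull_fibreMap_eventuallyEq (S : Plane → Fibre) (hY : ContDiffAt ℝ ∞ Y q)
    (h0 : partials 0 1 Y q ≠ 0) :
    ∀ᶠ z in 𝓝 q, pull (fibreMap Y) S z =
      ![(S (fibreMap Y z) 0 + S (fibreMap Y z) 1 * partials 1 0 Y z
            + S (fibreMap Y z) 2 * partials 1 0 Y z ^ 2 + S (fibreMap Y z) 3 * partials 1 0 Y z ^ 3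
            - partials 2 0 Y z) * (partials 0 1 Y z)⁻¹,
        S (fibreMap Y z) 1 + 2 * (S (fibreMap Y z) 2 * partials 1 0 Y z)
            + 3 * (S (fibreMap Y z) 3 * partials 1 0 Y z ^ 2)
            - 2 * (partials 1 1 Y z * (partials 0 1 Y z)⁻¹),
        S (fibreMap Y z) 2 * partials 0 1 Y z
            + 3 * (S (fibreMap Y z) 3 * (partials 1 0 Y z * partials 0 1 Y z))
            - partials 0 2 Y z * (partials 0 1 Y z)⁻¹,
        S (fibreMap Y z) 3 * partials 0 1 Y z ^ 2] := by
  filter_upwards [(contDiffAt_partials 0 1 hY).continuousAt.eventually_ne h0] with z hz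
  have e1 : pderiv 0 Y z = partials 1 0 Y z := rfl
  have e2 : pderiv 1 Y z = partials 0 1 Y z := rfl
  have e11 : pderiv 0 (pderiv 0 Y) z = partials 2 0 Y z := rfl
  have e12 : pderiv 0 (pderiv 1 Y) z = partials 1 1 Y z := rfl
  have e22 : pderiv 1 (pderiv 1 Y) z = partials 0 2 Y z := rfl
  funext i
  fin_cases i <;> simp [pull, transformedCoeffs, pderiv_fibreMap_zero, pderiv_fibreMap_one, e1, e2,
    e11, e12, e22] <;> field_simp

/-- The computational core of the covariance: all derivatives of Y of order two and higher cancel in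
F¹ and F². -/
theorem F_jet_pull_fibreMap (hY : ContDiffAt ℝ ∞ Y q) (hS : ContDiffAt ℝ ∞ S (fibreMap Y q))
    (h0 : partials 0 1 Y q ≠ 0) :
    F1 (jet 2 (pull (fibreMap Y) S) q) = partials 0 1 Y q
        * (F1 (jet 2 S (fibreMap Y q)) + partials 1 0 Y q * F2 (jet 2 S (fibreMap Y q))) ∧
      F2 (jet 2 (pull (fibreMap Y) S) q) = partials 0 1 Y q
        * (partials 0 1 Y q * F2 (jet 2 S (fibreMap Y q))) := by
  have hSi : ∀ i, ContDiffAt ℝ ∞ (fun z => S z i) (fibreMap Y q) := contDiffAt_pi.1 hS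
  rw [jet_congr (pull_fibreMap_eventuallyEq S hY h0)]
  simp only [F1, F2, jet_u, Matrix.cons_val]
  -- `A` collects the derivatives of the coefficients along the map and `P` those of Y. The rules
  -- `A0`, `A1`, `P0`, `P1` express their derivatives again in `A` and `P`, so what remains is
  -- formal differentiation.
  obtain ⟨A, hA⟩ : ∃ A : Fin 4 → ℕ → ℕ → Plane → ℝ,
      A = fun i a b z => partials a b (fun w => S w i) (fibreMap Y z) := ⟨_, rfl⟩
  obtain ⟨P, hP⟩ : ∃ P : ℕ → ℕ → Plane → ℝ, P = fun a b => partials a b Y := ⟨_, rfl⟩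
  have hAz : ∀ i z, S (fibreMap Y z) i = A i 0 0 z := fun i z => by rw [hA]; rfl
  have hAq : ∀ i a b, partials a b (fun w => S w i) (fibreMap Y q) = A i a b q := fun i a b => by
    rw [hA]
  have hPz : ∀ a b, partials a b Y = P a b := fun a b => by rw [hP]
  have A0 : ∀ i a b, HasPD 0 (A i a b)
      (fun z => A i (a + 1) b z + A i a (b + 1) z * P 1 0 z) q := fun i a b => by
    rw [hA, hP]
    exact HasPD.comp_fibreMap_zero a b hY (hSi i)
  have A1 : ∀ i a b, HasPD 1 (A i a b) (fun z => A i a (b + 1) z * P 0 1 z) q := fun i a b => by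
    rw [hA, hP]
    exact HasPD.comp_fibreMap_one a b hY (hSi i)
  have P0 : ∀ a b, HasPD 0 (P a b) (P (a + 1) b) q := fun a b => by
    rw [hP]
    exact HasPD.partials_zero a b hY
  have P1 : ∀ a b, HasPD 1 (P a b) (P a (b + 1)) q := fun a b => by
    rw [hP]
    exact HasPD.partials_one a b hY
  simp only [hAz, hAq, hPz] at h0 ⊢
  clear hA hP hAz hAq hPz hSi hS hY
  have R0 : HasPD 0 (fun z => (P 0 1 z)⁻¹) (fun z => -(P 0 1 z)⁻¹ ^ 2 * P 1 1 z) q :=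
    (P0 0 1).inv h0
  have R1 : HasPD 1 (fun z => (P 0 1 z)⁻¹) (fun z => -(P 0 1 z)⁻¹ ^ 2 * P 0 2 z) q :=
    (P1 0 1).inv h0
  have u0_0 := (by
    apply_rules (maxDepth := 400) [A0, P0, R0, HasPD.const_mul, HasPD.cube, HasPD.sq, HasPD.sub,
    HasPD.add, HasPD.mul] : HasPD 0 (fun z => (A 0 0 0 z + A 1 0 0 z * P 1 0 z + A 2 0 0 z * P 1 0 z ^ 2
      + A 3 0 0 z * P 1 0 z ^ 3 - P 2 0 z) * (P 0 1 z)⁻¹) _ q)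
  have u0_1 := (by
    apply_rules (maxDepth := 400) [A1, P1, R1, HasPD.const_mul, HasPD.cube, HasPD.sq, HasPD.sub,
    HasPD.add, HasPD.mul] : HasPD 1 (fun z => (A 0 0 0 z + A 1 0 0 z * P 1 0 z + A 2 0 0 z * P 1 0 z ^ 2
      + A 3 0 0 z * P 1 0 z ^ 3 - P 2 0 z) * (P 0 1 z)⁻¹) _ q)
  have u1_0 := (by
    apply_rules (maxDepth := 400) [A0, P0, R0, HasPD.const_mul, HasPD.cube, HasPD.sq, HasPD.sub,
    HasPD.add, HasPD.mul] : HasPD 0 (fun z => A 1 0 0 z + 2 * (A 2 0 0 z * P 1 0 z) + 3 * (A 3 0 0 z * P 1 0 z ^ 2)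
      - 2 * (P 1 1 z * (P 0 1 z)⁻¹)) _ q)
  have u1_1 := (by
    apply_rules (maxDepth := 400) [A1, P1, R1, HasPD.const_mul, HasPD.cube, HasPD.sq, HasPD.sub,
    HasPD.add, HasPD.mul] : HasPD 1 (fun z => A 1 0 0 z + 2 * (A 2 0 0 z * P 1 0 z) + 3 * (A 3 0 0 z * P 1 0 z ^ 2)
      - 2 * (P 1 1 z * (P 0 1 z)⁻¹)) _ q)
  have u2_0 := (by
    apply_rules (maxDepth := 400) [A0, P0, R0, HasPD.const_mul, HasPD.cube, HasPD.sq, HasPD.sub,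
    HasPD.add, HasPD.mul] : HasPD 0 (fun z => A 2 0 0 z * P 0 1 z + 3 * (A 3 0 0 z * (P 1 0 z * P 0 1 z))
      - P 0 2 z * (P 0 1 z)⁻¹) _ q)
  have u2_1 := (by
    apply_rules (maxDepth := 400) [A1, P1, R1, HasPD.const_mul, HasPD.cube, HasPD.sq, HasPD.sub,
    HasPD.add, HasPD.mul] : HasPD 1 (fun z => A 2 0 0 z * P 0 1 z + 3 * (A 3 0 0 z * (P 1 0 z * P 0 1 z))
      - P 0 2 z * (P 0 1 z)⁻¹) _ q)
  have u3_0 := (by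
    apply_rules (maxDepth := 400) [A0, P0, R0, HasPD.const_mul, HasPD.cube, HasPD.sq, HasPD.sub,
    HasPD.add, HasPD.mul] : HasPD 0 (fun z => A 3 0 0 z * P 0 1 z ^ 2) _ q)
  have u3_1 := (by
    apply_rules (maxDepth := 400) [A1, P1, R1, HasPD.const_mul, HasPD.cube, HasPD.sq, HasPD.sub,
    HasPD.add, HasPD.mul] : HasPD 1 (fun z => A 3 0 0 z * P 0 1 z ^ 2) _ q)
  -- Only the second derivatives that occur in F¹ or F² are computed.
  have w0_11 := u0_1.value₂ (l := 1) (by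
    apply_rules (maxDepth := 400) [A1, P1, R1, HasPD.neg, HasPD.const_mul, HasPD.cube, HasPD.sq, HasPD.sub,
    HasPD.add, HasPD.mul])
  have w1_10 := u1_1.value₂ (l := 0) (by
    apply_rules (maxDepth := 400) [A0, P0, R0, HasPD.neg, HasPD.const_mul, HasPD.cube, HasPD.sq, HasPD.sub,
    HasPD.add, HasPD.mul])
  have w1_11 := u1_1.value₂ (l := 1) (by
    apply_rules (maxDepth := 400) [A1, P1, R1, HasPD.neg, HasPD.const_mul, HasPD.cube, HasPD.sq, HasPD.sub,
    HasPD.add, HasPD.mul])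
  have w2_00 := u2_0.value₂ (l := 0) (by
    apply_rules (maxDepth := 400) [A0, P0, R0, HasPD.neg, HasPD.const_mul, HasPD.cube, HasPD.sq, HasPD.sub,
    HasPD.add, HasPD.mul])
  have w2_10 := u2_1.value₂ (l := 0) (by
    apply_rules (maxDepth := 400) [A0, P0, R0, HasPD.neg, HasPD.const_mul, HasPD.cube, HasPD.sq, HasPD.sub,
    HasPD.add, HasPD.mul])
  have w3_00 := u3_0.value₂ (l := 0) (by
    apply_rules (maxDepth := 400) [A0, P0, R0, HasPD.neg, HasPD.const_mul, HasPD.cube, HasPD.sq, HasPD.sub,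
    HasPD.add, HasPD.mul])
  have p00 : ∀ f, partials 0 0 f q = f q := fun _ => rfl
  have p10 : ∀ f, partials 1 0 f q = pderiv 0 f q := fun _ => rfl
  have p01 : ∀ f, partials 0 1 f q = pderiv 1 f q := fun _ => rfl
  have p20 : ∀ f, partials 2 0 f q = pderiv 0 (pderiv 0 f) q := fun _ => rfl
  have p11 : ∀ f, partials 1 1 f q = pderiv 0 (pderiv 1 f) q := fun _ => rfl
  have p02 : ∀ f, partials 0 2 f q = pderiv 1 (pderiv 1 f) q := fun _ => rfl
  simp only [p00, p10, p01, p20, p11, p02, u0_0.value, u0_1.value, u1_0.value, u1_1.value,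
    u2_0.value, u2_1.value, u3_0.value, w0_11, w1_10, w1_11, w2_00, w2_10, w3_00, u3_1.value,
    zero_add, Nat.reduceAdd]
  clear w0_11 w1_10 w1_11 w2_00 w2_10 w3_00 u0_0 u0_1 u1_0 u1_1 u2_0 u2_1 u3_0 u3_1 R0 R1 A0 A1 P0 P1
  constructor
  · field_simp
    ring
  · field_simp
    ring

end FibreMap

/-- The pair `(F¹, F²)`. -/
def curv (j : Fin 2) : JetSpace 2 → ℝ := ![F1, F2] j

/-- The pair `(F¹, F²)` transforms under `g` as a covector times the Jacobian determinant. -/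
def Covariant (g : Plane → Plane) (q : Plane) : Prop :=
  ∀ S : Plane → Fibre, ContDiffAt ℝ ∞ S (g q) → ∀ j, curv j (jet 2 (pull g S) q)
    = jac g q * (pderiv j (fun z => g z 0) q * curv 0 (jet 2 S (g q))
      + pderiv j (fun z => g z 1) q * curv 1 (jet 2 S (g q)))

theorem Covariant.congr {g g' : Plane → Plane} {q : Plane} (h : Covariant g q)
    (hc : ContinuousAt g q) (e : g =ᶠ[𝓝 q] g') : Covariant g' q := by
  have hm : ∀ m, (fun z => g z m) =ᶠ[𝓝 q] fun z => g' z m := fun m => by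
    filter_upwards [e] with z hz
    rw [hz]
  intro S hS j
  rw [← e.eq_of_nhds] at hS
  rw [← jet_congr (pull_congr e hc (.refl _ S)), h S hS j, jac_congr e,
    (pderiv_congr j (hm 0)).eq_of_nhds, (pderiv_congr j (hm 1)).eq_of_nhds, e.eq_of_nhds]

theorem Covariant.comp {g h : Plane → Plane} {q : Plane} (cg : Covariant g (h q))
    (ch : Covariant h q) (hg : ContDiffAt ℝ ∞ g (h q)) (hh : ContDiffAt ℝ ∞ h q)
    (h0 : jac g (h q) ≠ 0) (h0' : jac h q ≠ 0) : Covariant (fun z => g (h z)) q := by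
  intro S hS j
  have dg : DifferentiableAt ℝ g (h q) := hg.differentiableAt (by simp)
  have dh : DifferentiableAt ℝ h q := hh.differentiableAt (by simp)
  rw [← jet_congr (pull_pull S hg hh h0 h0'), ch _ (contDiffAt_pull hg hS h0), cg S hS, cg S hS,
    jac_comp dg dh, pderiv_comp (f := fun z => g z 0) j (differentiableAt_pi.1 dg 0) dh,
    pderiv_comp (f := fun z => g z 1) j (differentiableAt_pi.1 dg 1) dh]
  ring

theorem covariant_fibreMap {Y : Plane → ℝ} {q : Plane} (hY : ContDiffAt ℝ ∞ Y q)
    (h0 : pderiv 1 Y q ≠ 0) : Covariant (fibreMap Y) q := by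
  intro S hS j
  have h := F_jet_pull_fibreMap hY hS h0
  have e1 : partials 1 0 Y q = pderiv 0 Y q := rfl
  have e2 : partials 0 1 Y q = pderiv 1 Y q := rfl
  rw [e1, e2] at h
  rw [jac_fibreMap, pderiv_fibreMap_zero, pderiv_fibreMap_one]
  fin_cases j
  · simpa [curv] using h.1
  · simpa [curv] using h.2

/-- The map `(x, y) ↦ (y, x)`. -/
def swapMap (z : Plane) : Plane := ![z 1, z 0]

theorem swapMap_swapMap (z : Plane) : swapMap (swapMap z) = z := by
  funext i
  fin_cases i <;> rfl

theorem contDiff_swapMap : ContDiff ℝ ∞ swapMap :=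
  contDiff_pi.2 fun m => by
    fin_cases m
    exacts [contDiff_apply ℝ ℝ 1, contDiff_apply ℝ ℝ 0]

theorem pderiv_swapMap (j m : Fin 2) :
    pderiv j (fun z => swapMap z m) = fun _ => if m = j then 0 else 1 := by
  funext z
  fin_cases m
  · refine (pderiv_coord j 1 z).trans ?_
    fin_cases j <;> simp
  · refine (pderiv_coord j 0 z).trans ?_
    fin_cases j <;> simp

theorem jac_swapMap (q : Plane) : jac swapMap q = -1 := by
  simp [jac, det2, pderiv_swapMap]

theorem HasPD.comp_swapMap_zero {f : Plane → ℝ} {q : Plane}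
    (hf : ContDiffAt ℝ ∞ f (swapMap q)) :
    HasPD 0 (fun z => f (swapMap z)) (fun z => pderiv 1 f (swapMap z)) q := by
  refine (HasPD.comp hf contDiff_swapMap.contDiffAt (.of_contDiffAt
    (contDiffAt_pi.1 contDiff_swapMap.contDiffAt 0)) (.of_contDiffAt
      (contDiffAt_pi.1 contDiff_swapMap.contDiffAt 1))).congr (.of_eq ?_)
  funext z
  simp [pderiv_swapMap]

theorem HasPD.comp_swapMap_one {f : Plane → ℝ} {q : Plane}
    (hf : ContDiffAt ℝ ∞ f (swapMap q)) :
    HasPD 1 (fun z => f (swapMap z)) (fun z => pderiv 0 f (swapMap z)) q := by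
  refine (HasPD.comp hf contDiff_swapMap.contDiffAt (.of_contDiffAt
    (contDiffAt_pi.1 contDiff_swapMap.contDiffAt 0)) (.of_contDiffAt
      (contDiffAt_pi.1 contDiff_swapMap.contDiffAt 1))).congr (.of_eq ?_)
  funext z
  simp [pderiv_swapMap]

theorem partials_comp_swapMap {f : Plane → ℝ} {q : Plane} (a b : ℕ)
    (hf : ContDiffAt ℝ ∞ f (swapMap q)) :
    partials a b (fun z => f (swapMap z)) q = partials b a f (swapMap q) := by
  have hc : ContDiffAt ℝ ∞ (fun z => f (swapMap z)) q := hf.comp q contDiff_swapMap.contDiffAt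
  induction b generalizing f with
  | zero =>
    induction a generalizing f with
    | zero => rfl
    | succ a ih =>
      have h := HasPD.comp_swapMap_zero hf
      rw [← partials_pderiv_zero _ _ hc, (partials_congr a 0 h.eq).eq_of_nhds,
        ih (contDiffAt_pderiv 1 hf) h.smooth', partials_pderiv_one]
  | succ b ih =>
    have h := HasPD.comp_swapMap_one hf
    rw [← partials_pderiv_one, (partials_congr a b h.eq).eq_of_nhds,
      ih (contDiffAt_pderiv 0 hf) h.smooth', partials_pderiv_zero _ _ hf]

theorem pull_swapMap (S : Plane → Fibre) (z : Plane) :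
    pull swapMap S z = ![-S (swapMap z) 3, -S (swapMap z) 2, -S (swapMap z) 1,
      -S (swapMap z) 0] := by
  funext i
  fin_cases i <;> simp [pull, transformedCoeffs, pderiv_swapMap, div_neg]

theorem covariant_swapMap (q : Plane) : Covariant swapMap q := by
  intro S hS j
  have hSi : ∀ i, ContDiffAt ℝ ∞ (fun z => S z i) (swapMap q) := contDiffAt_pi.1 hS
  have hi : ∀ i a b, partials a b (fun z => -S (swapMap z) i) q
      = -partials b a (fun z => S z i) (swapMap q) := by
    intro i a b
    have h := partials_const_mul (f := fun z => S (swapMap z) i) a b (-1)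
      ((hSi i).comp q contDiff_swapMap.contDiffAt)
    rw [partials_comp_swapMap (f := fun z => S z i) a b (hSi i)] at h
    simpa using h
  fin_cases j <;> simp [curv, F1, F2, jet_u, pull_swapMap, hi, jac_swapMap, pderiv_swapMap] <;> ring

/-- As ∂₁g⁰ ≠ 0, the map b(x, y) = (g⁰(x, y), y) is a local diffeomorphism. It is a fibre map
conjugated by the swap, and g = `fibreMap Y` ∘ b with Y = g¹ ∘ b⁻¹. Covariance passes to composites,
so it follows from the cases of swaps and fibre maps. -/
theorem covariant_of_pderiv_ne_zero {g : Plane → Plane} {q : Plane} (hg : ContDiffAt ℝ ∞ g q)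
    (h0 : jac g q ≠ 0) (h1 : pderiv 0 (fun z => g z 0) q ≠ 0) : Covariant g q := by
  obtain ⟨Y', hY'⟩ : ∃ Y' : Plane → ℝ, Y' = fun z => g (swapMap z) 0 := ⟨_, rfl⟩
  have hg0 : ContDiffAt ℝ ∞ (fun z => g z 0) (swapMap (swapMap q)) := by
    rw [swapMap_swapMap]
    exact contDiffAt_pi.1 hg 0
  have sY' : ContDiffAt ℝ ∞ Y' (swapMap q) := by
    rw [hY']
    exact hg0.comp (swapMap q) contDiff_swapMap.contDiffAt
  have dY' : pderiv 1 Y' (swapMap q) ≠ 0 := by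
    rw [hY', (HasPD.comp_swapMap_one hg0).value, swapMap_swapMap]
    exact h1
  have sw : ∀ z, ContDiffAt ℝ ∞ swapMap z := fun z => contDiff_swapMap.contDiffAt
  have jw : ∀ z, jac swapMap z ≠ 0 := fun z => by simp [jac_swapMap]
  have jY' : jac (fibreMap Y') (swapMap q) ≠ 0 := by rwa [jac_fibreMap]
  have sF := contDiffAt_fibreMap sY'
  have c1 : Covariant (fun z => fibreMap Y' (swapMap z)) q :=
    (covariant_fibreMap sY' dY').comp (covariant_swapMap q) sF (sw q) jY' (jw q)
  have s1 : ContDiffAt ℝ ∞ (fun z => fibreMap Y' (swapMap z)) q := sF.comp q (sw q)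
  have j1 : jac (fun z => fibreMap Y' (swapMap z)) q ≠ 0 := by
    rw [jac_comp (sF.differentiableAt (by simp)) ((sw q).differentiableAt (by simp))]
    exact mul_ne_zero jY' (jw q)
  -- In coordinates b(x, y) = (g⁰(x, y), y).
  obtain ⟨b, hb⟩ : ∃ b : Plane → Plane, b = fun z => swapMap (fibreMap Y' (swapMap z)) := ⟨_, rfl⟩
  have c2 : Covariant b q := by
    rw [hb]
    exact (covariant_swapMap _).comp c1 (sw _) s1 (jw _) j1
  have s2 : ContDiffAt ℝ ∞ b q := by
    rw [hb]
    exact (sw (fibreMap Y' (swapMap q))).comp q s1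
  have d2 : DifferentiableAt ℝ b q := s2.differentiableAt (by simp)
  have j2 : jac b q ≠ 0 := by
    rw [hb, jac_comp ((sw _).differentiableAt (by simp)) (s1.differentiableAt (by simp))]
    exact mul_ne_zero (jw _) j1
  have hb0 : ∀ z, b z 0 = g z 0 := fun z => by
    rw [hb]
    change Y' (swapMap z) = _
    rw [hY']
    exact congrArg (fun z => g z 0) (swapMap_swapMap z)
  obtain ⟨e, he⟩ := exists_hasFDerivAt_equiv d2 j2
  have hst := s2.hasStrictFDerivAt' he (by simp)
  have sc := s2.to_localInverse he (by simp)
  obtain ⟨c, hc⟩ : ∃ c, c = s2.localInverse he (by simp) := ⟨_, rfl⟩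
  rw [← hc] at sc
  have hcb : ∀ᶠ z in 𝓝 q, c (b z) = z := by
    rw [hc]
    exact hst.eventually_left_inverse
  have hcq : c (b q) = q := hcb.self_of_nhds
  obtain ⟨Y, hY⟩ : ∃ Y : Plane → ℝ, Y = fun w => g (c w) 1 := ⟨_, rfl⟩
  have sY : ContDiffAt ℝ ∞ Y (b q) := by
    rw [hY]
    exact ContDiffAt.comp (g := fun z => g z 1) (b q) (by rw [hcq]; exact contDiffAt_pi.1 hg 1) sc
  have eg : (fun z => fibreMap Y (b z)) =ᶠ[𝓝 q] g := by
    filter_upwards [hcb] with z hz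
    funext m
    fin_cases m
    · exact hb0 z
    · change Y (b z) = g z 1
      rw [hY]
      simp only [hz]
  -- The remaining factor is also non-degenerate, because its Jacobian divides that of g.
  have jY : jac (fibreMap Y) (b q) ≠ 0 := by
    intro hj
    have := jac_comp ((contDiffAt_fibreMap sY).differentiableAt (by simp)) d2
    rw [hj, zero_mul, jac_congr eg] at this
    exact h0 this
  refine ((covariant_fibreMap sY (by rwa [jac_fibreMap] at jY)).comp c2 (contDiffAt_fibreMap sY)
    s2 jY j2).congr ?_ eg
  exact ((contDiffAt_fibreMap sY).comp q s2).continuousAt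

/-- If ∂₁g⁰ = 0, then ∂₂g⁰ ≠ 0 because the Jacobian is non-zero, and exchanging the source
coordinates reduces to the previous case. -/
theorem covariant {g : Plane → Plane} {q : Plane} (hg : ContDiffAt ℝ ∞ g q) (h0 : jac g q ≠ 0) :
    Covariant g q := by
  by_cases h1 : pderiv 0 (fun z => g z 0) q = 0
  · have h2 : pderiv 1 (fun z => g z 0) q ≠ 0 := by
      intro h2
      apply h0
      simp [jac, det2, h1, h2]
    have e : (fun z => g (swapMap (swapMap z))) = g := by
      funext z
      rw [swapMap_swapMap]
    have hg' : ContDiffAt ℝ ∞ g (swapMap (swapMap q)) := by rwa [swapMap_swapMap]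
    have sw : ∀ z, ContDiffAt ℝ ∞ swapMap z := fun z => contDiff_swapMap.contDiffAt
    have s1 : ContDiffAt ℝ ∞ (fun z => g (swapMap z)) (swapMap q) := hg'.comp _ (sw _)
    have j1 : jac (fun z => g (swapMap z)) (swapMap q) ≠ 0 := by
      rw [jac_comp (hg'.differentiableAt (by simp)) ((sw _).differentiableAt (by simp)),
        jac_swapMap, swapMap_swapMap]
      simpa using h0
    have c1 : Covariant (fun z => g (swapMap z)) (swapMap q) := by
      refine covariant_of_pderiv_ne_zero s1 j1 ?_
      rw [(HasPD.comp_swapMap_zero (f := fun z => g z 0) (contDiffAt_pi.1 hg' 0)).value,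
        swapMap_swapMap]
      exact h2
    have := c1.comp (covariant_swapMap q) s1 (sw q) j1 (by simp [jac_swapMap])
    rwa [e] at this
  · exact covariant_of_pderiv_ne_zero hg h0 h1

/-! ### The transformation laws on `J³π` -/

theorem contDiffAt_jet (k : ℕ) {S : Plane → Fibre} {p : Plane} (hS : ContDiffAt ℝ ∞ S p) :
    ContDiffAt ℝ ∞ (jet k S) p :=
  contDiffAt_id.prodMk (contDiffAt_pi.2 fun σ => contDiffAt_pi.2 fun i =>
    contDiffAt_partials σ.1.1 σ.1.2 (contDiffAt_pi.1 hS i))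

theorem contDiff_curv (j : Fin 2) : ContDiff ℝ ∞ (curv j) := by
  fin_cases j
  exacts [contDiff_F1, contDiff_F2]

/-- The covariance law holds at all points near `q` and may be differentiated along the section;
this is why smoothness is required on neighbourhoods. -/
theorem totalDeriv_curv_jet_pull {g : Plane → Plane} {S : Plane → Fibre} {q : Plane}
    (hg : ∀ᶠ z in 𝓝 q, ContDiffAt ℝ ∞ g z) (hS : ∀ᶠ z in 𝓝 (g q), ContDiffAt ℝ ∞ S z)
    (h0 : jac g q ≠ 0) (l j : Fin 2) :
    totalDeriv l (curv j) (jet 3 (pull g S) q)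
      = pderiv l (jac g) q * (pderiv j (fun z => g z 0) q * curv 0 (jet 2 S (g q))
          + pderiv j (fun z => g z 1) q * curv 1 (jet 2 S (g q)))
        + jac g q * (pderiv l (pderiv j fun z => g z 0) q * curv 0 (jet 2 S (g q))
          + pderiv j (fun z => g z 0) q
            * (totalDeriv 0 (curv 0) (jet 3 S (g q)) * pderiv l (fun z => g z 0) q
              + totalDeriv 1 (curv 0) (jet 3 S (g q)) * pderiv l (fun z => g z 1) q)
          + (pderiv l (pderiv j fun z => g z 1) q * curv 1 (jet 2 S (g q))
          + pderiv j (fun z => g z 1) q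
            * (totalDeriv 0 (curv 1) (jet 3 S (g q)) * pderiv l (fun z => g z 0) q
              + totalDeriv 1 (curv 1) (jet 3 S (g q)) * pderiv l (fun z => g z 1) q))) := by
  have hgq := hg.self_of_nhds
  have hSq := hS.self_of_nhds
  have hgm : ∀ m, ContDiffAt ℝ ∞ (fun z => g z m) q := contDiffAt_pi.1 hgq
  have e : (fun z => curv j (jet 2 (pull g S) z)) =ᶠ[𝓝 q] fun z => jac g z
      * (pderiv j (fun z => g z 0) z * curv 0 (jet 2 S (g z))
        + pderiv j (fun z => g z 1) z * curv 1 (jet 2 S (g z))) := by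
    filter_upwards [hg, hgq.continuousAt.eventually hS,
      (contDiffAt_jac hgq).continuousAt.eventually_ne h0] with z hz hz' hz0
    exact covariant hz hz0 S hz' j
  have hc : ∀ m, HasPD l (fun z => curv m (jet 2 S (g z))) _ q := fun m =>
    HasPD.comp ((contDiff_curv m).contDiffAt.comp (g q) (contDiffAt_jet 2 hSq)) hgq
      (.of_contDiffAt (hgm 0)) (.of_contDiffAt (hgm 1))
  have hd : ∀ m, HasPD l (pderiv j fun z => g z m) _ q := fun m =>
    .of_contDiffAt (contDiffAt_pderiv j (hgm m))
  have key := (HasPD.of_contDiffAt (j := l) (contDiffAt_jac hgq)).mul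
    (((hd 0).mul (hc 0)).add ((hd 1).mul (hc 1)))
  rw [totalDeriv_jet (contDiff_curv j) l (contDiffAt_pull hgq hSq h0),
    (pderiv_congr l e).eq_of_nhds, key.value]
  simp only [totalDeriv_jet (contDiff_curv _) _ hSq]
  rfl

theorem pderiv_jac {g : Plane → Plane} {q : Plane} (hg : ContDiffAt ℝ ∞ g q) (l : Fin 2) :
    pderiv l (jac g) q
      = pderiv l (pderiv 0 fun z => g z 0) q * pderiv 1 (fun z => g z 1) q
        + pderiv 0 (fun z => g z 0) q * pderiv l (pderiv 1 fun z => g z 1) q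
        - (pderiv l (pderiv 1 fun z => g z 0) q * pderiv 0 (fun z => g z 1) q
          + pderiv 1 (fun z => g z 0) q * pderiv l (pderiv 0 fun z => g z 1) q) := by
  have hd : ∀ m j, HasPD l (pderiv j fun z => g z m) _ q := fun m j =>
    .of_contDiffAt (contDiffAt_pderiv j (contDiffAt_pi.1 hg m))
  exact (((hd 0 0).mul (hd 1 1)).sub ((hd 0 1).mul (hd 1 0))).value

theorem F3_eq (θ : JetSpace 3) : F3 θ =
    curv 1 (proj θ) * (curv 0 (proj θ) * totalDeriv 0 (curv 1) θ
        - curv 1 (proj θ) * totalDeriv 0 (curv 0) θ)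
      - curv 0 (proj θ) * (curv 0 (proj θ) * totalDeriv 1 (curv 1) θ
        - curv 1 (proj θ) * totalDeriv 1 (curv 0) θ)
      + curv 0 (proj θ) ^ 3 * θ.u 3 0 0 - curv 0 (proj θ) ^ 2 * curv 1 (proj θ) * θ.u 2 0 0
      + curv 0 (proj θ) * curv 1 (proj θ) ^ 2 * θ.u 1 0 0 - curv 1 (proj θ) ^ 3 * θ.u 0 0 0 := rfl

/-- The second derivatives of g coming from D_l Fʲ cancel against the inhomogeneous terms of the
transformed coefficients. These are contracted with the cubic monomials in F¹, F² for exactly this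
purpose. -/
theorem F3_jet_pull {g : Plane → Plane} {S : Plane → Fibre} {q : Plane}
    (hg : ∀ᶠ z in 𝓝 q, ContDiffAt ℝ ∞ g z) (hS : ∀ᶠ z in 𝓝 (g q), ContDiffAt ℝ ∞ S z)
    (h0 : jac g q ≠ 0) :
    F3 (jet 3 (pull g S) q) = jac g q ^ 5 * F3 (jet 3 S (g q)) := by
  have hgq := hg.self_of_nhds
  have hSq := hS.self_of_nhds
  have hp : ∀ T p, (proj (jet 3 T p) : JetSpace 2) = jet 2 T p := fun T p => rfl
  have hs : ∀ m, pderiv 1 (pderiv 0 fun z => g z m) q = pderiv 0 (pderiv 1 fun z => g z m) q :=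
    fun m => (pderiv_comm_eventually 1 0 (contDiffAt_pi.1 hgq m)).eq_of_nhds
  have ha : ∀ i, (jet 3 (pull g S) q).u i 0 0 = pull g S q i := fun i => rfl
  have hb : ∀ i, (jet 3 S (g q)).u i 0 0 = S (g q) i := fun i => rfl
  obtain ⟨t, ht⟩ : ∃ t, t = pull g S q := ⟨_, rfl⟩
  simp only [F3_eq, hp, covariant hgq h0 S hSq, totalDeriv_curv_jet_pull hg hS h0, ha, hb,
    pderiv_jac hgq, hs, ← ht]
  have e0 := congrFun ht 0
  have e1 := congrFun ht 1
  have e2 := congrFun ht 2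
  have e3 := congrFun ht 3
  simp only [pull, transformedCoeffs, Matrix.cons_val] at e0 e1 e2 e3
  simp only [jac, det2] at h0 ⊢
  rw [eq_div_iff h0] at e0 e1 e2 e3
  clear ht hs ha hb hp
  generalize curv 0 (jet 2 S (g q)) = f0 at *
  generalize curv 1 (jet 2 S (g q)) = f1 at *
  generalize totalDeriv 0 (curv 0) (jet 3 S (g q)) = D00 at *
  generalize totalDeriv 0 (curv 1) (jet 3 S (g q)) = D01 at *
  generalize totalDeriv 1 (curv 0) (jet 3 S (g q)) = D10 at *
  generalize totalDeriv 1 (curv 1) (jet 3 S (g q)) = D11 at *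
  generalize pderiv 0 (pderiv 0 fun z => g z 0) q = X11 at *
  generalize pderiv 0 (pderiv 1 fun z => g z 0) q = X12 at *
  generalize pderiv 1 (pderiv 1 fun z => g z 0) q = X22 at *
  generalize pderiv 0 (pderiv 0 fun z => g z 1) q = Y11 at *
  generalize pderiv 0 (pderiv 1 fun z => g z 1) q = Y12 at *
  generalize pderiv 1 (pderiv 1 fun z => g z 1) q = Y22 at *
  generalize pderiv 0 (fun z => g z 0) q = X1 at *
  generalize pderiv 1 (fun z => g z 0) q = X2 at *
  generalize pderiv 0 (fun z => g z 1) q = Y1 at *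
  generalize pderiv 1 (fun z => g z 1) q = Y2 at *
  generalize S (g q) 0 = a0 at *
  generalize S (g q) 1 = a1 at *
  generalize S (g q) 2 = a2 at *
  generalize S (g q) 3 = a3 at *
  obtain ⟨J, hJ⟩ : ∃ J, J = X1 * Y2 - X2 * Y1 := ⟨_, rfl⟩
  obtain ⟨p0, hp0⟩ : ∃ p0, p0 = X1 * f0 + Y1 * f1 := ⟨_, rfl⟩
  obtain ⟨p1, hp1⟩ : ∃ p1, p1 = X2 * f0 + Y2 * f1 := ⟨_, rfl⟩
  rw [← hJ] at h0 e0 e1 e2 e3 ⊢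
  rw [← hp0, ← hp1]
  -- The derivatives of J are absent here: they contribute multiples of (p0, p1) to the derivatives
  -- of the pair and drop out of the antisymmetric expressions F¹ D_l F² - F² D_l F¹.
  have key : (J * p1) * ((J * p0) * (J * (X12 * f0 + X2 * (D00 * X1 + D10 * Y1)
        + (Y12 * f1 + Y2 * (D01 * X1 + D11 * Y1))))
        - (J * p1) * (J * (X11 * f0 + X1 * (D00 * X1 + D10 * Y1)
        + (Y11 * f1 + Y1 * (D01 * X1 + D11 * Y1)))))
      - (J * p0) * ((J * p0) * (J * (X22 * f0 + X2 * (D00 * X2 + D10 * Y2)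
        + (Y22 * f1 + Y2 * (D01 * X2 + D11 * Y2))))
        - (J * p1) * (J * (X12 * f0 + X1 * (D00 * X2 + D10 * Y2)
        + (Y12 * f1 + Y1 * (D01 * X2 + D11 * Y2)))))
      + J ^ 2 * (p0 ^ 3 * (t 3 * J) - p0 ^ 2 * p1 * (t 2 * J) + p0 * p1 ^ 2 * (t 1 * J)
        - p1 ^ 3 * (t 0 * J))
      = J ^ 2 * (J ^ 3 * (f1 * (f0 * D01 - f1 * D00) - f0 * (f0 * D11 - f1 * D10)
        + f0 ^ 3 * a3 - f0 ^ 2 * f1 * a2 + f0 * f1 ^ 2 * a1 - f1 ^ 3 * a0)) := by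
    rw [e0, e1, e2, e3]
    subst hp0 hp1 hJ
    ring
  linear_combination key

/-! ### Moves on jets -/

theorem exists_mem_orbit_translate {k : ℕ} (θ : JetSpace k) : ((0, θ.2) : JetSpace k) ∈ orbit k θ := by
  obtain ⟨S, hS, e⟩ := exists_jet_eq θ
  have hp : ∀ m j : Fin 2, pderiv j (fun z : Plane => (z + θ.1) m)
      = fun _ => if m = j then 1 else 0 := by
    intro m j
    funext z
    rw [← pderiv_coord j m (z + θ.1)]
    simp only [pderiv]
    rw [← fderiv_comp_add_right]
  have hpull : pull (fun z => z + θ.1) S = fun z => S (z + θ.1) := by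
    funext z i
    simp only [pull, hp, pderiv_const]
    fin_cases i <;> simp [transformedCoeffs]
  have h := jet_pull_mem_orbit (k := k) (q := 0) (g := fun z => z + θ.1) (by fun_prop) hS
    (by simp only [jac, det2, hp]; simp)
  rw [hpull] at h
  simp only [zero_add] at h
  rw [e] at h
  convert h using 1
  refine Prod.ext rfl (funext fun σ => funext fun i => ?_)
  rw [jet_snd_apply, partials_comp_add (fun z => S z i), zero_add, ← jet_snd_apply, e]

/-- The polynomial map with the derivatives `c m a b` for `a, b ≤ n` at the origin. -/
def polyMap (n : ℕ) (c : Fin 2 → ℕ → ℕ → ℝ) (z : Plane) : Plane :=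
  fun m => taylorPoly n (c m) 0 z

theorem contDiff_polyMap (n : ℕ) (c : Fin 2 → ℕ → ℕ → ℝ) : ContDiff ℝ ∞ (polyMap n c) :=
  contDiff_pi.2 fun m => contDiff_taylorPoly n (c m) 0

theorem partials_polyMap (n : ℕ) (c : Fin 2 → ℕ → ℕ → ℝ) (m : Fin 2) {a b : ℕ} (h : a + b ≤ n) :
    partials a b (fun z => polyMap n c z m) 0 = c m a b :=
  partials_taylorPoly n (c m) 0 h

/-- The `2`-jets `d`, `h` of maps of the plane that fix the origin. -/
def quadraticMap (d : Fin 2 → Fin 2 → ℝ) (h : Fin 2 → Fin 2 → Fin 2 → ℝ) : Plane → Plane :=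
  polyMap 2 fun m a b =>
    if (a, b) = (1, 0) then d m 0 else if (a, b) = (0, 1) then d m 1
    else if (a, b) = (2, 0) then h m 0 0 else if (a, b) = (1, 1) then h m 0 1
    else if (a, b) = (0, 2) then h m 1 1 else 0

section QuadraticMap

variable (d : Fin 2 → Fin 2 → ℝ) (h : Fin 2 → Fin 2 → Fin 2 → ℝ)

theorem contDiff_quadraticMap : ContDiff ℝ ∞ (quadraticMap d h) := contDiff_polyMap 2 _

theorem quadraticMap_zero : quadraticMap d h 0 = 0 := by
  funext m
  change partials 0 0 (fun z => quadraticMap d h z m) 0 = 0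
  exact (partials_polyMap 2 _ m (a := 0) (b := 0) (by omega)).trans (by simp)

theorem pderiv_quadraticMap (m j : Fin 2) :
    pderiv j (fun z => quadraticMap d h z m) 0 = d m j := by
  fin_cases j
  · exact (partials_polyMap 2 _ m (a := 1) (b := 0) (by omega)).trans (by simp)
  · exact (partials_polyMap 2 _ m (a := 0) (b := 1) (by omega)).trans (by simp)

theorem pderiv_pderiv_quadraticMap (hs : ∀ m, h m 1 0 = h m 0 1) (m j l : Fin 2) :
    pderiv j (pderiv l fun z => quadraticMap d h z m) 0 = h m j l := by
  have h01 : pderiv 0 (pderiv 1 fun z => quadraticMap d h z m) 0 = h m 0 1 :=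
    (partials_polyMap 2 _ m (a := 1) (b := 1) (by omega)).trans (by simp)
  fin_cases j <;> fin_cases l
  · exact (partials_polyMap 2 _ m (a := 2) (b := 0) (by omega)).trans (by simp)
  · exact h01
  · refine Eq.trans ?_ (h01.trans (hs m).symm)
    exact (pderiv_comm_eventually 1 0
      (contDiffAt_pi.1 (contDiff_quadraticMap d h).contDiffAt m)).eq_of_nhds
  · exact (partials_polyMap 2 _ m (a := 0) (b := 2) (by omega)).trans (by simp)

theorem jac_quadraticMap : jac (quadraticMap d h) 0 = det2 d := by
  simp only [jac, pderiv_quadraticMap]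

end QuadraticMap

theorem exists_mem_orbit_two (θ : JetSpace 2) (hθ : θ.1 = 0) (d : Fin 2 → Fin 2 → ℝ)
    (h0 : det2 d ≠ 0) : ∃ θ' ∈ orbit 2 θ, θ'.1 = 0 ∧
      ∀ j, curv j θ' = det2 d * (d 0 j * curv 0 θ + d 1 j * curv 1 θ) := by
  obtain ⟨S, hS, e⟩ := exists_jet_eq θ
  rw [hθ] at e
  have hg := contDiff_quadraticMap d 0
  have hj := jac_quadraticMap d 0
  have hq := quadraticMap_zero d 0
  refine ⟨jet 2 (pull (quadraticMap d 0) S) 0, ?_, rfl, fun j => ?_⟩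
  · have := jet_pull_mem_orbit (k := 2) (q := 0) hg hS (hj.trans_ne h0)
    rwa [hq, e] at this
  · rw [covariant hg.contDiffAt (hj.trans_ne h0) S hS.contDiffAt, hj, hq, e,
      pderiv_quadraticMap, pderiv_quadraticMap]

/-- The effect of a map with an arbitrary 2-jet on the data that later determine the 3-jet up to
equivalence: the coefficients at the point, Fʲ and D_l Fʲ. -/
theorem exists_mem_orbit_three (θ : JetSpace 3) (hθ : θ.1 = 0) (d : Fin 2 → Fin 2 → ℝ)
    (h : Fin 2 → Fin 2 → Fin 2 → ℝ) (h0 : det2 d ≠ 0) (hs : ∀ m, h m 1 0 = h m 0 1) :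
    ∃ θ' ∈ orbit 3 θ, θ'.1 = 0 ∧
      (∀ i, θ'.u i 0 0 = transformedCoeffs (fun i => θ.u i 0 0) d h i) ∧
      (∀ j, curv j (proj θ') = det2 d * (d 0 j * curv 0 (proj θ) + d 1 j * curv 1 (proj θ))) ∧
      ∀ l j, totalDeriv l (curv j) θ'
        = (h 0 l 0 * d 1 1 + d 0 0 * h 1 l 1 - (h 0 l 1 * d 1 0 + d 0 1 * h 1 l 0))
            * (d 0 j * curv 0 (proj θ) + d 1 j * curv 1 (proj θ))
          + det2 d * (h 0 l j * curv 0 (proj θ)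
            + d 0 j * (totalDeriv 0 (curv 0) θ * d 0 l + totalDeriv 1 (curv 0) θ * d 1 l)
            + (h 1 l j * curv 1 (proj θ)
            + d 1 j * (totalDeriv 0 (curv 1) θ * d 0 l + totalDeriv 1 (curv 1) θ * d 1 l))) := by
  obtain ⟨S, hS, e⟩ := exists_jet_eq θ
  rw [hθ] at e
  have hj := jac_quadraticMap d h
  have hq := quadraticMap_zero d h
  have hg := contDiff_quadraticMap d h
  have e2 : (proj θ : JetSpace 2) = jet 2 S 0 := by rw [← e]; rfl
  refine ⟨jet 3 (pull (quadraticMap d h) S) 0, ?_, rfl, fun i => ?_, fun j => ?_, fun l j => ?_⟩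
  · have := jet_pull_mem_orbit (k := 3) (q := 0) hg hS (hj.trans_ne h0)
    rwa [hq, e] at this
  · change pull (quadraticMap d h) S 0 i = _
    simp only [pull, pderiv_quadraticMap, pderiv_pderiv_quadraticMap d h hs, hq]
    rw [← e]
    rfl
  · have := covariant hg.contDiffAt (hj.trans_ne h0) S hS.contDiffAt j
    rw [hj, hq, ← e2, pderiv_quadraticMap, pderiv_quadraticMap] at this
    exact this
  · rw [totalDeriv_curv_jet_pull (.of_forall fun z => hg.contDiffAt)
      (.of_forall fun z => hS.contDiffAt) (hj.trans_ne h0), pderiv_jac hg.contDiffAt]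
    simp only [pderiv_quadraticMap, pderiv_pderiv_quadraticMap d h hs, hq, hj, e, ← e2]

/-- The change of the derivatives of order `k` of the coefficients under the map
`x ↦ x + O(|x|ᵏ⁺²)` with the derivatives `ξ` of order `k + 2`. -/
def coeffShift (ξ : Fin 2 → ℕ → ℕ → ℝ) (i : Fin 4) (a b : ℕ) : ℝ :=
  ![-ξ 1 (a + 2) b, ξ 0 (a + 2) b - 2 * ξ 1 (a + 1) (b + 1),
    2 * ξ 0 (a + 1) (b + 1) - ξ 1 a (b + 2), ξ 0 a (b + 2)] i

theorem transformedCoeffs_id (a : Fibre) (h : Fin 2 → Fin 2 → Fin 2 → ℝ) :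
    transformedCoeffs a (fun m j => if m = j then 1 else 0) h
      = ![a 0 - h 1 0 0, a 1 + (h 0 0 0 - 2 * h 1 0 1), a 2 + (2 * h 0 0 1 - h 1 1 1),
        a 3 + h 0 1 1] := by
  funext i
  fin_cases i <;> simp [transformedCoeffs] <;> ring

theorem partials_coord (m : Fin 2) (a b : ℕ) : partials a b (fun z => z m) (0 : Plane)
    = if (a, b) = (if m = 0 then (1, 0) else (0, 1)) then 1 else 0 := by
  fin_cases m
  · have e : (fun z : Plane => z 0) = monomialAt 0 1 0 := by
      funext z
      simp [monomialAt]
    simpa [e] using partials_monomialAt 0 1 0 a b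
  · have e : (fun z : Plane => z 1) = monomialAt 0 0 1 := by
      funext z
      simp [monomialAt]
    simpa [e] using partials_monomialAt 0 0 1 a b

/-- To the order considered, S ∘ g may be replaced by S and Dg by the identity. Only the second
derivatives of g remain, and after this replacement they enter additively and linearly. -/
theorem partials_pull_of_contact_id {k : ℕ} {g : Plane → Plane} {S : Plane → Fibre}
    (hg : ContDiff ℝ ∞ g) (hS : ContDiff ℝ ∞ S) (hg0 : g 0 = 0)
    (h : ∀ m, Contact (k + 2) 0 (fun z => g z m) (fun z => z m)) (i : Fin 4) {a b : ℕ}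
    (hab : a + b ≤ k) :
    partials a b (fun z => pull g S z i) 0 = partials a b (fun z => S z i) 0
      + coeffShift (fun m a b => partials a b (fun z => g z m) 0) i a b := by
  have hgm : ∀ m, ContDiffAt ℝ ∞ (fun z => g z m) 0 := contDiffAt_pi.1 hg.contDiffAt
  have hSi : ∀ i, ContDiffAt ℝ ∞ (fun z => S z i) 0 := contDiffAt_pi.1 hS.contDiffAt
  have hh : ∀ m j l, ContDiffAt ℝ ∞ (pderiv j (pderiv l fun z => g z m)) 0 := fun m j l =>
    contDiffAt_pderiv j (contDiffAt_pderiv l (hgm m))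
  have hd : ∀ m j : Fin 2, pderiv j (fun z => z m) = fun _ => if m = j then 1 else 0 :=
    fun m j => funext fun p => pderiv_coord j m p
  have hd' : ∀ m j, Contact (k + 1) 0 (pderiv j fun z => g z m)
      (fun _ => if m = j then 1 else 0) := fun m j => by
    rw [← hd]
    exact (h m).pderiv j
  have hc := transformedCoeffs_contact (n := k + 1) (q := 0) (a := fun z => S (g z)) (a' := S)
    (d := fun m j => pderiv j fun z => g z m) (d' := fun m j _ => if m = j then 1 else 0)
    (h := fun m j l => pderiv j (pderiv l fun z => g z m))
    (h' := fun m j l => pderiv j (pderiv l fun z => g z m))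
    (fun i => Contact.comp (f := fun z => S z i) (g := fun z => S z i) (v := fun z => z)
      (.refl (by rw [hg0]; exact hSi i)) hg0 hg.contDiffAt contDiffAt_id
      fun m => (h m).mono (Nat.le_succ _))
    hd' (fun m j l => .refl (hh m j l))
    (by simp [(hd' _ _).value, det2]) (by simp [det2]) i
  simp only [transformedCoeffs_id] at hc
  refine (hc.vanishes a b (Nat.lt_succ_iff.2 hab)).trans ?_
  have p00 : ∀ m, partials a b (pderiv 0 (pderiv 0 fun z => g z m)) 0
      = partials (a + 2) b (fun z => g z m) 0 := fun m => by
    rw [partials_pderiv_zero _ _ (contDiffAt_pderiv 0 (hgm m)), partials_pderiv_zero _ _ (hgm m)]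
  have p01 : ∀ m, partials a b (pderiv 0 (pderiv 1 fun z => g z m)) 0
      = partials (a + 1) (b + 1) (fun z => g z m) 0 := fun m => by
    rw [partials_pderiv_zero _ _ (contDiffAt_pderiv 1 (hgm m)), partials_pderiv_one]
  have p11 : ∀ m, partials a b (pderiv 1 (pderiv 1 fun z => g z m)) 0
      = partials a (b + 2) (fun z => g z m) 0 := fun m => by
    rw [partials_pderiv_one, partials_pderiv_one]
  have c2 : ∀ m j l, ContDiffAt ℝ ∞ (fun z => 2 * pderiv j (pderiv l fun z => g z m) z) 0 :=
    fun m j l => contDiffAt_const.mul (hh m j l)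
  fin_cases i
  · refine (partials_sub a b (hSi 0) (hh 1 0 0)).trans ?_
    rw [p00]
    rfl
  · refine (partials_add a b (hSi 1) ((hh 0 0 0).sub (c2 1 0 1))).trans ?_
    rw [partials_sub a b (hh 0 0 0) (c2 1 0 1), partials_const_mul a b 2 (hh 1 0 1), p00, p01]
    rfl
  · refine (partials_add a b (hSi 2) ((c2 0 0 1).sub (hh 1 1 1))).trans ?_
    rw [partials_sub a b (c2 0 0 1) (hh 1 1 1), partials_const_mul a b 2 (hh 0 0 1), p11, p01]
    rfl
  · refine (partials_add a b (hSi 3) (hh 0 1 1)).trans ?_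
    rw [p11]
    rfl

/-- The map `x ↦ x + O(|x|ᵏ⁺²)` with the derivatives `ξ` of order `k + 2`. -/
def shiftMap (k : ℕ) (ξ : Fin 2 → ℕ → ℕ → ℝ) : Plane → Plane :=
  polyMap (k + 2) fun m a b => if a + b = k + 2 then ξ m a b
    else if (a, b) = (if m = 0 then (1, 0) else (0, 1)) then 1 else 0

theorem contDiff_shiftMap (k : ℕ) (ξ : Fin 2 → ℕ → ℕ → ℝ) : ContDiff ℝ ∞ (shiftMap k ξ) :=
  contDiff_polyMap (k + 2) _

theorem shiftMap_contact (k : ℕ) (ξ : Fin 2 → ℕ → ℕ → ℝ) (m : Fin 2) :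
    Contact (k + 2) 0 (fun z => shiftMap k ξ z m) (fun z => z m) := by
  refine ⟨contDiffAt_pi.1 (contDiff_shiftMap k ξ).contDiffAt m, contDiffAt_coord m 0,
    fun a b hab => ?_⟩
  rw [partials_coord]
  refine (partials_polyMap (k + 2) _ m hab.le).trans ?_
  rw [if_neg hab.ne]

theorem jet_pull_shiftMap {k K : ℕ} (ξ : Fin 2 → ℕ → ℕ → ℝ) {S : Plane → Fibre}
    (hS : ContDiff ℝ ∞ S) (i : Fin 4) (a b : ℕ) (h : a + b ≤ K) (hk : a + b ≤ k) :
    (jet K (pull (shiftMap k ξ) S) 0).u i a b h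
      = (jet K S 0).u i a b h + if a + b = k then coeffShift ξ i a b else 0 := by
  have hc := shiftMap_contact k ξ
  rw [jet_u, jet_u, partials_pull_of_contact_id (contDiff_shiftMap k ξ) hS
    (funext fun m => (hc m).value) hc i hk]
  congr 1
  -- Orders a' + b' ≥ 2 do not see the linear part of the map, so the derivatives vanish unless the
  -- order is exactly k + 2.
  have hp : ∀ m a' b', a' + b' = a + b + 2 → partials a' b' (fun z => shiftMap k ξ z m) 0
      = if a + b = k then ξ m a' b' else 0 := by
    intro m a' b' h'
    refine (partials_polyMap (k + 2) _ m (by omega)).trans ?_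
    by_cases e : a + b = k
    · rw [if_pos (by omega), if_pos e]
    · rw [if_neg (by omega), if_neg e, if_neg]
      intro e'
      split at e' <;> simp only [Prod.mk.injEq] at e' <;> omega
  simp only [coeffShift, hp _ (a + 2) b (by omega), hp _ (a + 1) (b + 1) (by omega),
    hp _ a (b + 2) (by omega)]
  split
  · rfl
  · fin_cases i <;> simp

theorem jac_shiftMap (k : ℕ) (ξ : Fin 2 → ℕ → ℕ → ℝ) : jac (shiftMap k ξ) 0 = 1 := by
  simp [jac, det2, ((shiftMap_contact k ξ _).pderiv _).value, pderiv_coord]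

theorem shiftMap_zero (k : ℕ) (ξ : Fin 2 → ℕ → ℕ → ℝ) : shiftMap k ξ 0 = 0 :=
  funext fun m => (shiftMap_contact k ξ m).value

theorem pderiv_shiftMap (k : ℕ) (ξ : Fin 2 → ℕ → ℕ → ℝ) (m j : Fin 2) :
    pderiv j (fun z => shiftMap k ξ z m) 0 = if m = j then 1 else 0 := by
  rw [((shiftMap_contact k ξ m).pderiv j).value, pderiv_coord]

theorem pderiv_pderiv_shiftMap (k : ℕ) (ξ : Fin 2 → ℕ → ℕ → ℝ) (m j l : Fin 2) :
    pderiv l (pderiv j fun z => shiftMap (k + 1) ξ z m) 0 = 0 := by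
  have hd : pderiv j (fun z => z m) = fun _ => if m = j then 1 else 0 :=
    funext fun p => pderiv_coord j m p
  rw [(((shiftMap_contact (k + 1) ξ m).pderiv j).pderiv l).value, hd, pderiv_const]

theorem exists_mem_orbit_shift {K : ℕ} (k : ℕ) (ξ : Fin 2 → ℕ → ℕ → ℝ) (θ : JetSpace K)
    (hθ : θ.1 = 0) : ∃ θ' ∈ orbit K θ, θ'.1 = 0 ∧
      ∀ i a b (h : a + b ≤ K), a + b ≤ k →
        θ'.u i a b h = θ.u i a b h + if a + b = k then coeffShift ξ i a b else 0 := by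
  obtain ⟨S, hS, e⟩ := exists_jet_eq θ
  rw [hθ] at e
  refine ⟨jet K (pull (shiftMap k ξ) S) 0, ?_, rfl, fun i a b h hk => ?_⟩
  · have := jet_pull_mem_orbit (k := K) (q := 0) (contDiff_shiftMap k ξ) hS
      (by simp [jac_shiftMap])
    rwa [shiftMap_zero, e] at this
  · rw [jet_pull_shiftMap ξ hS i a b h hk, e]

theorem exists_mem_orbit_shift_two (k : ℕ) (ξ : Fin 2 → ℕ → ℕ → ℝ) (θ : JetSpace 2)
    (hθ : θ.1 = 0) : ∃ θ' ∈ orbit 2 θ, θ'.1 = 0 ∧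
      (∀ i a b (h : a + b ≤ 2), a + b ≤ k →
        θ'.u i a b h = θ.u i a b h + if a + b = k then coeffShift ξ i a b else 0) ∧
      ∀ j, curv j θ' = curv j θ := by
  obtain ⟨S, hS, e⟩ := exists_jet_eq θ
  rw [hθ] at e
  have hj : jac (shiftMap k ξ) 0 ≠ 0 := by simp [jac_shiftMap]
  refine ⟨jet 2 (pull (shiftMap k ξ) S) 0, ?_, rfl, fun i a b h hk => ?_, fun j => ?_⟩
  · have := jet_pull_mem_orbit (k := 2) (q := 0) (contDiff_shiftMap k ξ) hS hj
    rwa [shiftMap_zero, e] at this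
  · rw [jet_pull_shiftMap ξ hS i a b h hk, e]
  · rw [covariant (contDiff_shiftMap k ξ).contDiffAt hj S hS.contDiffAt, shiftMap_zero, e,
      jac_shiftMap, pderiv_shiftMap, pderiv_shiftMap]
    fin_cases j <;> simp

/-- The Jacobian matrix at the origin is the identity, which fixes F¹, F². The derivatives D_l Fʲ
also feel the second derivatives of the map, and these vanish only for k ≠ 0. -/
theorem exists_mem_orbit_shift_three (k : ℕ) (ξ : Fin 2 → ℕ → ℕ → ℝ) (θ : JetSpace 3)
    (hθ : θ.1 = 0) : ∃ θ' ∈ orbit 3 θ, θ'.1 = 0 ∧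
      (∀ i a b (h : a + b ≤ 3), a + b ≤ k →
        θ'.u i a b h = θ.u i a b h + if a + b = k then coeffShift ξ i a b else 0) ∧
      (∀ j, curv j (proj θ') = curv j (proj θ)) ∧
      (k ≠ 0 → ∀ l j, totalDeriv l (curv j) θ' = totalDeriv l (curv j) θ) := by
  obtain ⟨S, hS, e⟩ := exists_jet_eq θ
  rw [hθ] at e
  have e2 : (proj θ : JetSpace 2) = jet 2 S 0 := by rw [← e]; rfl
  have hj : jac (shiftMap k ξ) 0 ≠ 0 := by simp [jac_shiftMap]
  have hg := contDiff_shiftMap k ξ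
  refine ⟨jet 3 (pull (shiftMap k ξ) S) 0, ?_, rfl, fun i a b h hk => ?_, fun j => ?_,
    fun hk l j => ?_⟩
  · have := jet_pull_mem_orbit (k := 3) (q := 0) hg hS hj
    rwa [shiftMap_zero, e] at this
  · rw [jet_pull_shiftMap ξ hS i a b h hk, e]
  · have := covariant hg.contDiffAt hj S hS.contDiffAt j
    rw [shiftMap_zero, ← e2, jac_shiftMap, pderiv_shiftMap, pderiv_shiftMap] at this
    refine Eq.trans this ?_
    fin_cases j <;> simp
  · obtain ⟨k, rfl⟩ := Nat.exists_eq_succ_of_ne_zero hk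
    rw [totalDeriv_curv_jet_pull (.of_forall fun z => hg.contDiffAt)
      (.of_forall fun z => hS.contDiffAt) hj, pderiv_jac hg.contDiffAt]
    simp only [Nat.succ_eq_add_one, pderiv_shiftMap, pderiv_pderiv_shiftMap, shiftMap_zero,
      jac_shiftMap, e, ← e2]
    fin_cases j <;> fin_cases l <;> simp

/-! ### Normal forms -/

/-- Four equations in six unknowns; the mixed second derivatives are set to zero. -/
theorem exists_coeffShift_zero (v : Fin 4 → ℕ → ℕ → ℝ) :
    ∃ ξ, ∀ i, v i 0 0 + coeffShift ξ i 0 0 = 0 := by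
  refine ⟨fun m a b =>
    if m = 0 then (if (a, b) = (2, 0) then -v 1 0 0 else if (a, b) = (0, 2) then -v 3 0 0 else 0)
    else (if (a, b) = (2, 0) then v 0 0 0 else if (a, b) = (0, 2) then v 2 0 0 else 0),
    fun i => ?_⟩
  fin_cases i <;> simp [coeffShift]

theorem exists_coeffShift_one (v : Fin 4 → ℕ → ℕ → ℝ) :
    ∃ ξ, ∀ i, v i 1 0 + coeffShift ξ i 1 0 = 0 ∧ v i 0 1 + coeffShift ξ i 0 1 = 0 := by
  -- Eight equations in eight unknowns. The only coupled pair is that for u²₂ and u³₁, in the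
  -- unknowns `ξ 0 2 1` and `ξ 1 1 2`; its determinant 3 is the denominator.
  refine ⟨fun m a b =>
    if m = 0 then
      (if (a, b) = (3, 0) then 2 * v 0 0 1 - v 1 1 0
      else if (a, b) = (2, 1) then (v 1 0 1 - 2 * v 2 1 0) / 3
      else if (a, b) = (1, 2) then -v 3 1 0 else -v 3 0 1)
    else
      (if (a, b) = (3, 0) then v 0 1 0 else if (a, b) = (2, 1) then v 0 0 1
      else if (a, b) = (1, 2) then (2 * v 1 0 1 - v 2 1 0) / 3
      else v 2 0 1 - 2 * v 3 1 0), fun i => ?_⟩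
  fin_cases i <;> simp [coeffShift] <;> ring_nf
  simp

theorem exists_coeffShift_two (v : Fin 4 → ℕ → ℕ → ℝ) :
    ∃ ξ, ∀ i a b, a + b = 2 → (i, a, b) ≠ (1, 0, 2) → (i, a, b) ≠ (2, 2, 0) →
      v i a b + coeffShift ξ i a b = 0 := by
  -- The equations for u¹ and u⁴ fix `ξ 1 (a + 2) b` and `ξ 0 a (b + 2)`. The four remaining
  -- unknowns solve the equations for u²₁₁, u²₁₂, u³₁₂, u³₂₂, and nothing is left for u²₂₂ and u³₁₁.
  -- Order three is handled in the same way, with four equations left over.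
  refine ⟨fun m a b =>
    if m = 0 then
      (if (a, b) = (4, 0) then 2 * v 0 1 1 - v 1 2 0
      else if (a, b) = (3, 1) then 2 * v 0 0 2 - v 1 1 1 else -v 3 a (b - 2))
    else
      (if (a, b) = (1, 3) then v 2 1 1 - 2 * v 3 2 0
      else if (a, b) = (0, 4) then v 2 0 2 - 2 * v 3 1 1 else v 0 (a - 2) b),
    fun i a b h h1 h2 => ?_⟩
  obtain ⟨rfl, rfl⟩ | ⟨rfl, rfl⟩ | ⟨rfl, rfl⟩ :
      (a = 2 ∧ b = 0) ∨ (a = 1 ∧ b = 1) ∨ (a = 0 ∧ b = 2) := by omega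
  all_goals fin_cases i <;> simp [coeffShift] at h1 h2 ⊢ <;> ring

theorem exists_coeffShift_three (v : Fin 4 → ℕ → ℕ → ℝ) :
    ∃ ξ, ∀ i a b, a + b = 3 → (i, a, b) ≠ (1, 1, 2) → (i, a, b) ≠ (1, 0, 3) →
      (i, a, b) ≠ (2, 3, 0) → (i, a, b) ≠ (2, 2, 1) → v i a b + coeffShift ξ i a b = 0 := by
  refine ⟨fun m a b =>
    if m = 0 then
      (if (a, b) = (5, 0) then 2 * v 0 2 1 - v 1 3 0
      else if (a, b) = (4, 1) then 2 * v 0 1 2 - v 1 2 1 else -v 3 a (b - 2))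
    else
      (if (a, b) = (1, 4) then v 2 1 2 - 2 * v 3 2 1
      else if (a, b) = (0, 5) then v 2 0 3 - 2 * v 3 1 2 else v 0 (a - 2) b),
    fun i a b h h1 h2 h3 h4 => ?_⟩
  obtain ⟨rfl, rfl⟩ | ⟨rfl, rfl⟩ | ⟨rfl, rfl⟩ | ⟨rfl, rfl⟩ :
      (a = 3 ∧ b = 0) ∨ (a = 2 ∧ b = 1) ∨ (a = 1 ∧ b = 2) ∨ (a = 0 ∧ b = 3) := by omega
  all_goals fin_cases i <;> simp [coeffShift] at h1 h2 h3 h4 ⊢ <;> ring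

theorem JetSpace.ext_u {k : ℕ} {θ θ' : JetSpace k} (h1 : θ.1 = θ'.1)
    (h2 : ∀ i a b (h : a + b ≤ k), θ.u i a b h = θ'.u i a b h) : θ = θ' :=
  Prod.ext h1 (funext fun σ => funext fun i => h2 i σ.1.1 σ.1.2 σ.2)

/-- The coordinates of a jet, extended by zero. -/
def JetSpace.coord {k : ℕ} (θ : JetSpace k) (i : Fin 4) (a b : ℕ) : ℝ :=
  if h : a + b ≤ k then θ.u i a b h else 0

theorem JetSpace.coord_eq {k : ℕ} (θ : JetSpace k) (i : Fin 4) (a b : ℕ) (h : a + b ≤ k) :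
    θ.coord i a b = θ.u i a b h := dif_pos h

/-! ### Transitivity on J⁰π and J¹π -/

theorem zero_mem_orbit_zero (θ : JetSpace 0) : (0 : JetSpace 0) ∈ orbit 0 θ := by
  have h1 := exists_mem_orbit_translate θ
  set θ₁ : JetSpace 0 := (0, θ.2)
  obtain ⟨ξ, hξ⟩ := exists_coeffShift_zero θ₁.coord
  obtain ⟨θ₂, h2, z2, u2⟩ := exists_mem_orbit_shift 0 ξ θ₁ rfl
  have : θ₂ = 0 := by
    refine JetSpace.ext_u z2 fun i a b h => ?_
    obtain ⟨rfl, rfl⟩ : a = 0 ∧ b = 0 := by omega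
    rw [u2 i 0 0 h h, if_pos rfl, ← JetSpace.coord_eq, hξ]
    rfl
  exact this ▸ mem_orbit_trans h1 h2

/-- The orders are normalised in increasing succession, because a shift of order k leaves the lower
orders untouched. -/
theorem zero_mem_orbit_one (θ : JetSpace 1) : (0 : JetSpace 1) ∈ orbit 1 θ := by
  have h1 := exists_mem_orbit_translate θ
  set θ₁ : JetSpace 1 := (0, θ.2)
  obtain ⟨ξ, hξ⟩ := exists_coeffShift_zero θ₁.coord
  obtain ⟨θ₂, h2, z2, u2⟩ := exists_mem_orbit_shift 0 ξ θ₁ rfl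
  obtain ⟨η, hη⟩ := exists_coeffShift_one θ₂.coord
  obtain ⟨θ₃, h3, z3, u3⟩ := exists_mem_orbit_shift 1 η θ₂ z2
  have : θ₃ = 0 := by
    refine JetSpace.ext_u z3 fun i a b h => ?_
    rw [u3 i a b h h, ← JetSpace.coord_eq]
    obtain ⟨rfl, rfl⟩ | ⟨rfl, rfl⟩ | ⟨rfl, rfl⟩ :
      (a = 0 ∧ b = 0) ∨ (a = 1 ∧ b = 0) ∨ (a = 0 ∧ b = 1) := by omega
    · rw [if_neg (by omega), JetSpace.coord_eq _ _ _ _ h, u2 i 0 0 h le_rfl, if_pos rfl,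
        ← JetSpace.coord_eq, hξ]
      exact add_zero 0
    · rw [if_pos rfl, (hη i).1]
      rfl
    · rw [if_pos rfl, (hη i).2]
      rfl
  exact this ▸ mem_orbit_trans (mem_orbit_trans h1 h2) h3

theorem isOrbit_zero : IsOrbit 0 Set.univ :=
  isOrbit_of_invariant_of_transitive (Set.mem_univ 0) (fun _ _ => Set.subset_univ _)
    fun θ _ => zero_mem_orbit_zero θ

theorem isOrbit_one : IsOrbit 1 Set.univ :=
  isOrbit_of_invariant_of_transitive (Set.mem_univ 0) (fun _ _ => Set.subset_univ _)
    fun θ _ => zero_mem_orbit_one θ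

/-- All the coordinates vanish except for those on which `F¹`, `F²` depend linearly. -/
def IsNormalTwo (θ : JetSpace 2) : Prop :=
  θ.1 = 0 ∧ ∀ i a b (h : a + b ≤ 2), (i, a, b) ≠ (1, 0, 2) → (i, a, b) ≠ (2, 2, 0) →
    θ.u i a b h = 0

theorem curv_translate (θ : JetSpace 2) (p : Plane) (j : Fin 2) :
    curv j (p, θ.2) = curv j θ := by
  fin_cases j <;> rfl

theorem exists_isNormalTwo (θ : JetSpace 2) :
    ∃ θ' ∈ orbit 2 θ, IsNormalTwo θ' ∧ ∀ j, curv j θ' = curv j θ := by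
  have h1 := exists_mem_orbit_translate θ
  have c1 := curv_translate θ 0
  set θ₁ : JetSpace 2 := (0, θ.2)
  obtain ⟨ξ, hξ⟩ := exists_coeffShift_zero θ₁.coord
  obtain ⟨θ₂, h2, z2, u2, c2⟩ := exists_mem_orbit_shift_two 0 ξ θ₁ rfl
  obtain ⟨η, hη⟩ := exists_coeffShift_one θ₂.coord
  obtain ⟨θ₃, h3, z3, u3, c3⟩ := exists_mem_orbit_shift_two 1 η θ₂ z2
  obtain ⟨ζ, hζ⟩ := exists_coeffShift_two θ₃.coord
  obtain ⟨θ₄, h4, z4, u4, c4⟩ := exists_mem_orbit_shift_two 2 ζ θ₃ z3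
  refine ⟨θ₄, mem_orbit_trans (mem_orbit_trans (mem_orbit_trans h1 h2) h3) h4,
    ⟨z4, fun i a b h n1 n2 => ?_⟩, fun j => by rw [c4, c3, c2, c1]⟩
  rw [u4 i a b h h]
  rcases (by omega : a + b = 2 ∨ a + b = 1 ∨ a + b = 0) with e | e | e
  · rw [if_pos e, ← JetSpace.coord_eq, hζ i a b e n1 n2]
  · rw [if_neg (by omega), u3 i a b h e.le, if_pos e, ← JetSpace.coord_eq, add_zero]
    obtain ⟨rfl, rfl⟩ | ⟨rfl, rfl⟩ : (a = 1 ∧ b = 0) ∨ (a = 0 ∧ b = 1) := by omega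
    exacts [(hη i).1, (hη i).2]
  · obtain ⟨rfl, rfl⟩ : a = 0 ∧ b = 0 := by omega
    rw [if_neg (by omega), u3 i 0 0 h (by omega), if_neg (by omega), u2 i 0 0 h le_rfl, if_pos rfl,
      ← JetSpace.coord_eq, hξ]
    simp

/-- In normal form F¹ = u³₁₁ and F² = u²₂₂, so the two surviving coordinates are recovered. -/
theorem IsNormalTwo.ext {θ θ' : JetSpace 2} (h : IsNormalTwo θ) (h' : IsNormalTwo θ')
    (hc : ∀ j, curv j θ = curv j θ') : θ = θ' := by
  have key : ∀ {θ : JetSpace 2}, IsNormalTwo θ → F1 θ = θ.u 2 2 0 ∧ F2 θ = θ.u 1 0 2 := by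
    intro θ h
    have hz := h.2
    constructor
    · simp [F1, hz]
    · simp [F2, hz]
  have e1 : F1 θ = F1 θ' := hc 0
  have e2 : F2 θ = F2 θ' := hc 1
  rw [(key h).1, (key h').1] at e1
  rw [(key h).2, (key h').2] at e2
  refine JetSpace.ext_u (h.1.trans h'.1.symm) fun i a b hab => ?_
  by_cases n1 : (i, a, b) = (1, 0, 2)
  · simp only [Prod.mk.injEq] at n1
    obtain ⟨rfl, rfl, rfl⟩ := n1
    exact e2
  by_cases n2 : (i, a, b) = (2, 2, 0)
  · simp only [Prod.mk.injEq] at n2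
    obtain ⟨rfl, rfl, rfl⟩ := n2
    exact e1
  rw [h.2 i a b hab n1 n2, h'.2 i a b hab n1 n2]

theorem mem_orbit_two_of_curv_eq {θ θ' : JetSpace 2} (hc : ∀ j, curv j θ = curv j θ') :
    θ' ∈ orbit 2 θ := by
  obtain ⟨η, h, n, e⟩ := exists_isNormalTwo θ
  obtain ⟨η', h', n', e'⟩ := exists_isNormalTwo θ'
  have : η = η' := n.ext n' fun j => by rw [e, e', hc]
  subst this
  exact mem_orbit_trans h (mem_orbit_symm h')

/-- A linear change of coordinates brings a non-zero covector density to `(1, 0)`. -/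
theorem exists_covector_eq (f0 f1 : ℝ) (h : f0 ≠ 0 ∨ f1 ≠ 0) :
    ∃ d : Fin 2 → Fin 2 → ℝ, det2 d ≠ 0 ∧ det2 d * (d 0 0 * f0 + d 1 0 * f1) = 1 ∧
      det2 d * (d 0 1 * f0 + d 1 1 * f1) = 0 := by
  by_cases h0 : f0 = 0
  · have h1 : f1 ≠ 0 := h.resolve_left (not_not_intro h0)
    refine ⟨![![0, -f1⁻¹], ![1, 0]], ?_, ?_, ?_⟩ <;> simp [det2, h0, h1]
  -- The second column spans the kernel of the covector and is scaled so that the determinant is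
  -- 1/f0.
  · refine ⟨![![1, -f1 * (f0 ^ 2)⁻¹], ![0, f0 * (f0 ^ 2)⁻¹]], ?_, ?_, ?_⟩ <;>
      simp [det2, h0] <;> field_simp
    ring

theorem curv_eq_zero_of_mem_orbit {θ θ' : JetSpace 2} (h : θ' ∈ orbit 2 θ)
    (h0 : curv 0 θ = 0) (h1 : curv 1 θ = 0) (j : Fin 2) : curv j θ' = 0 := by
  obtain ⟨f, hf, hl⟩ := h
  obtain ⟨hg, hj, e, S, hS, e1, e2⟩ := hl.pullsBack hf
  have := covariant hg hj S (e ▸ hS.self_of_nhds) j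
  rw [e2, ← e, e1, h0, h1] at this
  simpa using this

theorem F3_ne_zero_of_mem_orbit {θ θ' : JetSpace 3} (h : θ' ∈ orbit 3 θ) (h0 : F3 θ ≠ 0) :
    F3 θ' ≠ 0 := by
  obtain ⟨f, hf, hl⟩ := h
  have hl' := hl
  obtain ⟨hg, hj, e, S, hS, e1, e2⟩ := hl.pullsBack hf
  have ht : θ'.1 ∈ f.target := by
    obtain ⟨hp, -, -, -, -, -, -, rfl⟩ := hl'
    exact f.map_source hp
  have hg' : ∀ᶠ z in 𝓝 θ'.1, ContDiffAt ℝ ∞ f.symm z := by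
    filter_upwards [f.open_target.mem_nhds ht] with z hz using hf.contDiffAt_symm hz
  have := F3_jet_pull hg' (e ▸ hS) hj
  rw [e2, ← e, e1] at this
  rw [this]
  exact mul_ne_zero (pow_ne_zero 5 hj) h0

theorem F_ne_zero_iff (θ : JetSpace 2) :
    (F1 θ, F2 θ) ≠ (0, 0) ↔ curv 0 θ ≠ 0 ∨ curv 1 θ ≠ 0 := by
  change ¬((F1 θ, F2 θ) = (0, 0)) ↔ F1 θ ≠ 0 ∨ F2 θ ≠ 0
  rw [Prod.mk.injEq, not_and_or]

theorem isOrbit_degenerate : IsOrbit 2 {θ : JetSpace 2 | F1 θ = 0 ∧ F2 θ = 0} := by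
  refine isOrbit_of_invariant_of_transitive (θ₀ := 0) ?_ (fun θ hθ θ' h => ?_) fun θ hθ => ?_
  · have : ∀ i a b (h : a + b ≤ 2), (0 : JetSpace 2).u i a b h = 0 := fun _ _ _ _ => rfl
    constructor
    · simp [F1, this]
    · simp [F2, this]
  · exact ⟨curv_eq_zero_of_mem_orbit h hθ.1 hθ.2 0, curv_eq_zero_of_mem_orbit h hθ.1 hθ.2 1⟩
  · refine mem_orbit_two_of_curv_eq fun j => ?_
    have : ∀ i a b (h : a + b ≤ 2), (0 : JetSpace 2).u i a b h = 0 := fun _ _ _ _ => rfl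
    fin_cases j
    · refine Eq.trans hθ.1 ?_
      simp [curv, F1, this]
    · refine Eq.trans hθ.2 ?_
      simp [curv, F2, this]

theorem curv_unitJet : curv 0 (unitJet 2 2 2 0) = 1 ∧ curv 1 (unitJet 2 2 2 0) = 0 := by
  constructor
  · simp [curv, F1]
  · simp [curv, F2]

theorem isOrbit_F_ne_zero : IsOrbit 2 {θ : JetSpace 2 | (F1 θ, F2 θ) ≠ (0, 0)} := by
  simp only [F_ne_zero_iff]
  refine isOrbit_of_invariant_of_transitive (θ₀ := unitJet 2 2 2 0) ?_ (fun θ hθ θ' h => ?_)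
    fun θ hθ => ?_
  · exact Or.inl (by rw [curv_unitJet.1]; exact one_ne_zero)
  · by_contra h'
    simp only [Set.mem_ofPred_eq, not_or, not_not] at h'
    have hc := curv_eq_zero_of_mem_orbit (mem_orbit_symm h) h'.1 h'.2
    rcases hθ with hθ | hθ
    exacts [hθ (hc 0), hθ (hc 1)]
  · have h1 := exists_mem_orbit_translate θ
    have c1 := curv_translate θ 0
    set θ₁ : JetSpace 2 := (0, θ.2)
    obtain ⟨d, hd, e0, e1⟩ := exists_covector_eq _ _ hθ
    obtain ⟨θ₂, h2, -, c2⟩ := exists_mem_orbit_two θ₁ rfl d hd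
    refine mem_orbit_trans (mem_orbit_trans h1 h2) (mem_orbit_two_of_curv_eq fun j => ?_)
    rw [c2, c1, c1]
    fin_cases j
    exacts [e0.trans curv_unitJet.1.symm, e1.trans curv_unitJet.2.symm]

/-- All the coordinates vanish except for those on which `Fʲ`, `D_l Fʲ` depend linearly. -/
def IsNormalThree (θ : JetSpace 3) : Prop :=
  θ.1 = 0 ∧ ∀ i a b (h : a + b ≤ 3), (i, a, b) ≠ (1, 0, 2) → (i, a, b) ≠ (2, 2, 0) →
    (i, a, b) ≠ (1, 1, 2) → (i, a, b) ≠ (1, 0, 3) → (i, a, b) ≠ (2, 3, 0) →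
    (i, a, b) ≠ (2, 2, 1) → θ.u i a b h = 0

/-- Order zero must be normalised beforehand, since a shift of order zero would change D_l Fʲ; the
shifts of orders 1 to 3 preserve it. -/
theorem exists_isNormalThree (θ : JetSpace 3) (hθ : θ.1 = 0) (hu : ∀ i, θ.u i 0 0 = 0) :
    ∃ θ' ∈ orbit 3 θ, IsNormalThree θ' ∧ (∀ j, curv j (proj θ') = curv j (proj θ)) ∧
      ∀ l j, totalDeriv l (curv j) θ' = totalDeriv l (curv j) θ := by
  obtain ⟨η, hη⟩ := exists_coeffShift_one θ.coord
  obtain ⟨θ₁, h1, z1, u1, c1, d1⟩ := exists_mem_orbit_shift_three 1 η θ hθ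
  obtain ⟨ζ, hζ⟩ := exists_coeffShift_two θ₁.coord
  obtain ⟨θ₂, h2, z2, u2, c2, d2⟩ := exists_mem_orbit_shift_three 2 ζ θ₁ z1
  obtain ⟨ξ, hξ⟩ := exists_coeffShift_three θ₂.coord
  obtain ⟨θ₃, h3, z3, u3, c3, d3⟩ := exists_mem_orbit_shift_three 3 ξ θ₂ z2
  refine ⟨θ₃, mem_orbit_trans (mem_orbit_trans h1 h2) h3,
    ⟨z3, fun i a b h n1 n2 n3 n4 n5 n6 => ?_⟩, fun j => by rw [c3, c2, c1],
    fun l j => by rw [d3 (by simp), d2 (by simp), d1 (by simp)]⟩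
  rw [u3 i a b h h]
  rcases (by omega : a + b = 3 ∨ a + b = 2 ∨ a + b = 1 ∨ a + b = 0) with e | e | e | e
  · rw [if_pos e, ← JetSpace.coord_eq, hξ i a b e n3 n4 n5 n6]
  · rw [if_neg (by omega), u2 i a b h e.le, if_pos e, ← JetSpace.coord_eq, hζ i a b e n1 n2,
      add_zero]
  · rw [if_neg (by omega), u2 i a b h (by omega), if_neg (by omega), u1 i a b h e.le, if_pos e,
      ← JetSpace.coord_eq, add_zero, add_zero]
    obtain ⟨rfl, rfl⟩ | ⟨rfl, rfl⟩ : (a = 1 ∧ b = 0) ∨ (a = 0 ∧ b = 1) := by omega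
    exacts [(hη i).1, (hη i).2]
  · obtain ⟨rfl, rfl⟩ : a = 0 ∧ b = 0 := by omega
    rw [if_neg (by omega), u2 i 0 0 h (by omega), if_neg (by omega), u1 i 0 0 h (by omega),
      if_neg (by omega), hu]
    simp

/-- The six surviving coordinates are recovered from Fʲ and D_l Fʲ. Four of them appear directly;
u²₁₂₂ and u³₁₁₂ are found from D₂F¹ = u³₁₁₂ - 2u²₁₂₂ and D₁F² = u²₁₂₂ - 2u³₁₁₂, a non-degenerate
system. -/
theorem IsNormalThree.ext {θ θ' : JetSpace 3} (h : IsNormalThree θ) (h' : IsNormalThree θ')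
    (hc : ∀ j, curv j (proj θ) = curv j (proj θ'))
    (hd : ∀ l j, totalDeriv l (curv j) θ = totalDeriv l (curv j) θ') : θ = θ' := by
  have key : ∀ {θ : JetSpace 3}, IsNormalThree θ →
      (curv 0 (proj θ) = θ.u 2 2 0 ∧ curv 1 (proj θ) = θ.u 1 0 2) ∧
      (totalDeriv 0 (curv 0) θ = θ.u 2 3 0 ∧
        totalDeriv 1 (curv 0) θ = θ.u 2 2 1 - 2 * θ.u 1 1 2) ∧
      (totalDeriv 0 (curv 1) θ = θ.u 1 1 2 - 2 * θ.u 2 2 1 ∧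
        totalDeriv 1 (curv 1) θ = θ.u 1 0 3) := by
    intro θ h
    have hz := h.2
    have c0 : curv 0 = F1 := rfl
    have c1 : curv 1 = F2 := rfl
    refine ⟨⟨?_, ?_⟩, ⟨?_, ?_⟩, ?_, ?_⟩
    · simp [c0, F1, hz]
    · simp [c1, F2, hz]
    · simp [c0, totalDeriv_eq, fderiv_F1, totalVector_zero_u, hz]
    · simp [c0, totalDeriv_eq, fderiv_F1, totalVector_one_u, hz]
      ring
    · simp [c1, totalDeriv_eq, fderiv_F2, totalVector_zero_u, hz]
    · simp [c1, totalDeriv_eq, fderiv_F2, totalVector_one_u, hz]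
  have e0 := hc 0
  have e1 := hc 1
  have e00 := hd 0 0
  have e10 := hd 1 0
  have e01 := hd 0 1
  have e11 := hd 1 1
  rw [(key h).1.1, (key h').1.1] at e0
  rw [(key h).1.2, (key h').1.2] at e1
  rw [(key h).2.1.1, (key h').2.1.1] at e00
  rw [(key h).2.1.2, (key h').2.1.2] at e10
  rw [(key h).2.2.1, (key h').2.2.1] at e01
  rw [(key h).2.2.2, (key h').2.2.2] at e11
  refine JetSpace.ext_u (h.1.trans h'.1.symm) fun i a b hab => ?_
  by_cases n1 : (i, a, b) = (1, 0, 2)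
  · simp only [Prod.mk.injEq] at n1
    obtain ⟨rfl, rfl, rfl⟩ := n1
    exact e1
  by_cases n2 : (i, a, b) = (2, 2, 0)
  · simp only [Prod.mk.injEq] at n2
    obtain ⟨rfl, rfl, rfl⟩ := n2
    exact e0
  by_cases n3 : (i, a, b) = (1, 1, 2)
  · simp only [Prod.mk.injEq] at n3
    obtain ⟨rfl, rfl, rfl⟩ := n3
    linarith
  by_cases n4 : (i, a, b) = (1, 0, 3)
  · simp only [Prod.mk.injEq] at n4
    obtain ⟨rfl, rfl, rfl⟩ := n4
    exact e11
  by_cases n5 : (i, a, b) = (2, 3, 0)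
  · simp only [Prod.mk.injEq] at n5
    obtain ⟨rfl, rfl, rfl⟩ := n5
    exact e00
  by_cases n6 : (i, a, b) = (2, 2, 1)
  · simp only [Prod.mk.injEq] at n6
    obtain ⟨rfl, rfl, rfl⟩ := n6
    linarith
  rw [h.2 i a b hab n1 n2 n3 n4 n5 n6, h'.2 i a b hab n1 n2 n3 n4 n5 n6]

/-! ### The generic orbit of J³π -/

theorem exists_pow_five_eq (x : ℝ) : ∃ ρ : ℝ, ρ ^ 5 = x := by
  rcases le_total 0 x with h | h
  · exact ⟨x ^ (((5 : ℕ) : ℝ)⁻¹), Real.rpow_inv_natCast_pow h (by norm_num)⟩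
  · refine ⟨-((-x) ^ (((5 : ℕ) : ℝ)⁻¹)), ?_⟩
    rw [Odd.neg_pow (by decide), Real.rpow_inv_natCast_pow (neg_nonneg.2 h) (by norm_num), neg_neg]

theorem transformedCoeffs_zero_linear (d : Fin 2 → Fin 2 → ℝ) :
    transformedCoeffs 0 d 0 = 0 := by
  funext i
  fin_cases i <;> simp [transformedCoeffs]

/-- The jet in `J³π` has the normal form of the generic orbit. -/
def IsGenericNormalThree (θ : JetSpace 3) : Prop :=
  IsNormalThree θ ∧ (curv 0 (proj θ) = 1 ∧ curv 1 (proj θ) = 0) ∧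
    (totalDeriv 0 (curv 0) θ = 0 ∧ totalDeriv 1 (curv 0) θ = 0) ∧
    totalDeriv 0 (curv 1) θ = 0 ∧ totalDeriv 1 (curv 1) θ = -1

theorem IsGenericNormalThree.ext {θ θ' : JetSpace 3} (h : IsGenericNormalThree θ)
    (h' : IsGenericNormalThree θ') : θ = θ' := by
  obtain ⟨n, ⟨a0, a1⟩, ⟨a2, a3⟩, a4, a5⟩ := h
  obtain ⟨n', ⟨b0, b1⟩, ⟨b2, b3⟩, b4, b5⟩ := h'
  refine n.ext n' (Fin.forall_fin_two.2 ⟨a0.trans b0.symm, a1.trans b1.symm⟩)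
    (Fin.forall_fin_two.2 ⟨Fin.forall_fin_two.2 ⟨a2.trans b2.symm, a4.trans b4.symm⟩,
      Fin.forall_fin_two.2 ⟨a3.trans b3.symm, a5.trans b5.symm⟩⟩)

theorem curv_eq_or_of_F3_ne_zero {θ : JetSpace 3} (h : F3 θ ≠ 0) :
    curv 0 (proj θ) ≠ 0 ∨ curv 1 (proj θ) ≠ 0 := by
  by_contra! h'
  refine h ?_
  rw [F3_eq, h'.1, h'.2]
  ring

/-- Once (F¹, F²) = (1, 0) and the coefficients vanish at the point, four parameters ρ, σ, α, β
remain to normalise the four numbers D_l Fʲ. -/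
theorem exists_isGenericNormalThree (θ : JetSpace 3) (hF : F3 θ ≠ 0) :
    ∃ θ' ∈ orbit 3 θ, IsGenericNormalThree θ' := by
  have h1 := exists_mem_orbit_translate θ
  set θ₁ : JetSpace 3 := (0, θ.2)
  have f1 := F3_ne_zero_of_mem_orbit h1 hF
  obtain ⟨d, hd, e0, e1⟩ := exists_covector_eq _ _ (curv_eq_or_of_F3_ne_zero f1)
  obtain ⟨θ₂, h2, z2, -, c2, -⟩ := exists_mem_orbit_three θ₁ rfl d 0 hd fun _ => rfl
  obtain ⟨ξ, hξ⟩ := exists_coeffShift_zero θ₂.coord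
  obtain ⟨θ₃, h3, z3, u3, c3, -⟩ := exists_mem_orbit_shift_three 0 ξ θ₂ z2
  have h13 := mem_orbit_trans (mem_orbit_trans h1 h2) h3
  have f3 := F3_ne_zero_of_mem_orbit h13 hF
  have hu3 : (fun i => θ₃.u i 0 0) = 0 := by
    funext i
    rw [u3 i 0 0 _ le_rfl, if_pos rfl, ← JetSpace.coord_eq, hξ]
    rfl
  have c30 : curv 0 (proj θ₃) = 1 := by rw [c3, c2, e0]
  have c31 : curv 1 (proj θ₃) = 0 := by rw [c3, c2, e1]
  -- For this jet F³ reduces to -D₂F².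
  have hc : totalDeriv 1 (curv 1) θ₃ ≠ 0 := by
    have hz : ∀ i, θ₃.u i 0 0 = 0 := congrFun hu3
    rw [F3_eq, c30, c31] at f3
    simpa [hz] using f3
  -- The linear maps preserving the pair (1, 0) have rows (ρ, 0) and (σ, ρ⁻²), with determinant ρ⁻¹.
  -- They multiply D₂F² by ρ⁻⁵, so ρ can be chosen to make it -1, whatever its sign.
  obtain ⟨ρ, hρ⟩ := exists_pow_five_eq (-totalDeriv 1 (curv 1) θ₃)
  have hρ0 : ρ ≠ 0 := by
    rintro rfl
    apply hc
    linarith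
  -- This σ achieves D₂F¹ = 4 D₁F². The quadratic terms used below add 4β and β to these two
  -- numbers, so a single β then removes both.
  obtain ⟨σ, hσ⟩ : ∃ σ, σ = ρ * (totalDeriv 1 (curv 0) θ₃ - 4 * totalDeriv 0 (curv 1) θ₃)
    / (3 * totalDeriv 1 (curv 1) θ₃) := ⟨_, rfl⟩
  have hσ' : 3 * σ * totalDeriv 1 (curv 1) θ₃
      = ρ * (totalDeriv 1 (curv 0) θ₃ - 4 * totalDeriv 0 (curv 1) θ₃) := by
    rw [hσ]
    field_simp
  have hdet : det2 ![![ρ, 0], ![σ, (ρ ^ 2)⁻¹]] = ρ⁻¹ := by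
    simp [det2]
    field_simp
  obtain ⟨θ₄, h4, z4, u4, c4, d4⟩ := exists_mem_orbit_three θ₃ z3 ![![ρ, 0], ![σ, (ρ ^ 2)⁻¹]] 0
    (by rw [hdet]; exact inv_ne_zero hρ0) fun _ => rfl
  have hu4 : (fun i => θ₄.u i 0 0) = 0 := by
    funext i
    rw [u4, hu3, transformedCoeffs_zero_linear]
  have c40 : curv 0 (proj θ₄) = 1 := by
    rw [c4, hdet, c30, c31]
    simp [hρ0]
  have c41 : curv 1 (proj θ₄) = 0 := by
    rw [c4, hdet, c30, c31]
    simp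
  have d411 : totalDeriv 1 (curv 1) θ₄ = -1 := by
    rw [d4, hdet]
    simp
    field_simp
    linarith
  have d410 : totalDeriv 1 (curv 0) θ₄ = 4 * totalDeriv 0 (curv 1) θ₄ := by
    rw [d4, d4, hdet]
    simp
    field_simp
    linear_combination -hσ'
  -- The quadratic terms with parameters α, β are those of projective maps and keep the coefficients
  -- zero at the point. They add 5α to D₁F¹, 4β to D₂F¹ and β to D₁F², and they do not change D₂F².
  obtain ⟨α, hα⟩ : ∃ α, α = -totalDeriv 0 (curv 0) θ₄ / 5 := ⟨_, rfl⟩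
  obtain ⟨β, hβ⟩ : ∃ β, β = -totalDeriv 0 (curv 1) θ₄ := ⟨_, rfl⟩
  have hid : det2 (fun m j => if m = j then 1 else 0) = 1 := by simp [det2]
  obtain ⟨θ₅, h5, z5, u5, c5, d5⟩ := exists_mem_orbit_three θ₄ z4 (fun m j => if m = j then 1 else 0)
    ![![![2 * α, β], ![β, 0]], ![![0, α], ![α, 2 * β]]] (by rw [hid]; exact one_ne_zero)
    (Fin.forall_fin_two.2 ⟨rfl, rfl⟩)
  have hu5 : ∀ i, θ₅.u i 0 0 = 0 := by
    intro i
    rw [u5, hu4, transformedCoeffs_id]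
    fin_cases i <;> simp
  obtain ⟨θ₆, h6, n6, c6, d6⟩ := exists_isNormalThree θ₅ z5 hu5
  refine ⟨θ₆, mem_orbit_trans (mem_orbit_trans (mem_orbit_trans h13 h4) h5) h6, n6, ⟨?_, ?_⟩,
    ⟨?_, ?_⟩, ?_, ?_⟩
  · simp [c6, c5, hid, c40]
  · simp [c6, c5, hid, c41]
  · simp [d6, d5, hid, c40, c41]
    linarith
  · simp [d6, d5, hid, c40, c41]
    linarith
  · simp [d6, d5, hid, c40, c41]
    linarith
  · simp [d6, d5, hid, c40, c41, d411]

theorem isOrbit_F3_ne_zero : IsOrbit 3 {θ : JetSpace 3 | F3 θ ≠ 0} := by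
  obtain ⟨θ, hθ⟩ := dense_F3_ne_zero.nonempty
  obtain ⟨θ₀, h0, n0⟩ := exists_isGenericNormalThree θ hθ
  refine isOrbit_of_invariant_of_transitive (F3_ne_zero_of_mem_orbit h0 hθ)
    (fun η hη η' h => F3_ne_zero_of_mem_orbit h hη) fun η hη => ?_
  obtain ⟨η₀, h, n⟩ := exists_isGenericNormalThree η hη
  exact n0.ext n ▸ h

end PointODE

end

theorem mainTheorem4 :
    -- `J⁰π` and `J¹π` are orbits
    (PointODE.IsOrbit 0 Set.univ ∧ PointODE.IsOrbit 1 Set.univ) ∧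
    -- `J²π` is the union of two orbits: a generic one and a degenerate one of codimension 2
    ((({θ : PointODE.JetSpace 2 | (PointODE.F1 θ, PointODE.F2 θ) ≠ (0, 0)} ∪
        {θ : PointODE.JetSpace 2 | PointODE.F1 θ = 0 ∧ PointODE.F2 θ = 0}) = Set.univ) ∧
      PointODE.IsGenericOrbit 2
        {θ : PointODE.JetSpace 2 | (PointODE.F1 θ, PointODE.F2 θ) ≠ (0, 0)} ∧
      PointODE.IsOrbit 2 {θ : PointODE.JetSpace 2 | PointODE.F1 θ = 0 ∧ PointODE.F2 θ = 0} ∧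
      PointODE.IsSubmanifoldOfCodim 2
        {θ : PointODE.JetSpace 2 | PointODE.F1 θ = 0 ∧ PointODE.F2 θ = 0} ∧
      -- the equations `F¹ = 0`, `F² = 0` are regular: `dF¹`, `dF²` are independent on the orbit
      (∀ θ : PointODE.JetSpace 2, PointODE.F1 θ = 0 → PointODE.F2 θ = 0 →
        LinearIndependent ℝ ![fderiv ℝ PointODE.F1 θ, fderiv ℝ PointODE.F2 θ])) ∧
    -- `J³π` is a union of orbits, one of which is generic and given by `F³ ≠ 0`
    ((⋃₀ {O : Set (PointODE.JetSpace 3) | PointODE.IsOrbit 3 O}) = Set.univ ∧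
      PointODE.IsGenericOrbit 3 {θ : PointODE.JetSpace 3 | PointODE.F3 θ ≠ 0}) := by
  refine ⟨⟨PointODE.isOrbit_zero, PointODE.isOrbit_one⟩, ⟨?_,
    ⟨PointODE.isOrbit_F_ne_zero, PointODE.isOpen_F_ne_zero, PointODE.dense_F_ne_zero⟩,
    PointODE.isOrbit_degenerate, PointODE.isSubmanifoldOfCodim_degenerate,
    fun θ _ _ => PointODE.linearIndependent_fderiv_F θ⟩, PointODE.sUnion_isOrbit 3,
    PointODE.isOrbit_F3_ne_zero, PointODE.isOpen_F3_ne_zero, PointODE.dense_F3_ne_zero⟩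
  refine Set.eq_univ_of_forall fun θ => ?_
  by_cases h : PointODE.F1 θ = 0 ∧ PointODE.F2 θ = 0
  · exact Or.inr h
  · exact Or.inl fun e => h ⟨congrArg Prod.fst e, congrArg Prod.snd e⟩
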